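/- **Corollary 4.3 (essential spectrum of $\mathcal A$).** Let $m>0$, $\nu\in(-1,1)$, and let $V:\mathbb R\to\mathbb R$ be locally integrable with $$\lim_{|x|\to\infty}\int_x^{x+1}|V(t)|\,dt=0 .$$ Let $H_V=-\frac{d^2}{dx^2}+m^2+V(x)$ be the operator in $L^2(\mathbb R)$ on its maximal domain $$\mathcal D(H_V)=\{f\in L^2(\mathbb R):\ f,f'\in AC_{\rm loc}(\mathbb R),\ -f''+Vf\in L^2(\mathbb R)\},$$ and assume $0\in\rho(H_V)$. In $L^2(\mathbb R)\times L^2(\mathbb R)$ consider the block operator $$\mathcal A_0=\begin{pmatrix} H_V & -\nu\frac{d}{dx}\\ \nu\frac{d}{dx} & I\end{pmatrix},\qquad \mathrm{dom}(\mathcal A_0)=\mathcal D(H_V)\times W^{1,2}(\mathbb R).$$ Then $\mathcal A_0$ is well defined (that is, $\mathcal D(H_V)\subseteq W^{1,2}(\mathbb R)$) and closable, and the essential spectrum of its closure $\mathcal A$, i.e. the set of $z\in\mathbb C$ for which $\mathcal A-z$ is not a Fredholm operator, is $$\sigma_{\rm ess}(\mathcal A)=\begin{cases} [1-\nu^2,1]\cup[m^2,+\infty),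 & m\ge 1,\\ [1-\nu^2,m^2]\cup[1,+\infty), & 1-\nu^2\le m^2<1,\\ [m^2,1-\nu^2]\cup[1,+\infty), & m^2<1-\nu^2. \end{cases}$$ -/

import Mathlib

open MeasureTheory Filter Topology Set
open scoped ContDiff ENNReal

namespace GinzburgLandau

/-! ### Unbounded operators: resolvent set, essential spectrum, block operator matrices -/

section Abstract

variable {H : Type*} [NormedAddCommGroup H] [NormedSpace ℂ H]

/-- The linear map `T - z` on the domain of the unbounded operator `T`. -/
def shift (T : H →ₗ.[ℂ] H) (z : ℂ) : T.domain →ₗ[ℂ] H :=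
  T.toFun - z • T.domain.subtype

/-- The resolvent set: `z ∈ ρ(T)` iff `T - z : dom T → H` has a bounded, everywhere defined
two-sided inverse `R`. -/
def resolventSet (T : H →ₗ.[ℂ] H) : Set ℂ :=
  {z | ∃ R : H →L[ℂ] H,
    (∀ y : H, ∃ x : T.domain, (x : H) = R y ∧ shift T z x = y) ∧
    (∀ x : T.domain, R (shift T z x) = x)}

/-- `T - z` is a Fredholm operator: its kernel has finite dimension, and its range is closed and
has finite codimension. -/
def IsFredholmAt (T : H →ₗ.[ℂ] H) (z : ℂ) : Prop :=
  FiniteDimensional ℂ (LinearMap.ker (shift T z)) ∧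
  IsClosed (LinearMap.range (shift T z) : Set H) ∧
  FiniteDimensional ℂ (H ⧸ LinearMap.range (shift T z))

/-- The essential spectrum of a (closed) operator: the set of all `z ∈ ℂ` such that `T - z` is not
Fredholm. -/
def essentialSpectrum (T : H →ₗ.[ℂ] H) : Set ℂ :=
  {z | ¬ IsFredholmAt T z}

/-- The block operator matrix `(f₁, f₂) ↦ (A f₁ + B f₂, C f₁ + D f₂)` in the Hilbert space direct
sum `H ⊕ H`, on its natural domain `(dom A ∩ dom C) × (dom B ∩ dom D)`. -/
def blockMatrix (A B C D : H →ₗ.[ℂ] H) : WithLp 2 (H × H) →ₗ.[ℂ] WithLp 2 (H × H) where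
  domain := ((A.domain ⊓ C.domain).prod (B.domain ⊓ D.domain)).comap
    (WithLp.linearEquiv 2 ℂ (H × H)).toLinearMap
  toFun := (WithLp.linearEquiv 2 ℂ (H × H)).symm.toLinearMap ∘ₗ
    { toFun := fun f =>
        (A ⟨f.1.fst, f.2.1.1⟩ + B ⟨f.1.snd, f.2.2.1⟩,
         C ⟨f.1.fst, f.2.1.2⟩ + D ⟨f.1.snd, f.2.2.2⟩)
      map_add' := fun f g => by
        have hA := A.map_add ⟨f.1.fst, f.2.1.1⟩ ⟨g.1.fst, g.2.1.1⟩
        have hB := B.map_add ⟨f.1.snd, f.2.2.1⟩ ⟨g.1.snd, g.2.2.1⟩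
        have hC := C.map_add ⟨f.1.fst, f.2.1.2⟩ ⟨g.1.fst, g.2.1.2⟩
        have hD := D.map_add ⟨f.1.snd, f.2.2.2⟩ ⟨g.1.snd, g.2.2.2⟩
        rw [Prod.mk_add_mk, add_add_add_comm, ← hA, ← hB, add_add_add_comm (C _), ← hC, ← hD]
        congr 1
      map_smul' := fun c f => by
        have hA := A.map_smul c ⟨f.1.fst, f.2.1.1⟩
        have hB := B.map_smul c ⟨f.1.snd, f.2.2.1⟩
        have hC := C.map_smul c ⟨f.1.fst, f.2.1.2⟩
        have hD := D.map_smul c ⟨f.1.snd, f.2.2.2⟩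
        rw [RingHom.id_apply, Prod.smul_mk, smul_add, smul_add, ← hA, ← hB, ← hC, ← hD]
        congr 1 }

end Abstract

/-! ### The operators `d/dx` and `-d²/dx² + m² + V` in `L²(ℝ)` -/

/-- The complex Hilbert space `L²(ℝ)`. -/
abbrev L2 : Type := Lp ℂ 2 (volume : Measure ℝ)

theorem integrable_smul_L2 (u : L2) {φ : ℝ → ℝ} (hφ : Continuous φ) (hc : HasCompactSupport φ) :
    Integrable (fun x => φ x • (u x : ℂ)) := by
  have h : LocallyIntegrable (fun x => (u x : ℂ)) volume :=
    (Lp.memLp u).locallyIntegrable (by norm_num)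
  exact h.integrable_smul_left_of_hasCompactSupport hφ hc

/-- `v ∈ L²(ℝ)` is the weak derivative of `u ∈ L²(ℝ)`. -/
def HasWeakDeriv (u v : L2) : Prop :=
  ∀ φ : ℝ → ℝ, ContDiff ℝ ∞ φ → HasCompactSupport φ →
    ∫ x, deriv φ x • (u x : ℂ) = - ∫ x, φ x • (v x : ℂ)

theorem integrable_deriv_smul_L2 (u : L2) {φ : ℝ → ℝ} (hφ : ContDiff ℝ ∞ φ)
    (hc : HasCompactSupport φ) : Integrable (fun x => deriv φ x • (u x : ℂ)) :=
  integrable_smul_L2 u (hφ.continuous_deriv (by simp)) hc.deriv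

theorem integral_smul_L2_add (u u' : L2) {φ : ℝ → ℝ}
    (h : Integrable (fun x => φ x • (u x : ℂ))) (h' : Integrable (fun x => φ x • (u' x : ℂ))) :
    ∫ x, φ x • ((u + u' : L2) x : ℂ) = (∫ x, φ x • (u x : ℂ)) + ∫ x, φ x • (u' x : ℂ) := by
  rw [← integral_add h h']
  refine integral_congr_ae ?_
  filter_upwards [Lp.coeFn_add u u'] with x hx
  rw [hx, Pi.add_apply, smul_add]

theorem integral_smul_L2_smul (c : ℂ) (u : L2) (φ : ℝ → ℝ) :
    ∫ x, φ x • ((c • u : L2) x : ℂ) = c • ∫ x, φ x • (u x : ℂ) := by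
  rw [← integral_smul]
  refine integral_congr_ae ?_
  filter_upwards [Lp.coeFn_smul c u] with x hx
  rw [hx, Pi.smul_apply, smul_comm]

/-- The graph of `d/dx` on `W^{1,2}(ℝ)`. -/
def derivGraph : Submodule ℂ (L2 × L2) where
  carrier := {p | HasWeakDeriv p.1 p.2}
  add_mem' := by
    intro p q hp hq φ hφ hc
    have h1 := integral_smul_L2_add p.1 q.1 (integrable_deriv_smul_L2 p.1 hφ hc)
      (integrable_deriv_smul_L2 q.1 hφ hc)
    have h2 := integral_smul_L2_add p.2 q.2 (integrable_smul_L2 p.2 hφ.continuous hc)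
      (integrable_smul_L2 q.2 hφ.continuous hc)
    rw [Prod.fst_add, Prod.snd_add, h1, h2, hp φ hφ hc, hq φ hφ hc, neg_add]
  zero_mem' := by
    intro φ _ _
    have h1 := integral_smul_L2_smul 0 (0 : L2) (deriv φ)
    have h2 := integral_smul_L2_smul 0 (0 : L2) φ
    simp only [zero_smul] at h1 h2
    rw [Prod.fst_zero, Prod.snd_zero, h1, h2, neg_zero]
  smul_mem' := by
    intro c p hp φ hφ hc
    rw [Prod.smul_fst, Prod.smul_snd, integral_smul_L2_smul, integral_smul_L2_smul, hp φ hφ hc,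
      smul_neg]

/-- The operator `D = d/dx` in `L²(ℝ)` with domain `W^{1,2}(ℝ)`. -/
noncomputable def derivOp : L2 →ₗ.[ℂ] L2 := derivGraph.toLinearPMap

theorem mem_graph_derivOp (u v : L2) : (u, v) ∈ derivOp.graph ↔ HasWeakDeriv u v := by
  have h : derivOp.graph = derivGraph := by
    refine Submodule.toLinearPMap_graph_eq _ ?_
    rintro ⟨u, v⟩ hp (rfl : u = 0)
    have hv : ∀ᵐ x, (v x : ℂ) = 0 := by
      refine ae_eq_zero_of_integral_contDiff_smul_eq_zero
        ((Lp.memLp v).locallyIntegrable (by norm_num)) ?_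
      intro φ hφ hc
      have h1 := integral_smul_L2_smul 0 (0 : L2) (deriv φ)
      simp only [zero_smul] at h1
      have h2 := hp φ hφ hc
      rw [h1] at h2
      exact neg_eq_zero.mp h2.symm
    exact (Lp.eq_zero_iff_ae_eq_zero).2 hv
  rw [h]
  rfl

/-- `f ∈ AC_loc(ℝ)`: absolute continuity on every compact interval. -/
def ACLoc (f : ℝ → ℂ) : Prop := ∀ a b : ℝ, AbsolutelyContinuousOnInterval f a b

theorem ACLoc.continuous {f : ℝ → ℂ} (hf : ACLoc f) : Continuous f := by
  rw [continuous_iff_continuousAt]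
  intro x
  refine (hf (x - 1) (x + 1)).continuousOn.continuousAt ?_
  rw [uIcc_of_le (by linarith)]
  exact Icc_mem_nhds (by linarith) (by linarith)

theorem ACLoc.ae_differentiableAt {f : ℝ → ℂ} (hf : ACLoc f) :
    ∀ᵐ x, DifferentiableAt ℝ f x := by
  have hlip : ∀ {g : ℂ → ℝ}, (∀ z w, dist (g z) (g w) ≤ dist z w) → ∀ a b : ℝ,
      AbsolutelyContinuousOnInterval (g ∘ f) a b := by
    intro g hg a b
    rw [absolutelyContinuousOnInterval_iff]
    intro ε hε
    obtain ⟨δ, hδ, h⟩ := (absolutelyContinuousOnInterval_iff f a b).1 (hf a b) ε hε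
    exact ⟨δ, hδ, fun E hE hlt =>
      (Finset.sum_le_sum fun i _ => hg _ _).trans_lt (h E hE hlt)⟩
  have hre : ∀ z w : ℂ, dist z.re w.re ≤ dist z w := fun z w => by
    rw [Real.dist_eq, Complex.dist_eq, ← Complex.sub_re]; exact Complex.abs_re_le_norm _
  have him : ∀ z w : ℂ, dist z.im w.im ≤ dist z w := fun z w => by
    rw [Real.dist_eq, Complex.dist_eq, ← Complex.sub_im]; exact Complex.abs_im_le_norm _
  have key : ∀ n : ℕ, ∀ᵐ x, x ∈ uIcc (-(n : ℝ)) n → DifferentiableAt ℝ f x := by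
    intro n
    filter_upwards [(hlip hre (-(n : ℝ)) n).ae_differentiableAt,
      (hlip him (-(n : ℝ)) n).ae_differentiableAt] with x h1 h2 hx
    have h3 := (Complex.ofRealCLM.differentiableAt.comp x (h1 hx)).add
      ((Complex.ofRealCLM.differentiableAt.comp x (h2 hx)).mul_const Complex.I)
    refine h3.congr_of_eventuallyEq (Eventually.of_forall fun y => ?_)
    exact (Complex.re_add_im (f y)).symm
  filter_upwards [ae_all_iff.2 key] with x hx
  obtain ⟨n, hn⟩ := exists_nat_ge |x|
  refine hx n ?_
  rw [uIcc_of_le (by linarith [abs_nonneg x])]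
  exact abs_le.1 hn

theorem ACLoc.add {f g : ℝ → ℂ} (hf : ACLoc f) (hg : ACLoc g) : ACLoc (f + g) :=
  fun a b => (hf a b).add (hg a b)

theorem ACLoc.const_smul {f : ℝ → ℂ} (c : ℂ) (hf : ACLoc f) : ACLoc (c • f) :=
  fun a b => (hf a b).const_smul c

/-- If `f` and `f'` are locally absolutely continuous, then `f` is differentiable everywhere. -/
theorem ACLoc.differentiable {f : ℝ → ℂ} (hf : ACLoc f) (hf' : ACLoc (deriv f)) :
    Differentiable ℝ f := by
  set F : ℝ → ℂ := fun x => ∫ t in (0 : ℝ)..x, deriv f t with hF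
  have hFd : ∀ x, HasDerivAt F (deriv f x) x := fun x =>
    intervalIntegral.integral_hasDerivAt_right (hf'.continuous.intervalIntegrable _ _)
      (hf'.continuous.stronglyMeasurableAtFilter _ _) hf'.continuous.continuousAt
  have hFc : ContDiff ℝ 1 F := by
    rw [contDiff_one_iff_deriv]
    refine ⟨fun x => (hFd x).differentiableAt, ?_⟩
    rw [show deriv F = deriv f from funext fun x => (hFd x).deriv]
    exact hf'.continuous
  have hconst : ∀ x, f x = f 0 + F x := by
    intro x
    have hac : AbsolutelyContinuousOnInterval (f - F) 0 x :=
      (hf 0 x).sub hFc.contDiffOn.absolutelyContinuousOnInterval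
    obtain ⟨C, hC⟩ := hac.const_of_ae_hasDerivAt_zero (by
      filter_upwards [hf.ae_differentiableAt] with y hy _
      simpa using hy.hasDerivAt.sub (hFd y))
    have h0 := hC 0 left_mem_uIcc
    have hx := hC x right_mem_uIcc
    have hF0 : F 0 = 0 := by simp [hF]
    rw [Pi.sub_apply] at h0 hx
    rw [hF0, sub_zero] at h0
    rw [h0, ← hx, sub_add_cancel]
  have : f = fun x => f 0 + F x := funext hconst
  rw [this]
  exact fun x => ((hFd x).differentiableAt).const_add _

/-- The graph of the maximal realization of `-d²/dx² + m² + V(x)` in `L²(ℝ)`: the pairs `(u, w)`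
such that `u` has a representative `f` with `f, f' ∈ AC_loc(ℝ)` and
`-f'' + m² f + V f = w ∈ L²(ℝ)`. -/
def schrodingerGraph (m : ℝ) (V : ℝ → ℝ) : Submodule ℂ (L2 × L2) where
  carrier := {p | ∃ f : ℝ → ℂ, p.1 =ᵐ[volume] f ∧ ACLoc f ∧ ACLoc (deriv f) ∧
    p.2 =ᵐ[volume] fun x => -deriv (deriv f) x + (m : ℂ) ^ 2 * f x + (V x : ℂ) * f x}
  add_mem' := by
    rintro p q ⟨f, hf, hf1, hf2, hfe⟩ ⟨g, hg, hg1, hg2, hge⟩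
    have hd : deriv (f + g) = deriv f + deriv g := funext fun x =>
      deriv_add (hf1.differentiable hf2 x) (hg1.differentiable hg2 x)
    refine ⟨f + g, ?_, hf1.add hg1, hd ▸ hf2.add hg2, ?_⟩
    · filter_upwards [Lp.coeFn_add p.1 q.1, hf, hg] with x h1 h2 h3
      rw [Prod.fst_add, h1, Pi.add_apply, Pi.add_apply, h2, h3]
    · filter_upwards [Lp.coeFn_add p.2 q.2, hfe, hge, hf2.ae_differentiableAt,
        hg2.ae_differentiableAt] with x h1 h2 h3 h4 h5
      rw [Prod.snd_add, h1, Pi.add_apply, h2, h3, hd, deriv_add h4 h5, Pi.add_apply]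
      ring
  zero_mem' := by
    have h0 : deriv (0 : ℝ → ℂ) = 0 := funext fun x => by simp
    have hac : ACLoc (0 : ℝ → ℂ) := fun a b =>
      (contDiff_const (n := 1) (c := (0 : ℂ))).contDiffOn.absolutelyContinuousOnInterval
    refine ⟨0, ?_, hac, by rw [h0]; exact hac, ?_⟩
    · exact Lp.coeFn_zero ℂ 2 volume
    · filter_upwards [Lp.coeFn_zero ℂ 2 (volume : Measure ℝ)] with x hx
      rw [Prod.snd_zero, hx, h0, h0]
      simp
  smul_mem' := by
    rintro c p ⟨f, hf, hf1, hf2, hfe⟩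
    have hd : deriv (c • f) = c • deriv f := funext fun x =>
      deriv_const_smul c (hf1.differentiable hf2 x)
    refine ⟨c • f, ?_, hf1.const_smul c, hd ▸ hf2.const_smul c, ?_⟩
    · filter_upwards [Lp.coeFn_smul c p.1, hf] with x h1 h2
      rw [Prod.smul_fst, h1, Pi.smul_apply, Pi.smul_apply, h2]
    · filter_upwards [Lp.coeFn_smul c p.2, hfe, hf2.ae_differentiableAt] with x h1 h2 h3
      rw [Prod.smul_snd, h1, Pi.smul_apply, h2, hd, deriv_const_smul c h3, Pi.smul_apply]
      simp only [smul_eq_mul]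
      ring

/-- The Schrödinger operator `H_V = -d²/dx² + m² + V(x)` in `L²(ℝ)` on its maximal domain. -/
noncomputable def schrodinger (m : ℝ) (V : ℝ → ℝ) : L2 →ₗ.[ℂ] L2 :=
  (schrodingerGraph m V).toLinearPMap

theorem mem_graph_schrodinger (m : ℝ) (V : ℝ → ℝ) (u w : L2) :
    (u, w) ∈ (schrodinger m V).graph ↔
      ∃ f : ℝ → ℂ, u =ᵐ[volume] f ∧ ACLoc f ∧ ACLoc (deriv f) ∧
        w =ᵐ[volume] fun x => -deriv (deriv f) x + (m : ℂ) ^ 2 * f x + (V x : ℂ) * f x := by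
  have h : (schrodinger m V).graph = schrodingerGraph m V := by
    refine Submodule.toLinearPMap_graph_eq _ ?_
    rintro ⟨u, w⟩ ⟨f, hf, hf1, _, hfe⟩ (rfl : u = 0)
    have hf0 : f = 0 := by
      refine (hf1.continuous.ae_eq_iff_eq volume continuous_zero).1 ?_
      exact hf.symm.trans (Lp.coeFn_zero ℂ 2 volume)
    have h0 : deriv (0 : ℝ → ℂ) = 0 := funext fun x => by simp
    refine (Lp.eq_zero_iff_ae_eq_zero).2 ?_
    filter_upwards [hfe] with x hx
    rw [hx, hf0, h0, h0]
    simp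
  rw [h]
  rfl

/-! ### The Ginzburg–Landau block operator -/

/-- The block operator `𝒜₀ = (H_V, -ν d/dx; ν d/dx, I)` in `L²(ℝ) ⊕ L²(ℝ)`, on the domain
`dom(H_V) × W^{1,2}(ℝ)`. (Formally the first factor is `dom(H_V) ∩ W^{1,2}(ℝ)`; that this is all of
`dom(H_V)` for the potentials considered is part of the theorem.) -/
noncomputable def preOperator (m ν : ℝ) (V : ℝ → ℝ) :
    WithLp 2 (L2 × L2) →ₗ.[ℂ] WithLp 2 (L2 × L2) :=
  blockMatrix (schrodinger m V) ((-ν : ℂ) • derivOp) ((ν : ℂ) • derivOp)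
    ((LinearMap.id : L2 →ₗ[ℂ] L2).toPMap ⊤)

/-- The Ginzburg–Landau block operator `𝒜`, the closure of `𝒜₀`. -/
noncomputable def blockOperator (m ν : ℝ) (V : ℝ → ℝ) :
    WithLp 2 (L2 × L2) →ₗ.[ℂ] WithLp 2 (L2 × L2) :=
  (preOperator m ν V).closure

end GinzburgLandau

namespace GinzburgLandau

/-! ### Primitives of locally integrable functions and weak derivatives -/

/-! Without `V`, the Fourier transform turns the block operator into multiplication by the Hermitian
symbol with rows `(ξ² + m², -iνξ)` and `(iνξ, 1)`. The determinant of symbol minus `z` is `ξ² (1 -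
ν² - z) + (m² - z)(1 - z)`, so, apart from zero denominators, `z` is hit by a real frequency when
`ξ² = (z - m²)(z - 1) / (z - (1 - ν²))`; the point `1 - ν²` is the limit `ξ → ∞`. Hence the
candidate is the set of real `x` with `0 ≤ (x - m²)(x - 1)(x - (1 - ν²))` (`essentialSpectrum_eq`),
and the three cases of the theorem only record the order of the three roots.

The potential does not move this set because it is form compact: embedding `W^{1,2}` into `L²(V±
dx)` is a norm limit of finite rank operators built from point evaluations (`emb_approx`).

Everything is done in weak form. Riesz identifies `H1` with its dual `W^{-1,2}`, so `adjoint incl`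
plays the inclusion of `L²` in `W^{-1,2}`, `adjoint grad` plays `-d/dx` from `L²` to `W^{-1,2}`, and
`formOp T κ μ` plays `-κ d²/dx² + μ + V`. The assumption `0 ∈ ρ(H_V)` identifies the maximal
operator with the form operator (`mem_graph_schrodinger_iff`). The closure of the block operator is
then the weak relation `blockRel` (`blockRel_eq_closure`).

For `z ≠ 1` the second component can be eliminated, which leaves the Schur complement `schurOp`,
with `κ = 1 - ν²/(1 - z)` and `μ = m² - z`. If `κ` and `μ` are nonzero and not in opposite
directions, this is a coercive operator plus one of finite rank, hence Fredholm, and the property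
passes to the block operator (`isFredholmAt_of_isFredholm_schurOp`). Conversely, wave packets
escaping to infinity give singular sequences at every point of the candidate set
(`not_isFredholmAt_of_symbol`, `not_isFredholmAt_one_sub_sq`). -/

theorem locallyIntegrable_intervalIntegrable {E : Type*} [NormedAddCommGroup E] {v : ℝ → E}
    (hv : LocallyIntegrable v volume) (a b : ℝ) : IntervalIntegrable v volume a b :=
  intervalIntegrable_iff.mpr
    ((hv.integrableOn_isCompact isCompact_uIcc).mono_set uIoc_subset_uIcc)

theorem acLoc_primitive {v : ℝ → ℂ} (hv : LocallyIntegrable v volume) (c : ℝ) :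
    ACLoc (fun x => ∫ t in c..x, v t) := by
  intro a b
  have hi : ∀ a b, IntervalIntegrable v volume a b := locallyIntegrable_intervalIntegrable hv
  have hre : ∀ a b, IntervalIntegrable (fun t => (v t).re) volume a b := fun a b =>
    ⟨(hi a b).1.re, (hi a b).2.re⟩
  have him : ∀ a b, IntervalIntegrable (fun t => (v t).im) volume a b := fun a b =>
    ⟨(hi a b).1.im, (hi a b).2.im⟩
  -- The absolute continuity result needs the base point inside the interval, so the interval is
  -- enlarged to contain `c` and restricted again at the end.
  set a' := min a (min b c)
  set b' := max a (max b c)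
  have hab : uIcc a b ⊆ uIcc a' b' := by
    rw [uIcc_of_le (show a' ≤ b' by simp [a', b'])]
    exact uIcc_subset_Icc ⟨by simp [a'], by simp [b']⟩ ⟨by simp [a'], by simp [b']⟩
  have hc : c ∈ uIcc a' b' := by
    rw [uIcc_of_le (show a' ≤ b' by simp [a', b'])]
    exact ⟨by simp [a'], by simp [b']⟩
  have h1 := (hre a' b').absolutelyContinuousOnInterval_intervalIntegral hc
  have h2 := (him a' b').absolutelyContinuousOnInterval_intervalIntegral hc
  have hconst : ∀ z : ℂ, AbsolutelyContinuousOnInterval (fun _ : ℝ => z) a' b' := fun z =>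
    (contDiff_const (n := 1)).contDiffOn.absolutelyContinuousOnInterval
  have h3 := (h1.smul (hconst 1)).add (h2.smul (hconst Complex.I))
  have e : (fun x => ∫ t in c..x, v t) =
      (fun x => ∫ t in c..x, (v t).re) • (fun _ : ℝ => (1 : ℂ)) +
      (fun x => ∫ t in c..x, (v t).im) • (fun _ : ℝ => Complex.I) := by
    funext x
    have h4 := Complex.reCLM.intervalIntegral_comp_comm (hi c x)
    have h5 := Complex.imCLM.intervalIntegral_comp_comm (hi c x)
    simp only [Complex.reCLM_apply, Complex.imCLM_apply] at h4 h5
    apply Complex.ext <;> simp [h4, h5]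
  rw [e]
  exact h3.mono hab

/-- Integration by parts for a primitive of a locally integrable function. -/
theorem integral_deriv_smul_primitive {v : ℝ → ℂ} (hv : LocallyIntegrable v volume)
    {φ : ℝ → ℝ} (hφ : ContDiff ℝ ∞ φ) (hc : HasCompactSupport φ) :
    ∫ x, deriv φ x • (∫ t in (0 : ℝ)..x, v t) = - ∫ x, φ x • v x := by
  set F : ℝ → ℂ := fun x => ∫ t in (0 : ℝ)..x, v t with hF
  have hFc : Continuous F := (acLoc_primitive hv 0).continuous
  obtain ⟨R, hR0, hR⟩ : ∃ R > 0, tsupport φ ⊆ Ioo (-R) R := by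
    obtain ⟨r, hr⟩ := hc.isCompact.isBounded.subset_closedBall 0
    refine ⟨|r| + 1, by positivity, fun x hx => ?_⟩
    have := hr hx
    rw [Metric.mem_closedBall, Real.dist_0_eq_abs] at this
    have h2 := abs_le.1 (this.trans (le_abs_self r))
    constructor <;> linarith [h2.1, h2.2]
  have hdφ : Continuous (deriv φ) := hφ.continuous_deriv (by simp)
  set w : ℝ → ℂ := fun x => deriv φ x • F x + φ x • v x with hw
  have hw1 : LocallyIntegrable (fun x => deriv φ x • F x) volume :=
    (hdφ.smul hFc).locallyIntegrable
  have hw2 : LocallyIntegrable (fun x => φ x • v x) volume := hv.continuous_smul hφ.continuous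
  have hwl : LocallyIntegrable w volume := hw1.add hw2
  -- `φ F` minus the primitive of its almost everywhere derivative `w` is constant. Since `φ`
  -- vanishes at `±R`, comparing the two ends gives `∫ w = 0`.
  have hAC : AbsolutelyContinuousOnInterval (φ • F - fun x => ∫ t in (0:ℝ)..x, w t) (-R) R :=
    (((hφ.of_le (by simp)).contDiffOn.absolutelyContinuousOnInterval).smul
      (acLoc_primitive hv 0 (-R) R)).sub (acLoc_primitive hwl 0 (-R) R)
  obtain ⟨C, hC⟩ := hAC.const_of_ae_hasDerivAt_zero (by
    filter_upwards [LocallyIntegrable.ae_hasDerivAt_integral hv,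
      LocallyIntegrable.ae_hasDerivAt_integral hwl] with x h1 h2 _
    have hd : HasDerivAt φ (deriv φ x) x := (hφ.differentiable (by simp) x).hasDerivAt
    have := (hd.smul (h1 0)).sub (h2 0)
    convert this using 1
    simp [hw, hF, add_comm])
  have hφR : ∀ x, x ∉ Ioo (-R) R → φ x = 0 := fun x hx =>
    image_eq_zero_of_notMem_tsupport fun h => hx (hR h)
  have e1 := hC (-R) left_mem_uIcc
  have e2 := hC R right_mem_uIcc
  have hw0 : ∫ t in (-R)..R, w t = 0 := by
    have := locallyIntegrable_intervalIntegrable hwl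
    rw [← intervalIntegral.integral_interval_sub_left (this 0 R) (this 0 (-R))]
    simp only [Pi.sub_apply, Pi.smul_apply', hφR R (by simp), hφR (-R) (by simp),
      zero_smul, zero_sub] at e1 e2
    rw [← sub_eq_zero.2 (e1.trans e2.symm)]
    ring
  have hs1 : Function.support (fun x => deriv φ x • F x) ⊆ Ioc (-R) R := fun x hx =>
    Ioo_subset_Ioc_self (hR (support_deriv_subset (Function.support_smul_subset_left _ _ hx)))
  have hs2 : Function.support (fun x => φ x • v x) ⊆ Ioc (-R) R := fun x hx =>
    Ioo_subset_Ioc_self (hR (subset_tsupport _ (Function.support_smul_subset_left _ _ hx)))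
  rw [← intervalIntegral.integral_eq_integral_of_support_subset hs1,
    ← intervalIntegral.integral_eq_integral_of_support_subset hs2, ← add_eq_zero_iff_eq_neg,
    ← intervalIntegral.integral_add (locallyIntegrable_intervalIntegrable hw1 _ _)
      (locallyIntegrable_intervalIntegrable hw2 _ _)]
  exact hw0

/-- A compactly supported smooth function with vanishing integral is the derivative of a compactly
supported smooth function. -/
theorem exists_deriv_eq_of_integral_eq_zero {φ : ℝ → ℝ} (hφ : ContDiff ℝ ∞ φ)
    (hc : HasCompactSupport φ) (h0 : ∫ x, φ x = 0) :
    ∃ ψ : ℝ → ℝ, ContDiff ℝ ∞ ψ ∧ HasCompactSupport ψ ∧ deriv ψ = φ := by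
  obtain ⟨R, hR⟩ : ∃ R, tsupport φ ⊆ Ioo (-R) R := by
    obtain ⟨r, hr⟩ := hc.isCompact.isBounded.subset_closedBall 0
    refine ⟨|r| + 1, fun x hx => ?_⟩
    have := hr hx
    rw [Metric.mem_closedBall, Real.dist_0_eq_abs] at this
    have h2 := abs_le.1 (this.trans (le_abs_self r))
    constructor <;> linarith [h2.1, h2.2]
  have hφR : ∀ x, x ∉ Ioo (-R) R → φ x = 0 := fun x hx =>
    image_eq_zero_of_notMem_tsupport fun h => hx (hR h)
  set ψ : ℝ → ℝ := fun x => ∫ t in (-R)..x, φ t with hψ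
  have hd : ∀ x, HasDerivAt ψ (φ x) x := fun x =>
    intervalIntegral.integral_hasDerivAt_right (hφ.continuous.intervalIntegrable _ _)
      (hφ.continuous.stronglyMeasurableAtFilter _ _) hφ.continuous.continuousAt
  have hdψ : deriv ψ = φ := funext fun x => (hd x).deriv
  refine ⟨ψ, ?_, ?_, hdψ⟩
  · rw [contDiff_infty_iff_deriv, hdψ]
    exact ⟨fun x => (hd x).differentiableAt, hφ⟩
  · refine HasCompactSupport.intro (isCompact_Icc (a := -R) (b := R)) fun x hx => ?_
    rcases le_or_gt x (-R) with h | h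
    · refine intervalIntegral.integral_zero_ae (Eventually.of_forall fun t ht => hφR t ?_)
      rw [uIoc_of_ge h] at ht
      exact fun h' => by linarith [ht.2, h'.1]
    · have hxR : R < x := by
        by_contra h'
        exact hx ⟨h.le, not_lt.1 h'⟩
      have hs : Function.support φ ⊆ Ioc (-R) x := fun t ht => by
        have := hR (subset_tsupport _ ht)
        exact ⟨this.1, by linarith [this.2]⟩
      rw [hψ]
      simp only
      rw [intervalIntegral.integral_eq_integral_of_support_subset hs, h0]

/-- The lemma of du Bois-Reymond. -/
theorem ae_eq_const_of_integral_deriv_smul_eq_zero {h : ℝ → ℂ} (hh : LocallyIntegrable h volume)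
    (H : ∀ φ : ℝ → ℝ, ContDiff ℝ ∞ φ → HasCompactSupport φ → ∫ x, deriv φ x • h x = 0) :
    ∃ c : ℂ, ∀ᵐ x, h x = c := by
  let b : ContDiffBump (0 : ℝ) := ⟨1, 2, by norm_num, by norm_num⟩
  set χ : ℝ → ℝ := b.normed volume with hχ
  have hχs : ContDiff ℝ ∞ χ := b.contDiff_normed
  have hχc : HasCompactSupport χ := b.hasCompactSupport_normed
  have hχ1 : ∫ x, χ x = 1 := b.integral_normed
  have hint : ∀ {φ : ℝ → ℝ}, ContDiff ℝ ∞ φ → HasCompactSupport φ →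
      Integrable (fun x => φ x • h x) := fun hφ hc =>
    hh.integrable_smul_left_of_hasCompactSupport hφ.continuous hc
  set c : ℂ := ∫ x, χ x • h x with hcdef
  refine ⟨c, ?_⟩
  refine ae_eq_of_integral_contDiff_smul_eq hh (locallyIntegrable_const c) fun φ hφ hφc => ?_
  set I : ℝ := ∫ x, φ x with hI
  have hIφ : Integrable φ := hφ.continuous.integrable_of_hasCompactSupport hφc
  have hIχ : Integrable χ := hχs.continuous.integrable_of_hasCompactSupport hχc
  -- Subtracting the multiple of the unit-mass bump `χ` that makes the mean zero turns `φ` into a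
  -- derivative, to which `H` applies.
  have hs : ContDiff ℝ ∞ (fun x => φ x - I * χ x) := hφ.sub (contDiff_const.mul hχs)
  have hsc : HasCompactSupport (fun x => φ x - I * χ x) := hφc.sub (hχc.mul_left)
  obtain ⟨ψ, hψ, hψc, hψd⟩ := exists_deriv_eq_of_integral_eq_zero hs hsc (by
    rw [integral_sub hIφ (hIχ.const_mul I), integral_const_mul, hχ1, mul_one, sub_self])
  have := H ψ hψ hψc
  rw [hψd] at this
  have e : ∀ x, (φ x - I * χ x) • h x = φ x • h x - I • (χ x • h x) := fun x => by
    rw [sub_smul, mul_smul]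
  simp_rw [e] at this
  rw [integral_sub (hint hφ hφc) (by exact (hint hχs hχc).smul I), integral_smul, ← hcdef, sub_eq_zero]
    at this
  rw [this, integral_smul_const]

/-- A locally integrable function with locally integrable weak derivative `v` is a primitive
of `v`. -/
theorem ae_eq_primitive_of_weakDeriv {u v : ℝ → ℂ} (hu : LocallyIntegrable u volume)
    (hv : LocallyIntegrable v volume)
    (H : ∀ φ : ℝ → ℝ, ContDiff ℝ ∞ φ → HasCompactSupport φ →
      ∫ x, deriv φ x • u x = - ∫ x, φ x • v x) :
    ∃ c : ℂ, ∀ᵐ x, u x = c + ∫ t in (0 : ℝ)..x, v t := by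
  have hF : LocallyIntegrable (fun x => ∫ t in (0 : ℝ)..x, v t) volume :=
    (acLoc_primitive hv 0).continuous.locallyIntegrable
  obtain ⟨c, hc⟩ := ae_eq_const_of_integral_deriv_smul_eq_zero (hu.sub hF) fun φ hφ hφc => by
    have hd : Continuous (deriv φ) := hφ.continuous_deriv (by simp)
    simp only [Pi.sub_apply, smul_sub]
    rw [integral_sub (hu.integrable_smul_left_of_hasCompactSupport hd hφc.deriv)
      (hF.integrable_smul_left_of_hasCompactSupport hd hφc.deriv), H φ hφ hφc,
      integral_deriv_smul_primitive hv hφ hφc, sub_self]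
  refine ⟨c, ?_⟩
  filter_upwards [hc] with x hx
  rw [← hx, Pi.sub_apply, sub_add_cancel]

/-! ### The Sobolev space `W^{1,2}(ℝ)` as a Hilbert space -/

/-- A continuous compactly supported function as an element of `L²(ℝ)`. -/
noncomputable def toL2 (ψ : ℝ → ℂ) (hψ : Continuous ψ) (hc : HasCompactSupport ψ) : L2 :=
  (hψ.memLp_of_hasCompactSupport (p := 2) (μ := volume) hc).toLp ψ

theorem coeFn_toL2 {ψ : ℝ → ℂ} (hψ : Continuous ψ) (hc : HasCompactSupport ψ) :
    toL2 ψ hψ hc =ᵐ[volume] ψ := MemLp.coeFn_toLp _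

theorem inner_L2 (u v : L2) : inner ℂ u v = ∫ x, (starRingEnd ℂ) (u x) * (v x : ℂ) := by
  rw [L2.inner_def]
  refine integral_congr_ae (Eventually.of_forall fun x => ?_)
  simp [RCLike.inner_apply, mul_comm]

theorem inner_toL2 {ψ : ℝ → ℂ} (hψ : Continuous ψ) (hc : HasCompactSupport ψ) (u : L2) :
    inner ℂ (toL2 ψ hψ hc) u = ∫ x, (starRingEnd ℂ) (ψ x) * (u x : ℂ) := by
  rw [inner_L2]
  refine integral_congr_ae ?_
  filter_upwards [coeFn_toL2 hψ hc] with x hx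
  rw [hx]

theorem norm_sq_L2 {α : Type*} [MeasurableSpace α] {μ : Measure α} (u : Lp ℂ 2 μ) :
    ‖u‖ ^ 2 = ∫ x, ‖u x‖ ^ 2 ∂μ := by
  have h := inner_self_eq_norm_sq_to_K (𝕜 := ℂ) u
  rw [L2.inner_def] at h
  have e : ∀ x, inner ℂ (u x : ℂ) (u x) = ((‖u x‖ ^ 2 : ℝ) : ℂ) := fun x => by
    rw [inner_self_eq_norm_sq_to_K]; norm_cast
  simp_rw [e] at h
  rw [integral_complex_ofReal] at h
  refine Complex.ofReal_injective ?_
  rw [h]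
  norm_cast

theorem integrable_norm_sq_L2 {α : Type*} [MeasurableSpace α] {μ : Measure α} (u : Lp ℂ 2 μ) :
    Integrable (fun x => ‖u x‖ ^ 2) μ :=
  (memLp_two_iff_integrable_sq_norm (Lp.aestronglyMeasurable u)).1 (Lp.memLp u)

theorem hasCompactSupport_ofReal {φ : ℝ → ℝ} (hc : HasCompactSupport φ) :
    HasCompactSupport (fun x => (φ x : ℂ)) := hc.comp_left (g := Complex.ofReal) (by simp)

theorem continuous_ofReal_comp {φ : ℝ → ℝ} (h : Continuous φ) :
    Continuous (fun x => (φ x : ℂ)) := Complex.continuous_ofReal.comp h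

/-- Each test function imposes one continuous linear condition on the pair; this makes the graph
closed, so `H1` is complete. -/
theorem hasWeakDeriv_iff_inner (u v : L2) :
    HasWeakDeriv u v ↔ ∀ (φ : ℝ → ℝ) (hφ : ContDiff ℝ ∞ φ) (hc : HasCompactSupport φ),
      inner ℂ (toL2 (fun x => ((deriv φ x : ℝ) : ℂ))
        (continuous_ofReal_comp (hφ.continuous_deriv (by simp)))
        (hasCompactSupport_ofReal hc.deriv)) u +
      inner ℂ (toL2 (fun x => (φ x : ℂ)) (continuous_ofReal_comp hφ.continuous)
        (hasCompactSupport_ofReal hc)) v = 0 := by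
  refine forall_congr' fun φ => forall_congr' fun hφ => forall_congr' fun hc => ?_
  rw [inner_toL2, inner_toL2, ← add_eq_zero_iff_eq_neg]
  simp [Complex.real_smul]

/-- The Sobolev space `W^{1,2}(ℝ)`, as the graph of the weak derivative. -/
noncomputable def sobolev : Submodule ℂ (WithLp 2 (L2 × L2)) :=
  derivGraph.comap (WithLp.linearEquiv 2 ℂ (L2 × L2)).toLinearMap

theorem isClosed_sobolev : IsClosed (sobolev : Set (WithLp 2 (L2 × L2))) := by
  have : (sobolev : Set (WithLp 2 (L2 × L2))) = {p | HasWeakDeriv p.fst p.snd} := rfl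
  rw [this]
  simp only [hasWeakDeriv_iff_inner, ofPred_forall]
  refine isClosed_iInter fun φ => isClosed_iInter fun hφ => isClosed_iInter fun hc => ?_
  refine isClosed_eq ?_ continuous_const
  exact ((innerSL ℂ _).continuous.comp (WithLp.fstL 2 ℂ L2 L2).continuous).add
    ((innerSL ℂ _).continuous.comp (WithLp.sndL 2 ℂ L2 L2).continuous)

/-- The Sobolev space `W^{1,2}(ℝ)` with its graph inner product. -/
def H1 : Type := sobolev

noncomputable instance : NormedAddCommGroup H1 := inferInstanceAs (NormedAddCommGroup sobolev)

noncomputable instance : InnerProductSpace ℂ H1 := inferInstanceAs (InnerProductSpace ℂ sobolev)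

instance : CompleteSpace H1 := isClosed_sobolev.completeSpace_coe

/-- The inclusion of `W^{1,2}(ℝ)` into `L²(ℝ)`. -/
noncomputable def incl : H1 →L[ℂ] L2 := (WithLp.fstL 2 ℂ L2 L2).comp sobolev.subtypeL

/-- The weak derivative `W^{1,2}(ℝ) → L²(ℝ)`. -/
noncomputable def grad : H1 →L[ℂ] L2 := (WithLp.sndL 2 ℂ L2 L2).comp sobolev.subtypeL

theorem hasWeakDeriv_incl (w : H1) : HasWeakDeriv (incl w) (grad w) := w.2

theorem sobolev_norm_sq (w : H1) : ‖w‖ ^ 2 = ‖incl w‖ ^ 2 + ‖grad w‖ ^ 2 :=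
  WithLp.prod_norm_sq_eq_of_L2 (Subtype.val (p := fun x => x ∈ sobolev) w)

theorem exists_sobolev {u v : L2} (h : HasWeakDeriv u v) : ∃ w : H1, incl w = u ∧ grad w = v :=
  ⟨⟨WithLp.toLp 2 (u, v), h⟩, rfl, rfl⟩

theorem sobolev_ext {w w' : H1} (h1 : incl w = incl w') (h2 : grad w = grad w') : w = w' := by
  have : ‖w - w'‖ ^ 2 = 0 := by
    rw [sobolev_norm_sq, map_sub, map_sub, h1, h2]; simp
  exact sub_eq_zero.1 (norm_eq_zero.1 (pow_eq_zero_iff two_ne_zero |>.1 this))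

theorem eq_zero_of_forall_inner_toL2 {y : L2}
    (h : ∀ (φ : ℝ → ℝ) (hφ : ContDiff ℝ ∞ φ) (hc : HasCompactSupport φ),
      inner ℂ (toL2 (fun x => (φ x : ℂ)) (continuous_ofReal_comp hφ.continuous)
        (hasCompactSupport_ofReal hc)) y = 0) : y = 0 := by
  refine Lp.eq_zero_iff_ae_eq_zero.2 ?_
  refine ae_eq_zero_of_integral_contDiff_smul_eq_zero
    ((Lp.memLp y).locallyIntegrable (by norm_num)) fun φ hφ hc => ?_
  have := h φ hφ hc
  rw [inner_toL2] at this
  simpa [Complex.real_smul] using this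

theorem incl_injective : Function.Injective incl := by
  intro w w' h
  refine sobolev_ext h (sub_eq_zero.1 (eq_zero_of_forall_inner_toL2 fun φ hφ hc => ?_))
  have h1 := (hasWeakDeriv_iff_inner _ _).1 (hasWeakDeriv_incl (w - w')) φ hφ hc
  rw [map_sub, map_sub, h, sub_self, inner_zero_right, zero_add] at h1
  exact h1

/-- Smooth compactly supported functions belong to `W^{1,2}(ℝ)`. -/
theorem hasWeakDeriv_toL2 {ψ : ℝ → ℂ} (hψ : ContDiff ℝ ∞ ψ) (hc : HasCompactSupport ψ) :
    HasWeakDeriv (toL2 ψ hψ.continuous hc) (toL2 (deriv ψ) (hψ.continuous_deriv (by simp)) hc.deriv) := by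
  intro φ hφ hφc
  have hdψ := hψ.continuous_deriv (by simp)
  have hdφ := hφ.continuous_deriv (by simp)
  have e1 : ∫ x, deriv φ x • (toL2 ψ hψ.continuous hc x : ℂ) = ∫ x, deriv φ x • ψ x := by
    refine integral_congr_ae ?_
    filter_upwards [coeFn_toL2 hψ.continuous hc] with x hx
    rw [hx]
  have e2 : ∫ x, φ x • (toL2 (deriv ψ) hdψ hc.deriv x : ℂ) = ∫ x, φ x • deriv ψ x := by
    refine integral_congr_ae ?_
    filter_upwards [coeFn_toL2 hdψ hc.deriv] with x hx
    rw [hx]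
  rw [e1, e2]
  have := integral_bilinear_hasDerivAt_right_eq_neg_left_of_integrable (u := φ) (v := ψ)
    (L := ContinuousLinearMap.lsmul ℝ ℝ)
    (fun x _ => (hφ.differentiable (by simp) x).hasDerivAt)
    (fun x _ => (hψ.differentiable (by simp) x).hasDerivAt)
    ((hφ.continuous.smul hdψ).integrable_of_hasCompactSupport hc.deriv.smul_left)
    ((hdφ.smul hψ.continuous).integrable_of_hasCompactSupport hc.smul_left)
    ((hφ.continuous.smul hψ.continuous).integrable_of_hasCompactSupport hc.smul_left)
  simp only [ContinuousLinearMap.lsmul_apply] at this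
  rw [this, neg_neg]

/-! ### The continuous representative -/

/-- By du Bois-Reymond an element of `W^{1,2}` is a constant plus the primitive of its weak
derivative, and that primitive is continuous. -/
theorem exists_rep (w : H1) : ∃ f : ℝ → ℂ, incl w =ᵐ[volume] f ∧ Continuous f ∧
    ∀ a b, f b - f a = ∫ t in a..b, (grad w t : ℂ) := by
  have hl : ∀ u : L2, LocallyIntegrable (fun x => (u x : ℂ)) volume := fun u =>
    (Lp.memLp u).locallyIntegrable (by norm_num)
  obtain ⟨c, hc⟩ := ae_eq_primitive_of_weakDeriv (hl _) (hl _) (hasWeakDeriv_incl w)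
  refine ⟨_, hc, continuous_const.add (acLoc_primitive (hl _) 0).continuous, fun a b => ?_⟩
  have := locallyIntegrable_intervalIntegrable (hl (grad w))
  rw [← intervalIntegral.integral_interval_sub_left (this 0 b) (this 0 a)]
  ring

/-- The continuous representative of an element of `W^{1,2}(ℝ)`. -/
noncomputable def rep (w : H1) : ℝ → ℂ := (exists_rep w).choose

theorem rep_ae (w : H1) : incl w =ᵐ[volume] rep w := (exists_rep w).choose_spec.1

theorem continuous_rep (w : H1) : Continuous (rep w) := (exists_rep w).choose_spec.2.1

theorem rep_sub_rep (w : H1) (a b : ℝ) :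
    rep w b - rep w a = ∫ t in a..b, (grad w t : ℂ) := (exists_rep w).choose_spec.2.2 a b

theorem rep_eq_of_ae {w : H1} {f : ℝ → ℂ} (hf : Continuous f) (h : incl w =ᵐ[volume] f) :
    rep w = f :=
  ((continuous_rep w).ae_eq_iff_eq volume hf).1 ((rep_ae w).symm.trans h)

theorem rep_add (w w' : H1) : rep (w + w') = rep w + rep w' := by
  refine rep_eq_of_ae ((continuous_rep w).add (continuous_rep w')) ?_
  rw [map_add]
  filter_upwards [Lp.coeFn_add (incl w) (incl w'), rep_ae w, rep_ae w'] with x h1 h2 h3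
  rw [h1, Pi.add_apply, Pi.add_apply, h2, h3]

theorem rep_smul (c : ℂ) (w : H1) : rep (c • w) = c • rep w := by
  refine rep_eq_of_ae ((continuous_rep w).const_smul c) ?_
  rw [map_smul]
  filter_upwards [Lp.coeFn_smul c (incl w), rep_ae w] with x h1 h2
  rw [h1, Pi.smul_apply, Pi.smul_apply, h2]

/-- Cauchy–Schwarz against `1`, obtained from nonnegativity of the integral of `(g - c)²`, where `c`
is the mean of `g`. -/
theorem sq_integral_le {g : ℝ → ℝ} {a b : ℝ} (hab : a ≤ b) (hg : IntervalIntegrable g volume a b)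
    (hg2 : IntervalIntegrable (fun x => g x ^ 2) volume a b) :
    (∫ x in a..b, g x) ^ 2 ≤ (b - a) * ∫ x in a..b, g x ^ 2 := by
  rcases hab.eq_or_lt with rfl | h
  · simp
  set I := ∫ x in a..b, g x
  set c := I / (b - a)
  have hba : 0 < b - a := sub_pos.2 h
  have h0 : 0 ≤ ∫ x in a..b, (g x - c) ^ 2 :=
    intervalIntegral.integral_nonneg hab fun x _ => sq_nonneg _
  have e : ∀ x, (g x - c) ^ 2 = g x ^ 2 - 2 * c * g x + c ^ 2 := fun x => by ring
  simp_rw [e] at h0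
  rw [intervalIntegral.integral_add (hg2.sub (hg.const_mul _)) intervalIntegrable_const,
    intervalIntegral.integral_sub hg2 (hg.const_mul _), intervalIntegral.integral_const_mul,
    intervalIntegral.integral_const, smul_eq_mul] at h0
  have hc : c * (b - a) = I := div_mul_cancel₀ _ hba.ne'
  have : I ^ 2 = (b - a) * (2 * c * I - (b - a) * c ^ 2) := by rw [← hc]; ring
  rw [this]
  exact mul_le_mul_of_nonneg_left (by linarith) hba.le

theorem norm_rep_sub_sq_le (w : H1) {a b : ℝ} (hab : a ≤ b) :
    ‖rep w b - rep w a‖ ^ 2 ≤ (b - a) * ∫ t in a..b, ‖grad w t‖ ^ 2 := by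
  rw [rep_sub_rep]
  have hl : LocallyIntegrable (fun x => (grad w x : ℂ)) volume :=
    (Lp.memLp _).locallyIntegrable (by norm_num)
  have h1 := locallyIntegrable_intervalIntegrable hl a b
  have h2 : IntervalIntegrable (fun x => ‖grad w x‖ ^ 2) volume a b :=
    (integrable_norm_sq_L2 _).intervalIntegrable
  refine le_trans ?_ (sq_integral_le hab h1.norm h2)
  exact pow_le_pow_left₀ (norm_nonneg _) (intervalIntegral.norm_integral_le_integral_norm hab) 2

theorem norm_rep_sub_sq_le' (w : H1) (a b : ℝ) :
    ‖rep w b - rep w a‖ ^ 2 ≤ |b - a| * ‖grad w‖ ^ 2 := by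
  have key : ∀ {a b : ℝ}, a ≤ b → ‖rep w b - rep w a‖ ^ 2 ≤ |b - a| * ‖grad w‖ ^ 2 := by
    intro a b hab
    refine (norm_rep_sub_sq_le w hab).trans ?_
    rw [abs_of_nonneg (sub_nonneg.2 hab), norm_sq_L2, intervalIntegral.integral_of_le hab]
    exact mul_le_mul_of_nonneg_left (setIntegral_le_integral (integrable_norm_sq_L2 _)
      (Eventually.of_forall fun x => sq_nonneg _)) (sub_nonneg.2 hab)
  rcases le_total a b with h | h
  · exact key h
  · rw [norm_sub_rev, abs_sub_comm]; exact key h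

/-- Compare the value at `x` with the value at `t`, bound the difference by the energy on `[x, x +
s]`, and average over `t`. Staying local in `x` allows integration against a measure of infinite
mass; the free length `s` trades gradient against function. -/
theorem norm_rep_sq_le (w : H1) (x : ℝ) {s : ℝ} (hs : 0 < s) :
    ‖rep w x‖ ^ 2 ≤ ∫ t in x..(x + s), (2 / s * ‖incl w t‖ ^ 2 + 2 * s * ‖grad w t‖ ^ 2) := by
  have hx : x ≤ x + s := by linarith
  have i1 : IntervalIntegrable (fun t => ‖incl w t‖ ^ 2) volume x (x + s) :=
    (integrable_norm_sq_L2 _).intervalIntegrable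
  have i2 : IntervalIntegrable (fun t => ‖grad w t‖ ^ 2) volume x (x + s) :=
    (integrable_norm_sq_L2 _).intervalIntegrable
  set I := ∫ t in x..(x + s), ‖grad w t‖ ^ 2 with hI
  have hpt : ∀ t ∈ Icc x (x + s), ‖rep w x‖ ^ 2 ≤ 2 * ‖rep w t‖ ^ 2 + 2 * (s * I) := by
    intro t ht
    have h1 : ‖rep w t - rep w x‖ ^ 2 ≤ s * I := by
      refine (norm_rep_sub_sq_le w ht.1).trans ?_
      refine mul_le_mul (by linarith [ht.2]) ?_ ?_ hs.le
      · exact intervalIntegral.integral_mono_interval le_rfl ht.1 ht.2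
          (Eventually.of_forall fun _ => sq_nonneg _) i2
      · exact intervalIntegral.integral_nonneg ht.1 fun _ _ => sq_nonneg _
    have h2 : ‖rep w x‖ ≤ ‖rep w t‖ + ‖rep w t - rep w x‖ := by
      have := norm_sub_le (rep w t) (rep w t - rep w x)
      rwa [sub_sub_cancel] at this
    nlinarith [norm_nonneg (rep w x), sq_nonneg (‖rep w t‖ - ‖rep w t - rep w x‖),
      norm_nonneg (rep w t), norm_nonneg (rep w t - rep w x)]
  have h3 : ∫ _ in x..(x + s), ‖rep w x‖ ^ 2 ≤
      ∫ t in x..(x + s), (2 * ‖rep w t‖ ^ 2 + 2 * (s * I)) := by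
    refine intervalIntegral.integral_mono_on hx intervalIntegrable_const ?_ hpt
    exact (Continuous.intervalIntegrable (by have := continuous_rep w; fun_prop) _ _)
  have h4 : ∫ t in x..(x + s), (2 * ‖rep w t‖ ^ 2 + 2 * (s * I)) =
      ∫ t in x..(x + s), (2 * ‖incl w t‖ ^ 2 + 2 * (s * I)) := by
    refine intervalIntegral.integral_congr_ae ?_
    filter_upwards [rep_ae w] with t ht _
    rw [ht]
  rw [h4, intervalIntegral.integral_add (i1.const_mul _) intervalIntegrable_const,
    intervalIntegral.integral_const_mul, intervalIntegral.integral_const,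
    intervalIntegral.integral_const] at h3
  rw [intervalIntegral.integral_add (i1.const_mul _) (i2.const_mul _),
    intervalIntegral.integral_const_mul, intervalIntegral.integral_const_mul, ← hI]
  simp only [add_sub_cancel_left, smul_eq_mul] at h3
  refine le_of_mul_le_mul_left (h3.trans (le_of_eq ?_)) hs
  field_simp

/-! ### Embedding of `W^{1,2}(ℝ)` into weighted `L²` spaces -/

/-- A measure on the line whose mass on unit intervals is bounded, and tends to zero at infinity. -/
structure VanishingAtInfinity (μ : Measure ℝ) : Prop where
  bounded : ∃ M : ℝ, 0 ≤ M ∧ ∀ t, μ (Icc t (t + 1)) ≤ ENNReal.ofReal M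
  tail : ∀ ε > 0, ∃ R, ∀ t, μ (Icc t (t + 1) ∩ {x | R < |x|}) ≤ ENNReal.ofReal ε

/-- Integrate the local bound in `x` and swap the integrals: a given `t` is seen only from `x ∈ [t -
s, t]`, a set of `μ`-mass at most `M` since `s ≤ 1`. -/
theorem lintegral_rep_le (μ : Measure ℝ) [SFinite μ] {M : ℝ≥0∞}
    (hM : ∀ t, μ (Icc t (t + 1)) ≤ M) {s : ℝ} (hs : 0 < s) (hs1 : s ≤ 1) (w : H1) :
    ∫⁻ x, ENNReal.ofReal (‖rep w x‖ ^ 2) ∂μ ≤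
      M * ENNReal.ofReal (2 / s * ‖incl w‖ ^ 2 + 2 * s * ‖grad w‖ ^ 2) := by
  set g : ℝ → ℝ := fun t => 2 / s * ‖incl w t‖ ^ 2 + 2 * s * ‖grad w t‖ ^ 2 with hg
  have hg0 : ∀ t, 0 ≤ g t := fun t => by positivity
  have hgm : Measurable g :=
    (((Lp.stronglyMeasurable (incl w)).measurable.norm.pow_const 2).const_mul _).add
      (((Lp.stronglyMeasurable (grad w)).measurable.norm.pow_const 2).const_mul _)
  have i1 := (integrable_norm_sq_L2 (incl w)).const_mul (2 / s)
  have i2 := (integrable_norm_sq_L2 (grad w)).const_mul (2 * s)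
  have hgi : Integrable g := i1.add i2
  have hgI : ∫ t, g t = 2 / s * ‖incl w‖ ^ 2 + 2 * s * ‖grad w‖ ^ 2 := by
    rw [norm_sq_L2, norm_sq_L2, ← integral_const_mul, ← integral_const_mul, ← integral_add i1 i2]
  have hpt : ∀ x, ENNReal.ofReal (‖rep w x‖ ^ 2) ≤
      ∫⁻ t, {p : ℝ × ℝ | p.1 ≤ p.2 ∧ p.2 ≤ p.1 + s}.indicator
        (fun p => ENNReal.ofReal (g p.2)) (x, t) := by
    intro x
    have e : ∀ t, {p : ℝ × ℝ | p.1 ≤ p.2 ∧ p.2 ≤ p.1 + s}.indicator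
        (fun p => ENNReal.ofReal (g p.2)) (x, t) =
        (Icc x (x + s)).indicator (fun t => ENNReal.ofReal (g t)) t := fun t => rfl
    simp_rw [e]
    rw [lintegral_indicator measurableSet_Icc,
      ← ofReal_integral_eq_lintegral_ofReal hgi.integrableOn (Eventually.of_forall hg0),
      integral_Icc_eq_integral_Ioc, ← intervalIntegral.integral_of_le (by linarith)]
    exact ENNReal.ofReal_le_ofReal (norm_rep_sq_le w x hs)
  have hmeas : MeasurableSet {p : ℝ × ℝ | p.1 ≤ p.2 ∧ p.2 ≤ p.1 + s} :=
    (measurableSet_le measurable_fst measurable_snd).inter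
      (measurableSet_le measurable_snd (measurable_fst.add_const s))
  have hmf : Measurable ({p : ℝ × ℝ | p.1 ≤ p.2 ∧ p.2 ≤ p.1 + s}.indicator
      (fun p => ENNReal.ofReal (g p.2))) :=
    (hgm.comp measurable_snd).ennreal_ofReal.indicator hmeas
  refine (lintegral_mono hpt).trans ?_
  rw [lintegral_lintegral_swap (f := fun x t => {p : ℝ × ℝ | p.1 ≤ p.2 ∧ p.2 ≤ p.1 + s}.indicator
      (fun p => ENNReal.ofReal (g p.2)) (x, t)) hmf.aemeasurable, ← hgI,
    ofReal_integral_eq_lintegral_ofReal hgi (Eventually.of_forall hg0),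
    ← lintegral_const_mul _ hgm.ennreal_ofReal]
  refine lintegral_mono fun t => ?_
  have e : ∀ x, {p : ℝ × ℝ | p.1 ≤ p.2 ∧ p.2 ≤ p.1 + s}.indicator
      (fun p => ENNReal.ofReal (g p.2)) (x, t) =
      (Icc (t - s) t).indicator (fun _ => ENNReal.ofReal (g t)) x := fun x => by
    simp only [indicator, mem_ofPred_eq, mem_Icc, sub_le_iff_le_add]
    congr 1
    exact propext and_comm
  simp only [e]
  rw [lintegral_indicator_const measurableSet_Icc, mul_comm]
  gcongr
  exact (measure_mono (Icc_subset_Icc_right (by linarith))).trans (hM (t - s))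

theorem norm_sq_le_of_lintegral_le {α : Type*} [MeasurableSpace α] {μ : Measure α} {u : Lp ℂ 2 μ}
    {c : ℝ} (hc : 0 ≤ c) (h : ∫⁻ x, ENNReal.ofReal (‖u x‖ ^ 2) ∂μ ≤ ENNReal.ofReal c) :
    ‖u‖ ^ 2 ≤ c := by
  rw [norm_sq_L2, integral_eq_lintegral_of_nonneg_ae (Eventually.of_forall fun _ => sq_nonneg _)
    (integrable_norm_sq_L2 u).aestronglyMeasurable]
  exact ENNReal.toReal_le_of_le_ofReal hc h

theorem VanishingAtInfinity.memLp_rep {μ : Measure ℝ} [SFinite μ] (h : VanishingAtInfinity μ)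
    (w : H1) : MemLp (rep w) 2 μ := by
  obtain ⟨M, -, hM⟩ := h.bounded
  rw [memLp_two_iff_integrable_sq_norm (continuous_rep w).aestronglyMeasurable]
  refine ⟨((continuous_rep w).norm.pow 2).aestronglyMeasurable, ?_⟩
  rw [hasFiniteIntegral_iff_ofReal (Eventually.of_forall fun _ => sq_nonneg _)]
  exact (lintegral_rep_le μ hM one_pos le_rfl w).trans_lt
    (ENNReal.mul_lt_top ENNReal.ofReal_lt_top ENNReal.ofReal_lt_top)

/-- The embedding as a linear map. -/
noncomputable def embLinear {μ : Measure ℝ} [SFinite μ] (h : VanishingAtInfinity μ) :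
    H1 →ₗ[ℂ] Lp ℂ 2 μ where
  toFun w := (h.memLp_rep w).toLp (rep w)
  map_add' w w' := by
    rw [← MemLp.toLp_add]
    congr 1
    exact rep_add w w'
  map_smul' c w := by
    rw [RingHom.id_apply, ← MemLp.toLp_const_smul]
    congr 1
    exact rep_smul c w

theorem VanishingAtInfinity.exists_bound {μ : Measure ℝ} [SFinite μ] (h : VanishingAtInfinity μ) :
    ∃ M : ℝ, 0 ≤ M ∧ ∀ s : ℝ, 0 < s → s ≤ 1 → ∀ w : H1,
      ‖embLinear h w‖ ^ 2 ≤ M * (2 / s * ‖incl w‖ ^ 2 + 2 * s * ‖grad w‖ ^ 2) := by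
  obtain ⟨M, hM0, hM⟩ := h.bounded
  refine ⟨M, hM0, fun s hs hs1 w => norm_sq_le_of_lintegral_le (by positivity) ?_⟩
  rw [ENNReal.ofReal_mul hM0]
  refine le_trans (le_of_eq ?_) (lintegral_rep_le μ hM hs hs1 w)
  refine lintegral_congr_ae ?_
  filter_upwards [(h.memLp_rep w).coeFn_toLp] with x hx
  rw [← hx]
  rfl

/-- The bounded embedding of `W^{1,2}(ℝ)` into `L²(μ)`. -/
noncomputable def emb {μ : Measure ℝ} [SFinite μ] (h : VanishingAtInfinity μ) :
    H1 →L[ℂ] Lp ℂ 2 μ :=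
  (embLinear h).mkContinuousOfExistsBound (by
    obtain ⟨M, hM0, hM⟩ := h.exists_bound
    refine ⟨√(M * 2), fun w => abs_le_of_sq_le_sq' ?_ (by positivity) |>.2⟩
    refine (hM 1 one_pos le_rfl w).trans (le_of_eq ?_)
    rw [mul_pow, Real.sq_sqrt (by positivity), sobolev_norm_sq]
    ring)

theorem coeFn_emb {μ : Measure ℝ} [SFinite μ] (h : VanishingAtInfinity μ) (w : H1) :
    emb h w =ᵐ[μ] rep w := (h.memLp_rep w).coeFn_toLp

theorem emb_infinitesimal {μ : Measure ℝ} [SFinite μ] (h : VanishingAtInfinity μ) {δ : ℝ}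
    (hδ : 0 < δ) : ∃ C : ℝ, 0 ≤ C ∧ ∀ w : H1,
      ‖emb h w‖ ^ 2 ≤ δ * ‖grad w‖ ^ 2 + C * ‖incl w‖ ^ 2 := by
  obtain ⟨M, hM0, hM⟩ := h.exists_bound
  -- Chosen so that the gradient coefficient `2 s M` is at most `δ`; the price is the factor `2 / s`
  -- on the function.
  set s := min 1 (δ / (2 * (M + 1))) with hs
  have hs0 : 0 < s := lt_min one_pos (by positivity)
  refine ⟨M * (2 / s), by positivity, fun w => (hM s hs0 (min_le_left _ _) w).trans ?_⟩
  have h1 : s * (2 * (M + 1)) ≤ δ := (le_div_iff₀ (by positivity)).1 (min_le_right _ _)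
  have h2 : M * (2 * s) ≤ δ := by nlinarith
  nlinarith [mul_le_mul_of_nonneg_right h2 (sq_nonneg ‖grad w‖)]

/-- Evaluation at a point on `W^{1,2}(ℝ)`. -/
noncomputable def evalAt (x : ℝ) : H1 →L[ℂ] ℂ :=
  LinearMap.mkContinuousOfExistsBound
    { toFun := fun w => rep w x
      map_add' := fun w w' => by rw [rep_add]; rfl
      map_smul' := fun c w => by rw [rep_smul]; rfl } (by
    refine ⟨√2, fun w => abs_le_of_sq_le_sq' ?_ (by positivity) |>.2⟩
    have i1 := (integrable_norm_sq_L2 (incl w)).const_mul 2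
    have i2 := (integrable_norm_sq_L2 (grad w)).const_mul 2
    refine (norm_rep_sq_le w x one_pos).trans ?_
    rw [intervalIntegral.integral_of_le (by linarith), mul_pow, Real.sq_sqrt (by norm_num),
      sobolev_norm_sq, mul_add, norm_sq_L2 (incl w), norm_sq_L2 (grad w), ← integral_const_mul,
      ← integral_const_mul, ← integral_add i1 i2]
    norm_num only [div_one, mul_one]
    exact setIntegral_le_integral (i1.add i2) (Eventually.of_forall fun _ => by positivity))

@[simp] theorem evalAt_apply (x : ℝ) (w : H1) : evalAt x w = rep w x := rfl

theorem VanishingAtInfinity.measure_Icc_lt_top {μ : Measure ℝ} (h : VanishingAtInfinity μ)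
    (a b : ℝ) : μ (Icc a b) < ⊤ := by
  obtain ⟨M, -, hM⟩ := h.bounded
  have key : ∀ n : ℕ, μ (Icc a (a + n)) < ⊤ := by
    intro n
    induction n with
    | zero =>
      have h1 : a + ((0 : ℕ) : ℝ) ≤ a + 1 := by norm_num
      exact (measure_mono (Icc_subset_Icc_right h1)).trans_lt
        ((hM a).trans_lt ENNReal.ofReal_lt_top)
    | succ n ih =>
      refine (measure_mono (t := Icc a (a + n) ∪ Icc (a + n) (a + n + 1)) ?_).trans_lt
        ((measure_union_le _ _).trans_lt (ENNReal.add_lt_top.2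
          ⟨ih, (hM _).trans_lt ENNReal.ofReal_lt_top⟩))
      intro x hx
      rcases le_total x (a + n) with h | h
      · exact Or.inl ⟨hx.1, h⟩
      · exact Or.inr ⟨h, by have := hx.2; push_cast at this; linarith⟩
  obtain ⟨n, hn⟩ := exists_nat_ge (b - a)
  exact (measure_mono (Icc_subset_Icc_right (by linarith))).trans_lt (key n)

/-- The embedding of `W^{1,2}(ℝ)` into `L²(μ)` is a limit of finite rank interpolation operators. -/
theorem emb_approx {μ : Measure ℝ} [SFinite μ] (h : VanishingAtInfinity μ) {ε : ℝ} (hε : 0 < ε) :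
    ∃ (t : Finset ℤ) (x : ℤ → ℝ) (b : ℤ → Lp ℂ 2 μ),
      ‖emb h - ∑ k ∈ t, (evalAt (x k)).smulRight (b k)‖ ≤ ε := by
  -- The budget is `ε² ‖w‖²`. The tail `|x| > R` costs at most `ε²/4 · 2 ‖w‖²`, by the local bound
  -- with `s = 1`; the interpolation error on `[-R, R]` costs at most `d m0 ‖w'‖²`, and the mesh `d`
  -- is chosen to make `d m0 ≤ ε²/4`.
  obtain ⟨R, hR⟩ := h.tail (ε ^ 2 / 4) (by positivity)
  set m0 : ℝ := (μ (Icc (-R) R)).toReal with hm0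
  have hm0' : μ (Icc (-R) R) = ENNReal.ofReal m0 :=
    (ENNReal.ofReal_toReal (h.measure_Icc_lt_top _ _).ne).symm
  have hm0n : 0 ≤ m0 := ENNReal.toReal_nonneg
  set d : ℝ := ε ^ 2 / 4 / (m0 + 1) with hd
  have hd0 : 0 < d := by positivity
  have hdm : d * m0 ≤ ε ^ 2 / 4 := by
    rw [hd, div_mul_eq_mul_div, div_le_iff₀ (by positivity)]
    nlinarith [sq_nonneg ε]
  set cell : ℤ → Set ℝ := fun k => {x | ⌊x / d⌋ = k} ∩ Icc (-R) R with hcell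
  have hcm : ∀ k, MeasurableSet (cell k) := fun k =>
    (((measurable_id.div_const d).floor) (measurableSet_singleton k)).inter measurableSet_Icc
  have hcf : ∀ k, μ (cell k) ≠ ⊤ := fun k =>
    ((measure_mono inter_subset_right).trans_lt (h.measure_Icc_lt_top _ _)).ne
  refine ⟨Finset.Icc ⌊-R / d⌋ ⌊R / d⌋, fun k => d * k,
    fun k => indicatorConstLp 2 (hcm k) (hcf k) 1, ?_⟩
  set T := ∑ k ∈ Finset.Icc ⌊-R / d⌋ ⌊R / d⌋,
    (evalAt (d * k)).smulRight (indicatorConstLp 2 (hcm k) (hcf k) (1 : ℂ)) with hT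
  refine ContinuousLinearMap.opNorm_le_bound _ hε.le fun w => abs_le_of_sq_le_sq' ?_
    (by positivity) |>.2
  refine norm_sq_le_of_lintegral_le (by positivity) ?_
  have hTw : ∀ᵐ x ∂μ, T w x = ∑ k ∈ Finset.Icc ⌊-R / d⌋ ⌊R / d⌋,
      (cell k).indicator (fun _ => rep w (d * k)) x := by
    have e : T w = ∑ k ∈ Finset.Icc ⌊-R / d⌋ ⌊R / d⌋,
        rep w (d * k) • indicatorConstLp 2 (hcm k) (hcf k) (1 : ℂ) := by
      simp [hT]
    rw [e]
    have h2 : ∀ᵐ x ∂μ, ∀ k : ℤ, (rep w (d * k) • indicatorConstLp 2 (hcm k) (hcf k) (1 : ℂ) :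
        Lp ℂ 2 μ) x = (cell k).indicator (fun _ => rep w (d * k)) x := by
      rw [ae_all_iff]
      intro k
      filter_upwards [Lp.coeFn_smul (rep w (d * k)) (indicatorConstLp 2 (hcm k) (hcf k) (1 : ℂ)),
        indicatorConstLp_coeFn (p := 2) (hs := hcm k) (hμs := hcf k) (c := (1 : ℂ))] with x h1 h2
      rw [h1, Pi.smul_apply, h2]
      by_cases hx : x ∈ cell k <;> simp [hx]
    filter_upwards [Lp.coeFn_finsetSum (Finset.Icc ⌊-R / d⌋ ⌊R / d⌋)
      (fun k : ℤ => rep w (d * k) • indicatorConstLp 2 (hcm k) (hcf k) (1 : ℂ)), h2] with x h1 h2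
    rw [h1, Finset.sum_apply]
    exact Finset.sum_congr rfl fun k _ => h2 k
  -- On `[-R, R]` the function is replaced by its value at the left node of the mesh cell, at
  -- distance at most `d`, so the square error is at most `d ‖w'‖²`. Outside, the approximation is
  -- zero and the error is the function itself.
  have hpt : ∀ᵐ x ∂μ, ENNReal.ofReal (‖(emb h - T) w x‖ ^ 2) ≤
      (Icc (-R) R).indicator (fun _ => ENNReal.ofReal (d * ‖grad w‖ ^ 2)) x +
      {x | R < |x|}.indicator (fun x => ENNReal.ofReal (‖rep w x‖ ^ 2)) x := by
    have e : (emb h - T) w = emb h w - T w := rfl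
    rw [e]
    filter_upwards [Lp.coeFn_sub (emb h w) (T w), coeFn_emb h w, hTw] with x h1 h2 h3
    rw [h1, Pi.sub_apply, h2, h3]
    by_cases hx : x ∈ Icc (-R) R
    · have hk : ⌊x / d⌋ ∈ Finset.Icc ⌊-R / d⌋ ⌊R / d⌋ := by
        rw [Finset.mem_Icc]
        exact ⟨Int.floor_le_floor (div_le_div_of_nonneg_right hx.1 hd0.le),
          Int.floor_le_floor (div_le_div_of_nonneg_right hx.2 hd0.le)⟩
      rw [Finset.sum_eq_single_of_mem _ hk (fun k _ hne => indicator_of_notMem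
        (fun hx' => hne hx'.1.symm) _), indicator_of_mem (show x ∈ cell ⌊x / d⌋ from ⟨rfl, hx⟩),
        indicator_of_mem hx]
      refine le_add_right (ENNReal.ofReal_le_ofReal ?_)
      refine (norm_rep_sub_sq_le' w _ _).trans ?_
      gcongr
      have f1 := Int.floor_le (x / d)
      have f2 := Int.lt_floor_add_one (x / d)
      rw [le_div_iff₀ hd0] at f1
      rw [div_lt_iff₀ hd0] at f2
      rw [abs_of_nonneg (by linarith)]
      linarith
    · have hx' : x ∈ {x | R < |x|} := by
        by_contra h'
        exact hx (abs_le.1 (not_lt.1 h'))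
      rw [Finset.sum_eq_zero (fun k _ => indicator_of_notMem (fun h => hx h.2) _), sub_zero,
        indicator_of_mem hx']
      exact le_add_self
  refine (lintegral_mono_ae hpt).trans ?_
  rw [lintegral_add_left (measurable_const.indicator measurableSet_Icc),
    lintegral_indicator_const measurableSet_Icc, hm0', ← ENNReal.ofReal_mul (by positivity)]
  have hms : MeasurableSet {x : ℝ | R < |x|} :=
    measurableSet_lt measurable_const continuous_abs.measurable
  rw [lintegral_indicator hms]
  have hRM : ∀ t, μ.restrict {x | R < |x|} (Icc t (t + 1)) ≤ ENNReal.ofReal (ε ^ 2 / 4) := by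
    intro t
    rw [Measure.restrict_apply measurableSet_Icc]
    exact hR t
  refine (add_le_add le_rfl (lintegral_rep_le (μ.restrict {x | R < |x|}) hRM one_pos
    le_rfl w)).trans ?_
  · rw [← ENNReal.ofReal_mul (by positivity), ← ENNReal.ofReal_add (by positivity) (by positivity)]
    refine ENNReal.ofReal_le_ofReal ?_
    have h1 := mul_le_mul_of_nonneg_right hdm (sq_nonneg ‖grad w‖)
    rw [mul_pow, sobolev_norm_sq]
    nlinarith [mul_nonneg (sq_nonneg ε) (sq_nonneg ‖grad w‖),
      mul_nonneg (sq_nonneg ε) (sq_nonneg ‖incl w‖)]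

/-! ### The measures associated with a potential -/

theorem withDensity_ofReal_le {V : ℝ → ℝ} (hV : LocallyIntegrable V volume) {U : ℝ → ℝ}
    (hU : ∀ x, U x ≤ |V x|) {a b : ℝ} (hab : a ≤ b) :
    volume.withDensity (fun x => ENNReal.ofReal (U x)) (Icc a b) ≤
      ENNReal.ofReal (∫ t in a..b, |V t|) := by
  rw [withDensity_apply _ measurableSet_Icc, intervalIntegral.integral_of_le hab,
    ← integral_Icc_eq_integral_Ioc, ofReal_integral_eq_lintegral_ofReal]
  · exact lintegral_mono fun x => ENNReal.ofReal_le_ofReal (hU x)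
  · exact (hV.integrableOn_isCompact isCompact_Icc).abs
  · exact Eventually.of_forall fun x => abs_nonneg _

/-- Used with `U = V` and `U = -V`: since `ENNReal.ofReal` truncates at zero, the densities are the
positive and negative parts of `V`. -/
theorem vanishingAtInfinity_withDensity {V : ℝ → ℝ} (hV : LocallyIntegrable V volume)
    (hV0 : Tendsto (fun x : ℝ => ∫ t in x..(x + 1), |V t|) (cocompact ℝ) (𝓝 0)) {U : ℝ → ℝ}
    (hU : ∀ x, U x ≤ |V x|) :
    VanishingAtInfinity (volume.withDensity (fun x => ENNReal.ofReal (U x))) := by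
  have hfar : ∀ ε > 0, ∃ R, 0 ≤ R ∧ ∀ t, R < |t| → ∫ t in t..(t + 1), |V t| ≤ ε := by
    intro ε hε
    have h1 := hV0.eventually (gt_mem_nhds hε)
    rw [← Metric.cobounded_eq_cocompact, (Metric.hasBasis_cobounded_compl_closedBall (0 : ℝ)).eventually_iff]
      at h1
    obtain ⟨R, -, hR⟩ := h1
    refine ⟨|R|, abs_nonneg _, fun t ht => (hR ?_).le⟩
    rw [mem_compl_iff, Metric.mem_closedBall, Real.dist_0_eq_abs, not_le]
    exact (le_abs_self R).trans_lt ht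
  have hle : ∀ t : ℝ, t ≤ t + 1 := fun t => by linarith
  constructor
  · obtain ⟨R, hR0, hR⟩ := hfar 1 one_pos
    set A := ∫ t in (-R)..(R + 1), |V t| with hA
    have hA0 : 0 ≤ A := intervalIntegral.integral_nonneg (by linarith) fun _ _ => abs_nonneg _
    refine ⟨1 + A, by positivity, fun t => ?_⟩
    rcases lt_or_ge R |t| with ht | ht
    · exact (withDensity_ofReal_le hV hU (hle t)).trans
        (ENNReal.ofReal_le_ofReal ((hR t ht).trans (by linarith)))
    · have := abs_le.1 ht
      refine (measure_mono (Icc_subset_Icc this.1 (by linarith [this.2] : t + 1 ≤ R + 1))).trans ?_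
      exact (withDensity_ofReal_le hV hU (by linarith)).trans
        (ENNReal.ofReal_le_ofReal (by linarith))
  · intro ε hε
    obtain ⟨R, hR0, hR⟩ := hfar ε hε
    -- The extra unit makes the intersection empty when `|t| ≤ R`, since then `[t, t + 1]` stays
    -- within `|x| ≤ R + 1`.
    refine ⟨R + 1, fun t => ?_⟩
    rcases lt_or_ge R |t| with ht | ht
    · exact (measure_mono inter_subset_left).trans
        ((withDensity_ofReal_le hV hU (hle t)).trans (ENNReal.ofReal_le_ofReal (hR t ht)))
    · have h0 : Icc t (t + 1) ∩ {x | R + 1 < |x|} = ∅ := by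
        refine eq_empty_of_forall_notMem fun x hx => ?_
        have h1 := abs_le.1 ht
        have h2 : |x| ≤ R + 1 := abs_le.2 ⟨by linarith [hx.1.1], by linarith [hx.1.2]⟩
        exact absurd hx.2 (not_lt.2 h2)
      rw [h0, measure_empty]
      exact zero_le

/-! ### Form operators on `W^{1,2}(ℝ)` -/

/-- The operator of finite rank `w ↦ ∑ w(x_k) b_k`. -/
noncomputable def interpolation {E : Type*} [NormedAddCommGroup E] [NormedSpace ℂ E]
    (t : Finset ℤ) (x : ℤ → ℝ) (b : ℤ → E) : H1 →L[ℂ] E :=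
  ∑ k ∈ t, (evalAt (x k)).smulRight (b k)

theorem interpolation_apply {E : Type*} [NormedAddCommGroup E] [NormedSpace ℂ E]
    (t : Finset ℤ) (x : ℤ → ℝ) (b : ℤ → E) (w : H1) :
    interpolation t x b w = ∑ k ∈ t, rep w (x k) • b k := by
  simp [interpolation]

theorem interpolation_hasFiniteRange {E : Type*} [NormedAddCommGroup E] [NormedSpace ℂ E]
    (t : Finset ℤ) (x : ℤ → ℝ) (b : ℤ → E) :
    (interpolation t x b : H1 →ₗ[ℂ] E).HasNoetherianRange := by
  rw [← LinearMap.mem_finiteRange_iff_hasNoetherianRange]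
  have : (interpolation t x b : H1 →ₗ[ℂ] E) =
      ∑ k ∈ t, ((evalAt (x k)).smulRight (b k) : H1 →L[ℂ] E).toLinearMap := by
    ext w
    simp [interpolation_apply]
  rw [this]
  refine Submodule.sum_mem _ fun k _ => ?_
  have e : ((evalAt (x k)).smulRight (b k) : H1 →L[ℂ] E).toLinearMap =
      (LinearMap.toSpanSingleton ℂ E (b k)) ∘ₗ (evalAt (x k)).toLinearMap := by
    ext w
    simp
  rw [e, LinearMap.mem_finiteRange_iff_hasNoetherianRange]
  exact LinearMap.HasNoetherianRange.of_isNoetherian_dom.comp_right _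

/-- The form operator of a relatively form compact perturbation of `-d²/dx²`. -/
structure FormCompact (T : H1 →L[ℂ] H1) : Prop where
  symm : ∀ w w', inner ℂ (T w) w' = inner ℂ w (T w')
  small : ∀ δ > 0, ∃ C, 0 ≤ C ∧
    ∀ w, ‖inner ℂ w (T w)‖ ≤ δ * ‖grad w‖ ^ 2 + C * ‖incl w‖ ^ 2
  approx : ∀ ε > 0, ∃ (t : Finset ℤ) (x : ℤ → ℝ) (b : ℤ → H1), ‖T - interpolation t x b‖ ≤ ε

open ContinuousLinearMap in
-- The form of this operator is the inner product of `L²(μ)`; smallness and finite rank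
-- approximation are inherited from the embedding.
theorem formCompact_emb {μ : Measure ℝ} [SFinite μ] (h : VanishingAtInfinity μ) :
    FormCompact ((adjoint (emb h)).comp (emb h)) where
  symm w w' := by
    rw [comp_apply, comp_apply, adjoint_inner_left, adjoint_inner_right]
  small δ hδ := by
    obtain ⟨C, hC, hb⟩ := emb_infinitesimal h hδ
    refine ⟨C, hC, fun w => ?_⟩
    rw [comp_apply, adjoint_inner_right, inner_self_eq_norm_sq_to_K, norm_pow]
    simpa using hb w
  approx ε hε := by
    obtain ⟨t, x, b, hb⟩ := emb_approx h (ε := ε / (‖adjoint (emb h)‖ + 1)) (by positivity)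
    refine ⟨t, x, fun k => adjoint (emb h) (b k), ?_⟩
    have e : (adjoint (emb h)).comp (emb h) - interpolation t x (fun k => adjoint (emb h) (b k)) =
        (adjoint (emb h)).comp (emb h - ∑ k ∈ t, (evalAt (x k)).smulRight (b k)) := by
      ext1 w
      simp [interpolation_apply]
    rw [e]
    refine (opNorm_comp_le _ _).trans ?_
    have h1 := mul_le_mul_of_nonneg_left hb (norm_nonneg (adjoint (emb h)))
    refine h1.trans ?_
    rw [mul_div_assoc', div_le_iff₀ (by positivity)]
    nlinarith [norm_nonneg (adjoint (emb h))]

theorem FormCompact.sub {T T' : H1 →L[ℂ] H1} (h : FormCompact T) (h' : FormCompact T') :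
    FormCompact (T - T') where
  symm w w' := by
    simp only [_root_.sub_apply, inner_sub_left, inner_sub_right, h.symm, h'.symm]
  small δ hδ := by
    obtain ⟨C, hC, hb⟩ := h.small (δ / 2) (by positivity)
    obtain ⟨C', hC', hb'⟩ := h'.small (δ / 2) (by positivity)
    refine ⟨C + C', by positivity, fun w => ?_⟩
    rw [_root_.sub_apply, inner_sub_right]
    refine (norm_sub_le _ _).trans ((add_le_add (hb w) (hb' w)).trans (le_of_eq ?_))
    ring
  approx ε hε := by
    obtain ⟨t, x, b, hb⟩ := h.approx (ε / 2) (by positivity)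
    obtain ⟨t', x', b', hb'⟩ := h'.approx (ε / 2) (by positivity)
    obtain ⟨s, y, c, hs⟩ : ∃ (s : Finset ℤ) (y : ℤ → ℝ) (c : ℤ → H1),
        interpolation s y c = interpolation t x b - interpolation t' x' b' := by
      -- Nodes are indexed by `ℤ`, so the two families are merged through a bijection of `ℤ ⊕ ℤ`
      -- with `ℤ`.
      let f : ℤ ⊕ ℤ ≃ ℤ := (Denumerable.eqv (ℤ ⊕ ℤ)).trans (Denumerable.eqv ℤ).symm
      refine ⟨(t.disjSum t').map f.toEmbedding, fun k => Sum.elim x x' (f.symm k),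
        fun k => Sum.elim b (fun j => -b' j) (f.symm k), ?_⟩
      ext1 w
      rw [interpolation_apply, _root_.sub_apply, interpolation_apply,
        interpolation_apply, Finset.sum_map, Finset.sum_disjSum]
      simp [sub_eq_add_neg]
    refine ⟨s, y, c, ?_⟩
    rw [hs, sub_sub_sub_comm]
    exact (norm_sub_le _ _).trans (by linarith)

/-- The operator of the form `κ ⟨u', w'⟩ + μ ⟨u, w⟩ + T(u, w)` on `W^{1,2}(ℝ)`. -/
noncomputable def formOp (T : H1 →L[ℂ] H1) (κ μ : ℂ) : H1 →L[ℂ] H1 :=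
  κ • (ContinuousLinearMap.adjoint grad).comp grad +
    μ • (ContinuousLinearMap.adjoint incl).comp incl + T

theorem formOp_apply (T : H1 →L[ℂ] H1) (κ μ : ℂ) (w : H1) :
    formOp T κ μ w = κ • ContinuousLinearMap.adjoint grad (grad w) +
      μ • ContinuousLinearMap.adjoint incl (incl w) + T w := rfl

theorem inner_formOp (T : H1 →L[ℂ] H1) (κ μ : ℂ) (u w : H1) :
    inner ℂ u (formOp T κ μ w) = κ * inner ℂ (grad u) (grad w) +
      μ * inner ℂ (incl u) (incl w) + inner ℂ u (T w) := by
  rw [formOp_apply, inner_add_right, inner_add_right, inner_smul_right, inner_smul_right,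
    ContinuousLinearMap.adjoint_inner_right, ContinuousLinearMap.adjoint_inner_right]

theorem inner_formOp_self (T : H1 →L[ℂ] H1) (κ μ : ℂ) (w : H1) :
    inner ℂ w (formOp T κ μ w) = κ * (‖grad w‖ ^ 2 : ℝ) + μ * (‖incl w‖ ^ 2 : ℝ) +
      inner ℂ w (T w) := by
  rw [inner_formOp, inner_self_eq_norm_sq_to_K, inner_self_eq_norm_sq_to_K]
  norm_cast

theorem formOp_symm {T : H1 →L[ℂ] H1} (hT : FormCompact T) (κ μ : ℝ) (u w : H1) :
    inner ℂ (formOp T κ μ u) w = inner ℂ u (formOp T κ μ w) := by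
  rw [← inner_conj_symm, inner_formOp, inner_formOp]
  simp only [map_add, map_mul, inner_conj_symm, Complex.conj_ofReal]
  rw [hT.symm]

/-- The Lax–Milgram theorem, with the modulus of the form in place of its real part. -/
theorem isUnit_of_coercive {T : H1 →L[ℂ] H1} {c : ℝ} (hc : 0 < c)
    (h : ∀ w, c * ‖w‖ ^ 2 ≤ ‖inner ℂ w (T w)‖) : IsUnit T := by
  refine ContinuousLinearMap.isUnit_of_forall_le_norm_inner_map T (c := ⟨c, hc.le⟩) hc fun w => ?_
  rw [norm_inner_symm, mul_comm]
  exact h w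

/-- Take form bound `1/4` with constant `C`: then `κ ≥ 1/2` leaves `1/4` of the gradient term, and
`μ ≥ 1 + C` leaves at least `1` of the other. -/
theorem FormCompact.exists_coercive {T : H1 →L[ℂ] H1} (hT : FormCompact T) :
    ∃ L : ℝ, 1 ≤ L ∧ ∀ κ μ : ℝ, 1 / 2 ≤ κ → L ≤ μ →
      (∀ w, 1 / 4 * ‖w‖ ^ 2 ≤ (inner ℂ w (formOp T κ μ w)).re) ∧ IsUnit (formOp T κ μ) := by
  obtain ⟨C, hC, hb⟩ := hT.small (1 / 4) (by norm_num)
  refine ⟨1 + C, by linarith, fun κ μ hκ hμ => ?_⟩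
  have key : ∀ w, 1 / 4 * ‖w‖ ^ 2 ≤ (inner ℂ w (formOp T κ μ w)).re := by
    intro w
    have h1 := (abs_le.1 ((Complex.abs_re_le_norm _).trans (hb w))).1
    rw [inner_formOp_self, Complex.add_re, Complex.add_re, ← Complex.ofReal_mul,
      ← Complex.ofReal_mul, Complex.ofReal_re, Complex.ofReal_re, sobolev_norm_sq]
    nlinarith [mul_le_mul_of_nonneg_right hκ (sq_nonneg ‖grad w‖),
      mul_le_mul_of_nonneg_right hμ (sq_nonneg ‖incl w‖), sq_nonneg ‖incl w‖]
  exact ⟨key, isUnit_of_coercive (by norm_num : (0 : ℝ) < 1 / 4) fun w =>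
    (key w).trans (Complex.re_le_norm _)⟩

/-- Two complex numbers that are not opposite lie strictly on one side of some line through the
origin, so their nonnegative combinations cannot cancel. -/
theorem exists_sectorial_bound {κ μ : ℂ} (hκ : κ ≠ 0) (hμ : μ ≠ 0)
    (h : ∀ t : ℝ, 0 ≤ t → κ ≠ -(t * μ)) :
    ∃ c : ℝ, 0 < c ∧ ∀ a b : ℝ, 0 ≤ a → 0 ≤ b → c * (a + b) ≤ ‖κ * a + μ * b‖ := by
  have hκ0 : 0 < ‖κ‖ := norm_pos_iff.2 hκ
  have hμ0 : 0 < ‖μ‖ := norm_pos_iff.2 hμ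
  set z := κ * (starRingEnd ℂ) μ with hz
  have hzn : ‖z‖ = ‖κ‖ * ‖μ‖ := by rw [hz, norm_mul, RCLike.norm_conj]
  have hre : -‖z‖ < z.re := by
    refine lt_of_le_of_ne (abs_le.1 (Complex.abs_re_le_norm z)).1 fun he => ?_
    have him : z.im = 0 := by
      have h1 := Complex.sq_norm z
      rw [Complex.normSq_apply, ← he] at h1
      nlinarith
    have hz' : z = -(‖z‖ : ℂ) := Complex.ext (by simp [← he]) (by simp [him])
    refine h (‖κ‖ / ‖μ‖) (by positivity) ?_
    have h2 : κ * (‖μ‖ : ℂ) ^ 2 = z * μ := by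
      rw [hz, mul_assoc, Complex.conj_mul']
    rw [hz', hzn] at h2
    have hμc : (‖μ‖ : ℂ) ≠ 0 := by exact_mod_cast hμ0.ne'
    push_cast at h2 ⊢
    field_simp
    refine mul_right_cancel₀ hμc ?_
    linear_combination h2
  -- Rotation by the conjugate bisector of the directions of `κ` and `μ`. It gives both a positive
  -- real part, equal to `‖κ‖‖μ‖ + Re (κ μ̄)` divided by `‖μ‖` and by `‖κ‖` respectively.
  set θ : ℂ := (starRingEnd ℂ) κ / ‖κ‖ + (starRingEnd ℂ) μ / ‖μ‖ with hθ
  set d := ‖z‖ + z.re with hd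
  have hd0 : 0 < d := by linarith
  have h1 : (θ * κ).re = d / ‖μ‖ := by
    have : θ * κ = ((‖κ‖ : ℝ) : ℂ) + z / ((‖μ‖ : ℝ) : ℂ) := by
      have hκc : (‖κ‖ : ℂ) ≠ 0 := by exact_mod_cast hκ0.ne'
      have := Complex.conj_mul' κ
      rw [hθ, hz, add_mul, div_mul_eq_mul_div, this, div_mul_eq_mul_div, mul_comm κ]
      congr 1
      field_simp
    rw [this, Complex.add_re, Complex.ofReal_re, Complex.div_ofReal_re, hd, hzn]
    field_simp
  have h2 : (θ * μ).re = d / ‖κ‖ := by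
    have : θ * μ = ((‖μ‖ : ℝ) : ℂ) + (starRingEnd ℂ) z / ((‖κ‖ : ℝ) : ℂ) := by
      have hμc : (‖μ‖ : ℂ) ≠ 0 := by exact_mod_cast hμ0.ne'
      have := Complex.conj_mul' μ
      rw [hθ, hz, add_mul, div_mul_eq_mul_div, div_mul_eq_mul_div, this, map_mul,
        Complex.conj_conj, add_comm]
      congr 1
      field_simp
    rw [this, Complex.add_re, Complex.ofReal_re, Complex.div_ofReal_re, Complex.conj_re, hd, hzn]
    field_simp
  have hθ2 : ‖θ‖ ≤ 2 := by
    refine (norm_add_le _ _).trans (le_of_eq ?_)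
    rw [norm_div, norm_div, RCLike.norm_conj, RCLike.norm_conj, Complex.norm_real,
      Complex.norm_real, norm_norm, norm_norm, div_self hκ0.ne', div_self hμ0.ne']
    norm_num
  set m := min (d / ‖μ‖) (d / ‖κ‖) with hm
  have hm0 : 0 < m := lt_min (by positivity) (by positivity)
  refine ⟨m / 2, by positivity, fun a b ha hb => ?_⟩
  have h3 : m * (a + b) ≤ (θ * (κ * a + μ * b)).re := by
    have : θ * (κ * a + μ * b) = (θ * κ) * ((a : ℝ) : ℂ) + (θ * μ) * ((b : ℝ) : ℂ) := by ring
    rw [this, Complex.add_re, Complex.re_mul_ofReal, Complex.re_mul_ofReal, h1, h2]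
    nlinarith [mul_le_mul_of_nonneg_right (min_le_left (d / ‖μ‖) (d / ‖κ‖)) ha,
      mul_le_mul_of_nonneg_right (min_le_right (d / ‖μ‖) (d / ‖κ‖)) hb]
  have h4 := h3.trans (Complex.re_le_norm _)
  rw [norm_mul] at h4
  nlinarith [mul_le_mul_of_nonneg_right hθ2 (norm_nonneg (κ * a + μ * b))]

/-- Outside of the closed half-line of opposite directions, the form operator is Fredholm. -/
theorem FormCompact.isFredholm_formOp {T : H1 →L[ℂ] H1} (hT : FormCompact T) {κ μ : ℂ}
    (hκ : κ ≠ 0) (hμ : μ ≠ 0) (h : ∀ t : ℝ, 0 ≤ t → κ ≠ -(t * μ)) :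
    (formOp T κ μ).IsFredholm := by
  obtain ⟨c, hc, hcb⟩ := exists_sectorial_bound hκ hμ h
  -- Replacing `T` by `T - F`, of norm at most `c/2`, keeps half of the sectorial bound, so the new
  -- operator is invertible. The discarded `F` has finite rank, and the inverse is a Fredholm
  -- quasi-inverse of the original operator.
  obtain ⟨t, x, b, hb⟩ := hT.approx (c / 2) (by positivity)
  set F := interpolation t x b with hF
  have hU : IsUnit (formOp (T - F) κ μ) := by
    refine isUnit_of_coercive (by positivity : 0 < c / 2) fun w => ?_
    have h1 := hcb (‖grad w‖ ^ 2) (‖incl w‖ ^ 2) (sq_nonneg _) (sq_nonneg _)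
    have h2 : ‖inner ℂ w ((T - F) w)‖ ≤ c / 2 * ‖w‖ ^ 2 := by
      refine (norm_inner_le_norm _ _).trans ?_
      have := (T - F).le_of_opNorm_le hb w
      nlinarith [norm_nonneg w]
    rw [inner_formOp_self]
    have h3 := norm_sub_le_norm_add (κ * ((‖grad w‖ ^ 2 : ℝ) : ℂ) + μ * ((‖incl w‖ ^ 2 : ℝ) : ℂ))
      (inner ℂ w ((T - F) w))
    rw [sobolev_norm_sq] at h2 ⊢
    linarith
  obtain ⟨U, hU⟩ := hU
  have e : formOp T κ μ = ↑U + F := by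
    rw [hU]
    ext1 w
    simp only [formOp_apply, _root_.add_apply, _root_.sub_apply]
    abel
  have hFr := interpolation_hasFiniteRange t x b
  refine ContinuousLinearMap.IsFredholm.of_isQuasiInverse (v := (↑U⁻¹ : H1 →L[ℂ] H1))
    ⟨?_, ?_⟩
  · refine LinearMap.FiniteRangeSetoid.equiv_iff_hasNoetherianRange.2 ?_
    have : (↑U⁻¹ : H1 →L[ℂ] H1).toLinearMap ∘ₗ (formOp T κ μ).toLinearMap - LinearMap.id =
        (↑U⁻¹ : H1 →L[ℂ] H1).toLinearMap ∘ₗ F.toLinearMap := by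
      ext1 w
      have h1 : (↑U⁻¹ : H1 →L[ℂ] H1) ((U : H1 →L[ℂ] H1) w) = w :=
        congr($(U.inv_mul) w)
      simp [e, h1]
    rw [this]
    exact hFr.comp_left _
  · refine LinearMap.FiniteRangeSetoid.equiv_iff_hasNoetherianRange.2 ?_
    have : (formOp T κ μ).toLinearMap ∘ₗ (↑U⁻¹ : H1 →L[ℂ] H1).toLinearMap - LinearMap.id =
        F.toLinearMap ∘ₗ (↑U⁻¹ : H1 →L[ℂ] H1).toLinearMap := by
      ext1 w
      have h1 : (U : H1 →L[ℂ] H1) ((↑U⁻¹ : H1 →L[ℂ] H1) w) = w :=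
        congr($(U.mul_inv) w)
      simp [e, h1]
    rw [this]
    exact hFr.comp_right _

/-! ### The form operator of a potential -/

/-- The form operator `⟨u, T w⟩ = ∫ V ū w` of a potential. -/
noncomputable def potentialOp {V : ℝ → ℝ} (hV : LocallyIntegrable V volume)
    (hV0 : Tendsto (fun x : ℝ => ∫ t in x..(x + 1), |V t|) (cocompact ℝ) (𝓝 0)) :
    H1 →L[ℂ] H1 :=
  (ContinuousLinearMap.adjoint
    (emb (vanishingAtInfinity_withDensity hV hV0 (fun x => le_abs_self (V x))))).comp
    (emb (vanishingAtInfinity_withDensity hV hV0 (fun x => le_abs_self (V x)))) -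
  (ContinuousLinearMap.adjoint
    (emb (vanishingAtInfinity_withDensity hV hV0 (fun x => neg_le_abs (V x))))).comp
    (emb (vanishingAtInfinity_withDensity hV hV0 (fun x => neg_le_abs (V x))))

theorem formCompact_potentialOp {V : ℝ → ℝ} (hV : LocallyIntegrable V volume)
    (hV0 : Tendsto (fun x : ℝ => ∫ t in x..(x + 1), |V t|) (cocompact ℝ) (𝓝 0)) :
    FormCompact (potentialOp hV hV0) :=
  (formCompact_emb _).sub (formCompact_emb _)

theorem inner_emb {U : ℝ → ℝ} (hU : AEMeasurable U volume)
    (h : VanishingAtInfinity (volume.withDensity (fun x => ENNReal.ofReal (U x))))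
    (u w : H1) :
    Integrable (fun x => max (U x) 0 • ((starRingEnd ℂ) (rep u x) * rep w x)) ∧
    inner ℂ (emb h u) (emb h w) =
      ∫ x, max (U x) 0 • ((starRingEnd ℂ) (rep u x) * rep w x) := by
  have e0 : ∀ᵐ x ∂(volume.withDensity (fun x => ENNReal.ofReal (U x))),
      inner ℂ (emb h u x : ℂ) (emb h w x) = (starRingEnd ℂ) (rep u x) * rep w x := by
    filter_upwards [coeFn_emb h u, coeFn_emb h w] with x h1 h2
    rw [h1, h2, RCLike.inner_apply, mul_comm]
  have hfin : ∀ᵐ x ∂(volume : Measure ℝ), ENNReal.ofReal (U x) < ⊤ :=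
    Eventually.of_forall fun _ => ENNReal.ofReal_lt_top
  have htr : ∀ x, (ENNReal.ofReal (U x)).toReal = max (U x) 0 := fun x =>
    ENNReal.toReal_ofReal'
  constructor
  · have h1 := (L2.integrable_inner (𝕜 := ℂ) (emb h u) (emb h w)).congr e0
    rw [integrable_withDensity_iff_integrable_smul₀' hU.ennreal_ofReal hfin] at h1
    simpa only [htr] using h1
  · rw [L2.inner_def, integral_congr_ae e0,
      integral_withDensity_eq_integral_toReal_smul₀ hU.ennreal_ofReal hfin]
    simp only [htr]

theorem inner_potentialOp {V : ℝ → ℝ} (hV : LocallyIntegrable V volume)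
    (hV0 : Tendsto (fun x : ℝ => ∫ t in x..(x + 1), |V t|) (cocompact ℝ) (𝓝 0)) (u w : H1) :
    inner ℂ u (potentialOp hV hV0 w) = ∫ x, V x • ((starRingEnd ℂ) (rep u x) * rep w x) := by
  have hm : AEMeasurable V volume := hV.aestronglyMeasurable.aemeasurable
  obtain ⟨h1, h2⟩ := inner_emb hm
    (vanishingAtInfinity_withDensity hV hV0 (fun x => le_abs_self (V x))) u w
  obtain ⟨h3, h4⟩ := inner_emb hm.neg
    (vanishingAtInfinity_withDensity hV hV0 (fun x => neg_le_abs (V x))) u w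
  rw [potentialOp, _root_.sub_apply, ContinuousLinearMap.comp_apply,
    ContinuousLinearMap.comp_apply, inner_sub_right, ContinuousLinearMap.adjoint_inner_right,
    ContinuousLinearMap.adjoint_inner_right, h2]
  refine (congrArg _ h4).trans ?_
  rw [← integral_sub h1 h3]
  congr 1 with x
  rw [← sub_smul]
  congr 1
  rcases le_total 0 (V x) with h | h
  · rw [max_eq_left h, Pi.neg_apply, max_eq_right (by linarith)]; ring
  · rw [max_eq_right h, Pi.neg_apply, max_eq_left (by linarith)]; ring

open ContinuousLinearMap (adjoint adjoint_inner_left adjoint_inner_right)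

/-! ### Skew-symmetry of the weak derivative -/

theorem locallyIntegrable_L2 (u : L2) : LocallyIntegrable (fun x => (u x : ℂ)) volume :=
  (Lp.memLp u).locallyIntegrable (by norm_num)

theorem rep_eq_primitive (w : H1) :
    rep w = fun x => rep w 0 + ∫ t in (0 : ℝ)..x, (grad w t : ℂ) :=
  funext fun x => by rw [← rep_sub_rep]; ring

theorem acLoc_rep (w : H1) : ACLoc (rep w) := by
  rw [rep_eq_primitive]
  have hconst : ACLoc (fun _ : ℝ => rep w 0) := fun a b =>
    (contDiff_const (n := 1)).contDiffOn.absolutelyContinuousOnInterval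
  exact hconst.add (acLoc_primitive (locallyIntegrable_L2 _) 0)

theorem ae_hasDerivAt_rep (w : H1) : ∀ᵐ x, HasDerivAt (rep w) (grad w x) x := by
  filter_upwards [LocallyIntegrable.ae_hasDerivAt_integral (locallyIntegrable_L2 (grad w))]
    with x hx
  rw [rep_eq_primitive]
  exact (hx 0).const_add _

theorem ACLoc.star {f : ℝ → ℂ} (hf : ACLoc f) : ACLoc (fun x => (starRingEnd ℂ) (f x)) := by
  intro a b
  rw [absolutelyContinuousOnInterval_iff]
  intro ε hε
  obtain ⟨δ, hδ, h⟩ := (absolutelyContinuousOnInterval_iff f a b).1 (hf a b) ε hε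
  refine ⟨δ, hδ, fun E hE hlt => lt_of_eq_of_lt (Finset.sum_congr rfl fun i _ => ?_) (h E hE hlt)⟩
  exact Complex.dist_conj_conj _ _

theorem tendsto_rep (w : H1) {l : ℕ → ℝ}
    (hl : Tendsto (fun n => ∫ t in l n..(l n + 1),
      (2 / 1 * ‖incl w t‖ ^ 2 + 2 * 1 * ‖grad w t‖ ^ 2)) atTop (𝓝 0)) :
    Tendsto (fun n => rep w (l n)) atTop (𝓝 0) := by
  have h : Tendsto (fun n => ‖rep w (l n)‖ ^ 2) atTop (𝓝 0) :=
    squeeze_zero (fun n => sq_nonneg _) (fun n => norm_rep_sq_le w (l n) one_pos) hl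
  have h2 := (Real.continuous_sqrt.tendsto 0).comp h
  rw [Real.sqrt_zero] at h2
  refine tendsto_zero_iff_norm_tendsto_zero.2 (h2.congr fun n => ?_)
  simp [Real.sqrt_sq]

theorem tendsto_rep_natCast (w : H1) :
    Tendsto (fun n : ℕ => rep w n) atTop (𝓝 0) ∧
    Tendsto (fun n : ℕ => rep w (-n)) atTop (𝓝 0) := by
  set g : ℝ → ℝ := fun t => 2 / 1 * ‖incl w t‖ ^ 2 + 2 * 1 * ‖grad w t‖ ^ 2 with hg
  have hgi : Integrable g :=
    ((integrable_norm_sq_L2 (incl w)).const_mul _).add ((integrable_norm_sq_L2 (grad w)).const_mul _)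
  have hi : ∀ a b, IntervalIntegrable g volume a b := fun _ _ => hgi.intervalIntegrable
  have t1 : Tendsto (fun n : ℕ => (n : ℝ)) atTop atTop := tendsto_natCast_atTop_atTop
  have t2 : Tendsto (fun n : ℕ => (n : ℝ) + 1) atTop atTop := tendsto_atTop_add_const_right _ _ t1
  have t3 : Tendsto (fun n : ℕ => -(n : ℝ)) atTop atBot := tendsto_neg_atTop_atBot.comp t1
  have t4 : Tendsto (fun n : ℕ => -(n : ℝ) + 1) atTop atBot := tendsto_atBot_add_const_right _ _ t3
  have I1 := intervalIntegral_tendsto_integral hgi t3 t1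
  constructor
  · refine tendsto_rep w ?_
    have := (intervalIntegral_tendsto_integral hgi t3 t2).sub I1
    rw [sub_self] at this
    exact this.congr fun n => intervalIntegral.integral_interval_sub_left (hi _ _) (hi _ _)
  · refine tendsto_rep w ?_
    have := I1.sub (intervalIntegral_tendsto_integral hgi t4 t1)
    rw [sub_self] at this
    refine this.congr fun n => ?_
    rw [← intervalIntegral.integral_add_adjacent_intervals (hi (-(n : ℝ)) (-n + 1)) (hi _ _)]
    exact add_sub_cancel_right _ _

/-- Integrate `(ū w)'` over `[-n, n]`. The boundary terms tend to zero, since elements of `W^{1,2}`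
vanish along the integers at both ends. -/
theorem inner_grad_incl (u w : H1) :
    inner ℂ (grad u) (incl w) = - inner ℂ (incl u) (grad w) := by
  set h : ℝ → ℂ := fun x =>
    (starRingEnd ℂ) (grad u x) * rep w x + (starRingEnd ℂ) (rep u x) * grad w x with hh
  have e1 : (fun x => inner ℂ (grad u x : ℂ) (incl w x)) =ᵐ[volume]
      fun x => (starRingEnd ℂ) (grad u x) * rep w x := by
    filter_upwards [rep_ae w] with x hx
    rw [hx, RCLike.inner_apply, mul_comm]
  have e2 : (fun x => inner ℂ (incl u x : ℂ) (grad w x)) =ᵐ[volume]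
      fun x => (starRingEnd ℂ) (rep u x) * grad w x := by
    filter_upwards [rep_ae u] with x hx
    rw [hx, RCLike.inner_apply, mul_comm]
  have i1 := (L2.integrable_inner (𝕜 := ℂ) (grad u) (incl w)).congr e1
  have i2 := (L2.integrable_inner (𝕜 := ℂ) (incl u) (grad w)).congr e2
  have hi : Integrable h := i1.add i2
  set F : ℝ → ℂ := fun x => (starRingEnd ℂ) (rep u x) * rep w x with hF
  have key : ∀ a b : ℝ, ∫ x in a..b, h x = F b - F a := by
    intro a b
    have hAC : AbsolutelyContinuousOnInterval (F - fun x => ∫ t in (0:ℝ)..x, h t) a b :=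
      ((acLoc_rep u).star a b).smul (acLoc_rep w a b) |>.sub
        (acLoc_primitive hi.locallyIntegrable 0 a b)
    obtain ⟨C, hC⟩ := hAC.const_of_ae_hasDerivAt_zero (by
      filter_upwards [ae_hasDerivAt_rep u, ae_hasDerivAt_rep w,
        LocallyIntegrable.ae_hasDerivAt_integral hi.locallyIntegrable] with x h1 h2 h3 _
      have h4 : HasDerivAt (fun x => (starRingEnd ℂ) (rep u x)) ((starRingEnd ℂ) (grad u x)) x :=
        Complex.conjCLE.hasFDerivAt.comp_hasDerivAt x h1
      have := (h4.mul h2).sub (h3 0)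
      rw [hh] at this
      simp only [sub_self] at this
      exact this)
    have ea := hC a left_mem_uIcc
    have eb := hC b right_mem_uIcc
    simp only [Pi.sub_apply] at ea eb
    rw [← intervalIntegral.integral_interval_sub_left (hi.intervalIntegrable (a := 0))
      hi.intervalIntegrable]
    linear_combination ea - eb
  have t1 : Tendsto (fun n : ℕ => (n : ℝ)) atTop atTop := tendsto_natCast_atTop_atTop
  have t3 : Tendsto (fun n : ℕ => -(n : ℝ)) atTop atBot := tendsto_neg_atTop_atBot.comp t1
  have l1 := intervalIntegral_tendsto_integral hi t3 t1
  simp only [key] at l1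
  have hc : Tendsto (starRingEnd ℂ : ℂ → ℂ) (𝓝 0) (𝓝 0) := by
    have := Complex.continuous_conj.tendsto 0
    rwa [map_zero] at this
  have l2 : Tendsto (fun n : ℕ => F n - F (-n)) atTop (𝓝 (0 * 0 - 0 * 0)) :=
    ((hc.comp (tendsto_rep_natCast u).1).mul (tendsto_rep_natCast w).1).sub
      ((hc.comp (tendsto_rep_natCast u).2).mul (tendsto_rep_natCast w).2)
  have h0 : ∫ x, h x = 0 := by
    rw [tendsto_nhds_unique l1 l2]; simp
  rw [hh, integral_add i1 i2, ← integral_congr_ae e1, ← integral_congr_ae e2, ← L2.inner_def,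
    ← L2.inner_def] at h0
  exact eq_neg_of_add_eq_zero_left h0

/-- On `W^{1,2}` the weak derivative taken in the dual space agrees with the one in `L²`. This
matches the block operator on its original domain with its weak form. -/
theorem adjoint_grad_incl (w : H1) : adjoint grad (incl w) = - adjoint incl (grad w) := by
  refine ext_inner_left ℂ fun u => ?_
  rw [adjoint_inner_right, inner_neg_right, adjoint_inner_right, inner_grad_incl]

theorem exists_smooth {ψ : ℝ → ℂ} (hψ : ContDiff ℝ ∞ ψ) (hc : HasCompactSupport ψ) :
    ∃ w : H1, incl w = toL2 ψ hψ.continuous hc ∧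
      grad w = toL2 (deriv ψ) (hψ.continuous_deriv (by simp)) hc.deriv ∧ rep w = ψ := by
  obtain ⟨w, h1, h2⟩ := exists_sobolev (hasWeakDeriv_toL2 hψ hc)
  refine ⟨w, h1, h2, rep_eq_of_ae hψ.continuous ?_⟩
  rw [h1]
  exact coeFn_toL2 hψ.continuous hc

/-- `L²` embeds injectively in `W^{-1,2}` because test functions already separate its elements. -/
theorem eq_zero_of_adjoint_incl_eq_zero {y : L2} (h : adjoint incl y = 0) : y = 0 := by
  refine eq_zero_of_forall_inner_toL2 fun φ hφ hc => ?_
  obtain ⟨w, h1, -⟩ := exists_smooth (Complex.ofRealCLM.contDiff.comp hφ)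
    (hasCompactSupport_ofReal hc)
  have : inner ℂ (incl w) y = 0 := by rw [← adjoint_inner_right, h, inner_zero_right]
  rw [h1] at this
  exact this

/-! ### The Schrödinger operator is the operator of its form -/

section Schrodinger

variable {V : ℝ → ℝ} (hV : LocallyIntegrable V volume)
    (hV0 : Tendsto (fun x : ℝ => ∫ t in x..(x + 1), |V t|) (cocompact ℝ) (𝓝 0))

theorem mem_graph_schrodinger_of_form (m : ℝ) {w : H1} {y : L2}
    (h : formOp (potentialOp hV hV0) 1 (m ^ 2 : ℝ) w = adjoint incl y) :
    (incl w, y) ∈ (schrodinger m V).graph := by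
  rw [mem_graph_schrodinger]
  have hVc : LocallyIntegrable (fun x => rep w x • (V x : ℂ)) volume :=
    LocallyIntegrable.continuous_smul (𝕜 := ℂ) (continuous_rep w) fun x => by
      obtain ⟨s, hs, h⟩ := hV x
      exact ⟨s, hs, h.ofReal⟩
  -- Solving the form equation for the second derivative gives `w'' = p` weakly, with `p` only
  -- locally integrable. So `w'` is a primitive of `p`, hence locally absolutely continuous.
  set p : ℝ → ℂ := fun x => (m : ℂ) ^ 2 * rep w x + rep w x • (V x : ℂ) - y x with hp
  have hm2 : LocallyIntegrable (fun x => (m : ℂ) ^ 2 * rep w x) volume :=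
    (continuous_const.mul (continuous_rep w)).locallyIntegrable
  have hpl : LocallyIntegrable p volume := (hm2.add hVc).sub (locallyIntegrable_L2 y)
  have hweak : ∀ φ : ℝ → ℝ, ContDiff ℝ ∞ φ → HasCompactSupport φ →
      ∫ x, deriv φ x • (grad w x : ℂ) = - ∫ x, φ x • p x := by
    intro φ hφ hc
    have hφc : ContDiff ℝ ∞ (fun x => (φ x : ℂ)) := Complex.ofRealCLM.contDiff.comp hφ
    obtain ⟨u, h1, h2, h3⟩ := exists_smooth hφc (hasCompactSupport_ofReal hc)
    have hd : deriv (fun x => (φ x : ℂ)) = fun x => ((deriv φ x : ℝ) : ℂ) := funext fun x =>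
      (hφ.differentiable (by simp) x).hasDerivAt.ofReal_comp.deriv
    have h4 := inner_formOp (potentialOp hV hV0) 1 (m ^ 2 : ℝ) u w
    rw [h, adjoint_inner_right, inner_potentialOp, h3, h1, h2, inner_toL2, inner_toL2, inner_toL2,
      hd] at h4
    simp only [Complex.conj_ofReal] at h4
    have int : ∀ {z : ℝ → ℂ}, LocallyIntegrable z volume → Integrable (fun x => (φ x : ℂ) * z x) :=
      fun hz => by
        have := hz.integrable_smul_left_of_hasCompactSupport hφ.continuous hc
        simpa only [Complex.real_smul] using this
    have e1 : ∫ x, (φ x : ℂ) * incl w x = ∫ x, (φ x : ℂ) * rep w x := by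
      refine integral_congr_ae ?_
      filter_upwards [rep_ae w] with x hx
      rw [hx]
    have e2 : ∫ x, φ x • p x = (m : ℂ) ^ 2 * (∫ x, (φ x : ℂ) * rep w x) +
        (∫ x, V x • ((φ x : ℂ) * rep w x)) - ∫ x, (φ x : ℂ) * y x := by
      rw [← integral_const_mul, ← integral_add, ← integral_sub]
      · congr 1 with x
        simp only [hp, Complex.real_smul, smul_eq_mul]
        ring
      · refine ((int hm2).add (int hVc)).congr (Eventually.of_forall fun x => ?_)
        simp only [Pi.add_apply, Complex.real_smul, smul_eq_mul]
        ring
      · exact int (locallyIntegrable_L2 y)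
      · exact (int (continuous_rep w).locallyIntegrable).const_mul _
      · refine (int hVc).congr (Eventually.of_forall fun x => ?_)
        simp only [Complex.real_smul, smul_eq_mul]
        ring
    rw [e1] at h4
    rw [e2]
    simp only [Complex.real_smul] at h4 ⊢
    push_cast at h4
    linear_combination -h4
  obtain ⟨c, hc⟩ := ae_eq_primitive_of_weakDeriv (locallyIntegrable_L2 (grad w)) hpl hweak
  set P : ℝ → ℂ := fun x => c + ∫ t in (0 : ℝ)..x, p t with hP
  have hPac : ACLoc P := by
    have hconst : ACLoc (fun _ : ℝ => c) := fun a b =>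
      (contDiff_const (n := 1)).contDiffOn.absolutelyContinuousOnInterval
    exact hconst.add (acLoc_primitive hpl 0)
  have hrep : rep w = fun x => rep w 0 + ∫ t in (0 : ℝ)..x, P t := by
    rw [rep_eq_primitive]
    funext x
    congr 1
    · simp
    · exact intervalIntegral.integral_congr_ae (by filter_upwards [hc] with t ht _ using ht)
  have hderiv : deriv (rep w) = P := by
    funext x
    rw [hrep]
    exact ((intervalIntegral.integral_hasDerivAt_right (hPac.continuous.intervalIntegrable _ _)
      (hPac.continuous.stronglyMeasurableAtFilter _ _) hPac.continuous.continuousAt).const_add _).deriv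
  refine ⟨rep w, rep_ae w, acLoc_rep w, hderiv ▸ hPac, ?_⟩
  filter_upwards [LocallyIntegrable.ae_hasDerivAt_integral hpl] with x hx
  rw [hderiv, ((hx 0).const_add c).deriv]
  simp only [hp, smul_eq_mul]
  ring

theorem formOp_add_smul (T : H1 →L[ℂ] H1) (κ μ c : ℂ) (w : H1) :
    formOp T κ (μ + c) w = formOp T κ μ w + c • adjoint incl (incl w) := by
  rw [formOp_apply, formOp_apply, add_smul]
  abel

/-- The form operator is contained in the maximal one by `mem_graph_schrodinger_of_form`. Equality
comes from invertibility of the maximal operator at `0`: its inverse is forced to agree with the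
form operator on a dense set, hence everywhere. -/
theorem mem_graph_schrodinger_iff (m : ℝ) (h0 : (0 : ℂ) ∈ resolventSet (schrodinger m V))
    (u y : L2) : (u, y) ∈ (schrodinger m V).graph ↔
      ∃ w : H1, incl w = u ∧ formOp (potentialOp hV hV0) 1 (m ^ 2 : ℝ) w = adjoint incl y := by
  refine ⟨fun huy => ?_, fun ⟨w, hw, h⟩ => hw ▸ mem_graph_schrodinger_of_form hV hV0 m h⟩
  set T := potentialOp hV hV0
  have hT : FormCompact T := formCompact_potentialOp hV hV0
  obtain ⟨L, hL1, hL⟩ := hT.exists_coercive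
  obtain ⟨-, Q, hQ⟩ := hL 1 (m ^ 2 + L) (by norm_num) (by nlinarith)
  set Qi : H1 →L[ℂ] H1 := ↑Q⁻¹ with hQi
  have hQQi : ∀ w, formOp T 1 (m ^ 2 : ℝ) (Qi w) + (L : ℂ) • adjoint incl (incl (Qi w)) = w := by
    intro w
    rw [← formOp_add_smul]
    have := congr($(Q.mul_inv) w)
    rw [hQ] at this
    simpa using this
  have hQiQ : ∀ w, Qi (formOp T 1 (m ^ 2 : ℝ) w + (L : ℂ) • adjoint incl (incl w)) = w := by
    intro w
    rw [← formOp_add_smul]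
    have := congr($(Q.inv_mul) w)
    rw [hQ] at this
    simpa using this
  have hQs : ∀ w w', inner ℂ (Qi w) w' = inner ℂ w (Qi w') := by
    intro w w'
    have hs := formOp_symm hT 1 (m ^ 2 + L) (Qi w) (Qi w')
    push_cast at hs
    rw [formOp_add_smul, formOp_add_smul] at hs
    have h1 := hQQi w
    have h2 := hQQi w'
    push_cast at h1 h2
    rw [h1, h2] at hs
    exact hs.symm
  obtain ⟨R, hR1, hR2⟩ := h0
  have hRg : ∀ {a b : L2}, (a, b) ∈ (schrodinger m V).graph → R b = a := by
    intro a b hab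
    obtain ⟨x, hx1, hx2⟩ := (LinearPMap.mem_graph_iff _).1 hab
    have h1 := hR2 x
    have h2 : shift (schrodinger m V) 0 x = schrodinger m V x := by
      rw [shift, zero_smul, sub_zero]; rfl
    rw [h2] at h1
    simp only at hx1 hx2
    rw [← hx2, h1, hx1]
  set 𝓡 : Submodule ℂ L2 := (LinearMap.range (formOp T 1 (m ^ 2 : ℝ)).toLinearMap).comap
    (adjoint incl).toLinearMap with h𝓡
  have hmem : ∀ y, y ∈ 𝓡 ↔ ∃ w, formOp T 1 (m ^ 2 : ℝ) w = adjoint incl y := fun y => Iff.rfl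
  -- A vector `y` orthogonal to the range of the form operator satisfies `y = L (H + L)⁻¹ y` by
  -- symmetry, with `H` the form operator, so `H y = 0`. As `H` is contained in the maximal
  -- operator, which is injective, `y = 0`.
  have hdense : 𝓡.topologicalClosure = ⊤ := by
    rw [Submodule.topologicalClosure_eq_top_iff, Submodule.eq_bot_iff]
    intro y hy
    have h1 : ∀ x, inner ℂ x (y - (L : ℂ) • incl (Qi (adjoint incl y))) = 0 := by
      intro x
      have hx : x - (L : ℂ) • incl (Qi (adjoint incl x)) ∈ 𝓡 := by
        refine (hmem _).2 ⟨Qi (adjoint incl x), ?_⟩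
        rw [map_sub, map_smul, eq_sub_iff_add_eq]
        exact hQQi _
      have h2 := (Submodule.mem_orthogonal _ _).1 hy _ hx
      rw [inner_sub_left, inner_smul_left, Complex.conj_ofReal, ← adjoint_inner_right, hQs,
        adjoint_inner_left] at h2
      rw [inner_sub_right, inner_smul_right]
      exact h2
    have h2 : y - (L : ℂ) • incl (Qi (adjoint incl y)) = 0 :=
      inner_self_eq_zero.1 (h1 _)
    have h3 : incl ((L : ℂ) • Qi (adjoint incl y)) = y := by
      rw [map_smul]; exact (sub_eq_zero.1 h2).symm
    have h4 : formOp T 1 (m ^ 2 : ℝ) ((L : ℂ) • Qi (adjoint incl y)) = adjoint incl 0 := by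
      have h5 := hQQi (adjoint incl y)
      rw [← map_smul, ← map_smul, h3] at h5
      rw [map_smul, eq_sub_of_add_eq h5, sub_self, smul_zero, map_zero]
    have h5 := hRg (mem_graph_schrodinger_of_form hV hV0 m h4)
    rw [map_zero, h3] at h5
    exact h5.symm
  -- The resolvent identity between `R` and the inverse of the form operator shifted by `L`. Both
  -- sides are continuous, so it extends from the dense set `𝓡` and exhibits every `R y` as an
  -- element of the form domain.
  have hclosed : ∀ y, R y = incl (Qi (adjoint incl (y + (L : ℂ) • R y))) := by
    intro y
    have hy : y ∈ closure (𝓡 : Set L2) := by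
      rw [← Submodule.topologicalClosure_coe, hdense]; trivial
    refine closure_minimal (t := {y | R y = incl (Qi (adjoint incl (y + (L : ℂ) • R y)))}) ?_ ?_ hy
    · intro y hy
      obtain ⟨w, hw⟩ := (hmem y).1 hy
      have h1 := hRg (mem_graph_schrodinger_of_form hV hV0 m hw)
      rw [mem_ofPred_eq, h1, map_add, map_smul, ← hw, hQiQ]
    · exact isClosed_eq R.continuous (by fun_prop)
  have h1 := hclosed y
  have h2 := hRg huy
  rw [h2] at h1
  refine ⟨_, h1.symm, ?_⟩
  have h3 := hQQi (adjoint incl (y + (L : ℂ) • u))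
  rw [← h1, map_add, map_smul] at h3
  rw [map_add, map_smul]
  exact add_right_cancel h3

end Schrodinger

/-! ### The block operator as a relation -/

theorem mem_graph_derivOp_iff (u v : L2) :
    (u, v) ∈ derivOp.graph ↔ ∃ w : H1, incl w = u ∧ grad w = v := by
  rw [mem_graph_derivOp]
  exact ⟨exists_sobolev, fun ⟨w, h1, h2⟩ => h1 ▸ h2 ▸ hasWeakDeriv_incl w⟩

/-- The relation `Y = 𝒜 X` in its weak form: `X = (f, g)` with `f ∈ W^{1,2}(ℝ)`, and the first
component of `𝒜 X` is computed in `W^{-1,2}(ℝ)`. -/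
noncomputable def blockRel (T : H1 →L[ℂ] H1) (m ν : ℝ) :
    Submodule ℂ (WithLp 2 (L2 × L2) × WithLp 2 (L2 × L2)) where
  carrier := {p | ∃ f : H1, incl f = p.1.fst ∧ p.2.snd = (ν : ℂ) • grad f + p.1.snd ∧
    formOp T 1 (m ^ 2 : ℝ) f + (ν : ℂ) • adjoint grad p.1.snd = adjoint incl p.2.fst}
  add_mem' := by
    rintro p q ⟨f, h1, h2, h3⟩ ⟨g, k1, k2, k3⟩
    refine ⟨f + g, ?_, ?_, ?_⟩
    · rw [map_add, h1, k1]; rfl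
    · rw [map_add, Prod.snd_add, WithLp.add_snd, h2, k2, Prod.fst_add, WithLp.add_snd, smul_add]
      abel
    · rw [map_add, Prod.snd_add, Prod.fst_add, WithLp.add_snd, WithLp.add_fst, map_add, map_add,
        ← h3, ← k3, smul_add]
      abel
  zero_mem' := ⟨0, by simp, by simp, by simp⟩
  smul_mem' := by
    rintro c p ⟨f, h1, h2, h3⟩
    refine ⟨c • f, ?_, ?_, ?_⟩
    · rw [map_smul, h1]; rfl
    · rw [map_smul, Prod.smul_snd, WithLp.smul_snd, h2, Prod.smul_fst, WithLp.smul_snd, smul_add,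
        smul_comm]
    · rw [map_smul, Prod.smul_snd, Prod.smul_fst, WithLp.smul_snd, WithLp.smul_fst, map_smul,
        map_smul, ← h3, smul_add, smul_comm (ν : ℂ)]

theorem mem_blockRel {T : H1 →L[ℂ] H1} {m ν : ℝ} {X Y : WithLp 2 (L2 × L2)} :
    (X, Y) ∈ blockRel T m ν ↔ ∃ f : H1, incl f = X.fst ∧ Y.snd = (ν : ℂ) • grad f + X.snd ∧
      formOp T 1 (m ^ 2 : ℝ) f + (ν : ℂ) • adjoint grad X.snd = adjoint incl Y.fst := Iff.rfl

/-- The right-hand side of the Schur complement of the block operator at `z`. -/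
noncomputable def schurMap (ν : ℝ) (z : ℂ) : WithLp 2 (L2 × L2) →L[ℂ] H1 :=
  (adjoint incl).comp (WithLp.fstL 2 ℂ L2 L2) -
    (ν / (1 - z)) • (adjoint grad).comp (WithLp.sndL 2 ℂ L2 L2)

theorem schurMap_apply (ν : ℝ) (z : ℂ) (Z : WithLp 2 (L2 × L2)) :
    schurMap ν z Z = adjoint incl Z.fst - (ν / (1 - z)) • adjoint grad Z.snd := rfl

/-- The Schur complement of the block operator at `z`. -/
noncomputable def schurOp (T : H1 →L[ℂ] H1) (m ν : ℝ) (z : ℂ) : H1 →L[ℂ] H1 :=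
  formOp T (1 - ν ^ 2 / (1 - z)) (m ^ 2 - z)

/-- For `z ≠ 1` the second row gives `g = (1 - z)⁻¹ (Z₂ - ν f')`; inserting it in the first leaves a
scalar equation for `f`. -/
theorem mem_blockRel_shift {T : H1 →L[ℂ] H1} {m ν : ℝ} {z : ℂ} (hz : z ≠ 1)
    {X Z : WithLp 2 (L2 × L2)} :
    (X, Z + z • X) ∈ blockRel T m ν ↔ ∃ f : H1, incl f = X.fst ∧
      X.snd = (1 - z)⁻¹ • (Z.snd - (ν : ℂ) • grad f) ∧ schurOp T m ν z f = schurMap ν z Z := by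
  have hz' : 1 - z ≠ 0 := sub_ne_zero.2 hz.symm
  rw [mem_blockRel]
  refine exists_congr fun f => and_congr_right fun hf => ?_
  have e1 : (Z + z • X).snd = (ν : ℂ) • grad f + X.snd ↔
      X.snd = (1 - z)⁻¹ • (Z.snd - (ν : ℂ) • grad f) := by
    rw [eq_inv_smul_iff₀ hz', WithLp.add_snd, WithLp.smul_snd, sub_smul, one_smul]
    constructor <;> intro h
    · rw [sub_eq_sub_iff_add_eq_add, add_comm X.snd, h]
    · rw [sub_eq_sub_iff_add_eq_add] at h
      rw [← h]; abel
  refine (and_congr_left' e1).trans (and_congr_right fun hg => ?_)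
  rw [WithLp.add_fst, WithLp.smul_fst, ← hf, hg, schurMap_apply, schurOp, formOp_apply,
    formOp_apply]
  simp only [map_add, map_sub, map_smul]
  rw [← sub_eq_zero, ← sub_eq_zero (b := _ - _)]
  refine Eq.congr ?_ rfl
  push_cast
  match_scalars <;> field_simp
  ring

/-- The condition `L ≥ 1` keeps the leading coefficient `1 - ν²/(1 + L)` at least `1/2`. So `-L` is
a reference point where both the Schur complement and the shifted Schrödinger form are invertible.
-/
theorem FormCompact.exists_isUnit_schurOp {T : H1 →L[ℂ] H1} (hT : FormCompact T) (m : ℝ) {ν : ℝ}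
    (hν : ν ^ 2 ≤ 1) : ∃ L : ℝ, 1 ≤ L ∧ IsUnit (schurOp T m ν (-L)) ∧
      IsUnit (formOp T (1 : ℝ) (m ^ 2 + L : ℝ)) := by
  obtain ⟨L, hL1, hL⟩ := hT.exists_coercive
  have h1 : 1 / 2 ≤ 1 - ν ^ 2 / (1 + L) := by
    have : ν ^ 2 / (1 + L) ≤ 1 / 2 := by
      rw [div_le_div_iff₀ (by linarith) two_pos]; linarith
    linarith
  have h2 : L ≤ m ^ 2 + L := by nlinarith [sq_nonneg m]
  refine ⟨L, hL1, ?_, (hL 1 _ (by norm_num) h2).2⟩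
  have e : schurOp T m ν (-L) = formOp T (1 - ν ^ 2 / (1 + L) : ℝ) (m ^ 2 + L : ℝ) := by
    rw [schurOp]; push_cast; simp
  rw [e]
  exact (hL _ _ h1 h2).2

/-- The inverse of `𝒜 - z`, given an inverse of its Schur complement. -/
noncomputable def blockInv (ν : ℝ) (z : ℂ) (Q : H1 →L[ℂ] H1) :
    WithLp 2 (L2 × L2) →L[ℂ] WithLp 2 (L2 × L2) :=
  (WithLp.prodContinuousLinearEquiv 2 ℂ L2 L2).symm.toContinuousLinearMap.comp
    ((incl.comp (Q.comp (schurMap ν z))).prod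
      ((1 - z)⁻¹ • (WithLp.sndL 2 ℂ L2 L2 - (ν : ℂ) • grad.comp (Q.comp (schurMap ν z)))))

theorem blockInv_fst (ν : ℝ) (z : ℂ) (Q : H1 →L[ℂ] H1) (Z : WithLp 2 (L2 × L2)) :
    (blockInv ν z Q Z).fst = incl (Q (schurMap ν z Z)) := rfl

theorem blockInv_snd (ν : ℝ) (z : ℂ) (Q : H1 →L[ℂ] H1) (Z : WithLp 2 (L2 × L2)) :
    (blockInv ν z Q Z).snd = (1 - z)⁻¹ • (Z.snd - (ν : ℂ) • grad (Q (schurMap ν z Z))) := rfl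

/-- Where the Schur complement is invertible, the relation becomes the graph of a bounded resolvent.
This turns later questions about closedness, density and Fredholmness into questions about a bounded
operator. -/
theorem mem_blockRel_iff_eq_blockInv {T : H1 →L[ℂ] H1} {m ν : ℝ} {z : ℂ} (hz : z ≠ 1)
    {Q : (H1 →L[ℂ] H1)ˣ} (hQ : ↑Q = schurOp T m ν z) {X Z : WithLp 2 (L2 × L2)} :
    (X, Z + z • X) ∈ blockRel T m ν ↔ X = blockInv ν z ↑Q⁻¹ Z := by
  rw [mem_blockRel_shift hz, ← hQ]
  constructor
  · rintro ⟨f, h1, h2, h3⟩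
    have h4 : (↑Q⁻¹ : H1 →L[ℂ] H1) (schurMap ν z Z) = f := by
      rw [← h3]
      exact congr($(Q.inv_mul) f)
    refine (WithLp.equiv 2 (L2 × L2)).injective (Prod.ext ?_ ?_)
    · change X.fst = _
      rw [← h1, ← h4]; rfl
    · change X.snd = _
      rw [h2, ← h4]; rfl
  · rintro rfl
    exact ⟨_, (blockInv_fst _ _ _ _).symm, blockInv_snd _ _ _ _, congr($(Q.mul_inv) _)⟩

/-! ### The closure of the block operator -/

section Closure

variable {V : ℝ → ℝ} (hV : LocallyIntegrable V volume)
    (hV0 : Tendsto (fun x : ℝ => ∫ t in x..(x + 1), |V t|) (cocompact ℝ) (𝓝 0))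
    {m : ℝ} (h0 : (0 : ℂ) ∈ resolventSet (schrodinger m V))

include hV hV0 h0 in
theorem domain_schrodinger_le : (schrodinger m V).domain ≤ derivOp.domain := by
  intro u hu
  obtain ⟨w, hw, -⟩ := (mem_graph_schrodinger_iff hV hV0 m h0 u _).1
    ((schrodinger m V).mem_graph ⟨u, hu⟩)
  rw [← hw]
  exact LinearPMap.mem_domain_of_mem_graph ((mem_graph_derivOp_iff _ _).2 ⟨w, rfl, rfl⟩)

include h0 in
theorem mem_graph_preOperator_iff (ν : ℝ) (X Y : WithLp 2 (L2 × L2)) :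
    (X, Y) ∈ (preOperator m ν V).graph ↔ ∃ (f g : H1) (h : L2), incl f = X.fst ∧ incl g = X.snd ∧
      formOp (potentialOp hV hV0) 1 (m ^ 2 : ℝ) f = adjoint incl h ∧
      Y.fst = h - (ν : ℂ) • grad g ∧ Y.snd = (ν : ℂ) • grad f + incl g := by
  have hd : ∀ x : derivOp.domain, ∀ w : H1, incl w = x → derivOp x = grad w := fun x w hw =>
    LinearPMap.mem_graph_snd_inj derivOp (derivOp.mem_graph x)
      ((mem_graph_derivOp_iff _ _).2 ⟨w, hw, rfl⟩) rfl
  constructor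
  · intro h
    obtain ⟨x, hx1, hx2⟩ := (LinearPMap.mem_graph_iff _).1 h
    simp only at hx1 hx2
    obtain ⟨f, hf1, hf2⟩ := (mem_graph_schrodinger_iff hV hV0 m h0 _ _).1
      ((schrodinger m V).mem_graph ⟨x.1.fst, x.2.1.1⟩)
    obtain ⟨g, hg1, hg2⟩ := (mem_graph_derivOp_iff _ _).1 (derivOp.mem_graph ⟨x.1.snd, x.2.2.1⟩)
    refine ⟨f, g, _, hf1.trans (congrArg (fun Z : WithLp 2 (L2 × L2) => Z.fst) hx1),
      hg1.trans (congrArg (fun Z : WithLp 2 (L2 × L2) => Z.snd) hx1), hf2, ?_, ?_⟩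
    · rw [← hx2, hg2, sub_eq_add_neg, ← neg_smul]; rfl
    · have e := hd ⟨x.1.fst, x.2.1.2⟩ f hf1
      rw [← hx2, ← e, hg1]; rfl
  · rintro ⟨f, g, h, hf, hg, hS, h1, h2⟩
    have k1 := (mem_graph_schrodinger_iff hV hV0 m h0 X.fst h).2 ⟨f, hf, hS⟩
    have k2 := (mem_graph_derivOp_iff X.fst (grad f)).2 ⟨f, hf, rfl⟩
    have k3 := (mem_graph_derivOp_iff X.snd (grad g)).2 ⟨g, hg, rfl⟩
    have d1 := LinearPMap.mem_domain_of_mem_graph k1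
    have d2 := LinearPMap.mem_domain_of_mem_graph k2
    have d3 := LinearPMap.mem_domain_of_mem_graph k3
    refine (LinearPMap.mem_graph_iff _).2 ⟨⟨X, ⟨d1, d2⟩, ⟨d3, trivial⟩⟩, rfl, ?_⟩
    refine (WithLp.equiv 2 (L2 × L2)).injective (Prod.ext ?_ ?_)
    · change schrodinger m V ⟨X.fst, d1⟩ + (-ν : ℂ) • derivOp ⟨X.snd, d3⟩ = Y.fst
      rw [h1, hd _ g hg, neg_smul, ← sub_eq_add_neg]
      congr 1
      exact LinearPMap.mem_graph_snd_inj _ ((schrodinger m V).mem_graph ⟨X.fst, d1⟩) k1 rfl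
    · change (ν : ℂ) • derivOp ⟨X.fst, d2⟩ + X.snd = Y.snd
      rw [h2, hd _ f hf, hg]

include h0 in
theorem graph_preOperator_le (ν : ℝ) :
    (preOperator m ν V).graph ≤ blockRel (potentialOp hV hV0) m ν := by
  rintro ⟨X, Y⟩ hXY
  obtain ⟨f, g, h, hf, hg, hS, h1, h2⟩ := (mem_graph_preOperator_iff hV hV0 h0 ν X Y).1 hXY
  refine mem_blockRel.2 ⟨f, hf, by rw [h2, hg], ?_⟩
  rw [hS, ← hg, adjoint_grad_incl, h1, map_sub, map_smul, smul_neg, sub_eq_add_neg]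

include h0 in
-- `blockRel` is closed, being described by the bounded resolvent `R` at `-L`. By continuity of `R`,
-- it is then enough that the original block operator shifted by `L` has dense range.
theorem blockRel_eq_closure {ν : ℝ} (hν : ν ^ 2 ≤ 1) :
    (preOperator m ν V).graph.topologicalClosure = blockRel (potentialOp hV hV0) m ν := by
  set T := potentialOp hV hV0
  have hT : FormCompact T := formCompact_potentialOp hV hV0
  obtain ⟨L, hL1, ⟨Q, hQ⟩, ⟨P, hP⟩⟩ := hT.exists_isUnit_schurOp m hν
  have hL : -(L : ℂ) ≠ 1 := by
    intro h
    have := congrArg Complex.re h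
    simp at this
    linarith
  set R := blockInv ν (-L) ↑Q⁻¹
  have hR : ∀ X Y, (X, Y) ∈ blockRel T m ν ↔ X = R (Y + (L : ℂ) • X) := by
    intro X Y
    rw [← mem_blockRel_iff_eq_blockInv hL hQ]
    simp
  have hG := graph_preOperator_le hV hV0 h0 ν
  refine le_antisymm (Submodule.topologicalClosure_minimal _ hG ?_) ?_
  · have e : (blockRel T m ν : Set (WithLp 2 (L2 × L2) × WithLp 2 (L2 × L2))) =
        {p | p.1 = R (p.2 + (L : ℂ) • p.1)} := by
      ext ⟨X, Y⟩
      exact hR X Y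
    rw [e]
    exact isClosed_eq continuous_fst (by fun_prop)
  · set M : Submodule ℂ (WithLp 2 (L2 × L2)) := (preOperator m ν V).graph.map
      (LinearMap.snd ℂ _ _ + (L : ℂ) • LinearMap.fst ℂ _ _) with hM
    have hMdense : M.topologicalClosure = ⊤ := by
      rw [Submodule.topologicalClosure_eq_top_iff, Submodule.eq_bot_iff]
      intro Z hZ
      have hZ' := (Submodule.mem_orthogonal _ _).1 hZ
      have hL0 : (1 + L : ℂ) ≠ 0 := fun h => hL (by linear_combination -h)
      -- Testing orthogonality with `(0, g)` shows that `ν Z₁` has weak derivative `-(1 + L) Z₂`,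
      -- and so lies in `W^{1,2}`.
      have k1 : ∀ g : H1,
          inner ℂ (grad g) ((ν : ℂ) • Z.fst) + inner ℂ (incl g) (-(1 + L : ℂ) • Z.snd) = 0 := by
        intro g
        have := hZ' _ ⟨(WithLp.toLp 2 (0, incl g), WithLp.toLp 2 (-(ν : ℂ) • grad g, incl g)),
          (mem_graph_preOperator_iff hV hV0 h0 ν _ _).2
            ⟨0, g, 0, by simp, rfl, by simp, by simp, by simp⟩, rfl⟩
        rw [WithLp.prod_inner_apply] at this
        simp only [LinearMap.add_apply, LinearMap.snd_apply, LinearMap.smul_apply,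
          LinearMap.fst_apply, WithLp.ofLp_add, WithLp.ofLp_smul, Prod.fst_add, Prod.snd_add,
          Prod.smul_fst, Prod.smul_snd, smul_zero, add_zero, inner_add_left, inner_smul_left,
          map_neg, Complex.conj_ofReal] at this
        change -(ν : ℂ) * inner ℂ (grad g) Z.fst + (inner ℂ (incl g) Z.snd +
          L * inner ℂ (incl g) Z.snd) = 0 at this
        rw [inner_smul_right, inner_smul_right]
        linear_combination -this
      have hweak : HasWeakDeriv ((ν : ℂ) • Z.fst) (-(1 + L : ℂ) • Z.snd) := by
        refine (hasWeakDeriv_iff_inner _ _).2 fun φ hφ hc => ?_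
        obtain ⟨g, hg1, hg2, -⟩ := exists_smooth (Complex.ofRealCLM.contDiff.comp hφ)
          (hasCompactSupport_ofReal hc)
        have hd : deriv (Complex.ofRealCLM ∘ φ) = fun x => ((deriv φ x : ℝ) : ℂ) := funext fun x =>
          (hφ.differentiable (by simp) x).hasDerivAt.ofReal_comp.deriv
        have := k1 g
        simp only [hg1, hg2, hd] at this
        exact this
      obtain ⟨w, hw1, hw2⟩ := exists_sobolev hweak
      have hPi : ∀ v, P.1 ((↑P⁻¹ : H1 →L[ℂ] H1) v) = v := fun v => congr($(P.mul_inv) v)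
      have hPP : ∀ v, formOp T 1 (m ^ 2 : ℝ) ((↑P⁻¹ : H1 →L[ℂ] H1) v) =
          v - (L : ℂ) • adjoint incl (incl ((↑P⁻¹ : H1 →L[ℂ] H1) v)) := by
        intro v
        have := hPi v
        rw [hP] at this
        push_cast at this
        rw [formOp_add_smul] at this
        push_cast
        exact eq_sub_of_add_eq this
      have hPs : ∀ w w', inner ℂ ((↑P⁻¹ : H1 →L[ℂ] H1) w) w' =
          inner ℂ w ((↑P⁻¹ : H1 →L[ℂ] H1) w') := by
        intro w w'
        have hs := formOp_symm hT 1 (m ^ 2 + L) ((↑P⁻¹ : H1 →L[ℂ] H1) w) ((↑P⁻¹ : H1 →L[ℂ] H1) w')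
        rw [← hP, hPi, hPi] at hs
        exact hs.symm
      -- The second family of tests is `(f, 0)` with `(H_V + L) f = x`, where `x` ranges over all of
      -- `L²`.
      have k2 : ∀ x : L2, inner ℂ x Z.fst +
          ν * inner ℂ (grad ((↑P⁻¹ : H1 →L[ℂ] H1) (adjoint incl x))) Z.snd = 0 := by
        intro x
        set f := (↑P⁻¹ : H1 →L[ℂ] H1) (adjoint incl x) with hf
        have := hZ' _ ⟨(WithLp.toLp 2 (incl f, 0),
            WithLp.toLp 2 (x - (L : ℂ) • incl f, (ν : ℂ) • grad f)),
          (mem_graph_preOperator_iff hV hV0 h0 ν _ _).2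
            ⟨f, 0, x - (L : ℂ) • incl f, rfl, by simp, by
              rw [hPP, map_sub, map_smul], by simp, by simp⟩, rfl⟩
        rw [WithLp.prod_inner_apply] at this
        simp only [LinearMap.add_apply, LinearMap.snd_apply, LinearMap.smul_apply,
          LinearMap.fst_apply, WithLp.ofLp_add, WithLp.ofLp_smul, Prod.fst_add, Prod.snd_add,
          Prod.smul_fst, Prod.smul_snd, smul_zero, add_zero, inner_smul_left,
          Complex.conj_ofReal, sub_add_cancel] at this
        exact this
      -- Combined, the two families say that `w = ν Z₁` solves the homogeneous Schur equation, which
      -- is uniquely solvable. Then `Z₂ = 0` from the derivative, and `Z₁ = 0` from `k2`, also when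
      -- `ν = 0`.
      have k3 : schurOp T m ν (-L) w = 0 := by
        have e : schurOp T m ν (-L) w =
            P.1 w - (ν ^ 2 / (1 + L) : ℂ) • adjoint grad (grad w) := by
          rw [hP, schurOp, formOp_apply, formOp_apply]
          push_cast
          rw [sub_neg_eq_add, sub_neg_eq_add, sub_smul]
          abel
        have h1 : incl ((↑P⁻¹ : H1 →L[ℂ] H1) (schurOp T m ν (-L) w)) = 0 := by
          refine ext_inner_left ℂ fun x => ?_
          rw [inner_zero_right, ← adjoint_inner_left, ← hPs, e, inner_sub_right, hP,
            ← formOp_symm hT, ← hP, inner_smul_right, adjoint_inner_right, hw2, inner_smul_right]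
          rw [hPi, adjoint_inner_left, hw1, inner_smul_right]
          have := k2 x
          field_simp
          linear_combination ν * this
        have h2 := incl_injective (h1.trans (map_zero _).symm)
        rw [← hPi (schurOp T m ν (-L) w), h2, map_zero]
      have k4 : w = 0 := by
        have h3 : (↑Q⁻¹ : H1 →L[ℂ] H1) (Q.1 w) = w := congr($(Q.inv_mul) w)
        rw [← h3, hQ, k3, map_zero]
      have k5 : Z.snd = 0 := by
        rw [k4, map_zero] at hw2
        exact (smul_eq_zero.1 hw2.symm).resolve_left (neg_ne_zero.2 hL0)
      have k6 : Z.fst = 0 := by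
        have := k2 Z.fst
        rw [k5, inner_zero_right, mul_zero, add_zero] at this
        exact inner_self_eq_zero.1 this
      exact (WithLp.equiv 2 (L2 × L2)).injective (Prod.ext k6 k5)
    rintro ⟨X, Y⟩ hXY
    have h1 : Y + (L : ℂ) • X ∈ closure (M : Set _) := by
      rw [← Submodule.topologicalClosure_coe, hMdense]; trivial
    -- `Φ` recovers a point of the relation from its image under `Y + L X`. Being continuous, it
    -- carries the closure of the dense range `M` into the closure of the graph.
    set Φ : WithLp 2 (L2 × L2) → WithLp 2 (L2 × L2) × WithLp 2 (L2 × L2) :=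
      fun Z => (R Z, Z - (L : ℂ) • R Z) with hΦ
    have hΦc : Continuous Φ := by fun_prop
    have h2 : MapsTo Φ M (preOperator m ν V).graph := by
      rintro _ ⟨⟨X', Y'⟩, hg, rfl⟩
      have := (hR X' Y').1 (hG hg)
      have e : Φ (Y' + (L : ℂ) • X') = (X', Y') := by
        simp only [hΦ]
        rw [← this, add_sub_cancel_right]
      exact e.symm ▸ hg
    have h3 := h2.closure hΦc h1
    have e : Φ (Y + (L : ℂ) • X) = (X, Y) := by
      simp only [hΦ]
      rw [← (hR X Y).1 hXY, add_sub_cancel_right]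
    rwa [e] at h3

theorem eq_zero_of_mem_blockRel {T : H1 →L[ℂ] H1} {m ν : ℝ} {Y : WithLp 2 (L2 × L2)}
    (h : (0, Y) ∈ blockRel T m ν) : Y = 0 := by
  obtain ⟨f, h1, h2, h3⟩ := mem_blockRel.1 h
  have hf : f = 0 := incl_injective (h1.trans (map_zero _).symm)
  rw [hf, map_zero, smul_zero, zero_add] at h2
  rw [hf, map_zero, zero_add, WithLp.zero_snd, map_zero, smul_zero] at h3
  exact (WithLp.equiv 2 (L2 × L2)).injective
    (Prod.ext (eq_zero_of_adjoint_incl_eq_zero h3.symm) h2)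

include hV hV0 h0 in
theorem isClosable_preOperator {ν : ℝ} (hν : ν ^ 2 ≤ 1) : (preOperator m ν V).IsClosable := by
  refine ⟨(blockRel (potentialOp hV hV0) m ν).toLinearPMap, ?_⟩
  rw [blockRel_eq_closure hV hV0 h0 hν, Submodule.toLinearPMap_graph_eq]
  rintro ⟨X, Y⟩ hXY (rfl : X = 0)
  exact eq_zero_of_mem_blockRel hXY

include h0 in
theorem graph_blockOperator {ν : ℝ} (hν : ν ^ 2 ≤ 1) :
    (blockOperator m ν V).graph = blockRel (potentialOp hV hV0) m ν := by
  rw [blockOperator, ← (isClosable_preOperator hV hV0 h0 hν).graph_closure_eq_closure_graph,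
    blockRel_eq_closure hV hV0 h0 hν]

end Closure

/-! ### Fredholm points -/

section Shift

variable {H : Type*} [NormedAddCommGroup H] [NormedSpace ℂ H]

theorem shift_eq_iff_mem_graph {A : H →ₗ.[ℂ] H} {z : ℂ} {X Z : H} :
    (∃ x : A.domain, (x : H) = X ∧ shift A z x = Z) ↔ (X, Z + z • X) ∈ A.graph := by
  rw [LinearPMap.mem_graph_iff]
  refine exists_congr fun x => and_congr_right fun hx => ?_
  rw [← hx, ← sub_eq_iff_eq_add]
  rfl

theorem mem_range_shift_iff {A : H →ₗ.[ℂ] H} {z : ℂ} {Z : H} :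
    Z ∈ LinearMap.range (shift A z) ↔ ∃ X, (X, Z + z • X) ∈ A.graph := by
  simp_rw [← shift_eq_iff_mem_graph, LinearMap.mem_range]
  exact ⟨fun ⟨x, hx⟩ => ⟨x, x, rfl, hx⟩, fun ⟨_, x, _, hx⟩ => ⟨x, hx⟩⟩

/-- This form of the kernel condition mentions only the graph, which is the known description of the
closure. -/
theorem finiteDimensional_ker_shift_iff {A : H →ₗ.[ℂ] H} {z : ℂ} :
    FiniteDimensional ℂ (LinearMap.ker (shift A z)) ↔
      ∃ K : Submodule ℂ H, FiniteDimensional ℂ K ∧ ∀ X, (X, z • X) ∈ A.graph → X ∈ K := by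
  have key : ∀ X, X ∈ (LinearMap.ker (shift A z)).map A.domain.subtype ↔
      (X, z • X) ∈ A.graph := by
    intro X
    rw [← zero_add (z • X), ← shift_eq_iff_mem_graph, Submodule.mem_map]
    exact exists_congr fun x => and_comm
  constructor
  · intro h
    exact ⟨_, inferInstance, fun X hX => (key X).2 hX⟩
  · rintro ⟨K, hK, h⟩
    have hinj : Function.Injective (A.domain.subtype ∘ₗ (LinearMap.ker (shift A z)).subtype) :=
      Subtype.val_injective.comp Subtype.val_injective
    let g : LinearMap.ker (shift A z) →ₗ[ℂ] K :=
      (A.domain.subtype ∘ₗ (LinearMap.ker (shift A z)).subtype).codRestrict K fun x =>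
        h _ ((key _).1 ⟨x, x.2, rfl⟩)
    refine FiniteDimensional.of_injective g fun a b hab => hinj ?_
    exact congrArg (Subtype.val : K → H) hab

end Shift

/-- The range of the shifted operator is the preimage of the range of the Schur complement under the
bounded map `schurMap`, so closedness and finite codimension pull back. The kernel is contained in a
linear image of the Schur kernel. -/
theorem isFredholmAt_of_isFredholm_schurOp {A : WithLp 2 (L2 × L2) →ₗ.[ℂ] WithLp 2 (L2 × L2)}
    {T : H1 →L[ℂ] H1} {m ν : ℝ} (hA : A.graph = blockRel T m ν) {z : ℂ} (hz : z ≠ 1)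
    (hS : (schurOp T m ν z).IsFredholm) : IsFredholmAt A z := by
  have hr : LinearMap.range (shift A z) =
      (LinearMap.range (schurOp T m ν z).toLinearMap).comap (schurMap ν z).toLinearMap := by
    ext Z
    rw [mem_range_shift_iff, hA]
    simp_rw [mem_blockRel_shift hz]
    constructor
    · rintro ⟨X, f, -, -, h⟩
      exact ⟨f, h⟩
    · rintro ⟨f, h⟩
      exact ⟨WithLp.toLp 2 (incl f, (1 - z)⁻¹ • (Z.snd - (ν : ℂ) • grad f)), f, rfl, rfl, h⟩
  refine ⟨finiteDimensional_ker_shift_iff.2 ?_, ?_, ?_⟩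
  · have := hS.finite_ker
    refine ⟨(LinearMap.ker (schurOp T m ν z).toLinearMap).map
      ((WithLp.prodContinuousLinearEquiv 2 ℂ L2 L2).symm.toLinearMap ∘ₗ
        (incl.toLinearMap.prod ((1 - z)⁻¹ • (-(ν : ℂ) • grad.toLinearMap)))), inferInstance, ?_⟩
    intro X hX
    rw [hA, ← zero_add (z • X), mem_blockRel_shift hz] at hX
    obtain ⟨f, h1, h2, h3⟩ := hX
    rw [map_zero] at h3
    refine ⟨f, h3, (WithLp.equiv 2 (L2 × L2)).injective (Prod.ext h1 ?_)⟩
    change _ = X.snd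
    rw [h2, WithLp.zero_snd, zero_sub, ← neg_smul]
    rfl
  · rw [hr]
    exact hS.isClosed_range.preimage (schurMap ν z).continuous
  · rw [hr]
    have := hS.finite_coker
    have h2 : FiniteDimensional ℂ (H1 ⧸ LinearMap.range (schurOp T m ν z).toLinearMap) := this
    have h3 := Submodule.CoFG.ker ((LinearMap.range (schurOp T m ν z).toLinearMap).mkQ ∘ₗ
      (schurMap ν z).toLinearMap)
    rwa [LinearMap.ker_comp, Submodule.ker_mkQ] at h3

/-! ### Singular sequences -/

section Singular

variable {E : Type*} [NormedAddCommGroup E] [InnerProductSpace ℂ E]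

theorem tendsto_inner_orthonormal {v : ℕ → E} (hv : Orthonormal ℂ v) (x : E) :
    Tendsto (fun n => inner ℂ x (v n)) atTop (𝓝 0) := by
  have h1 := (hv.inner_products_summable x).tendsto_atTop_zero
  have h2 := (Real.continuous_sqrt.tendsto 0).comp h1
  rw [Real.sqrt_zero] at h2
  refine tendsto_zero_iff_norm_tendsto_zero.2 (h2.congr fun n => ?_)
  simp [Real.sqrt_sq, norm_inner_symm]

theorem tendsto_starProjection_orthonormal {v : ℕ → E} (hv : Orthonormal ℂ v) (K : Submodule ℂ E)
    [FiniteDimensional ℂ K] : Tendsto (fun n => K.starProjection (v n)) atTop (𝓝 0) := by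
  have h1 : ∀ n, K.starProjection (v n) =
      ∑ i, inner ℂ (stdOrthonormalBasis ℂ K i : E) (v n) • (stdOrthonormalBasis ℂ K i : E) := by
    intro n
    rw [Submodule.starProjection_apply, (stdOrthonormalBasis ℂ K).orthogonalProjectionOnto_apply_eq_sum]
    simp
  simp_rw [h1]
  rw [← Finset.sum_const_zero (s := Finset.univ)
    (ι := Fin (Module.finrank ℂ K)) (M := E)]
  refine tendsto_finsetSum _ fun i _ => ?_
  rw [← zero_smul ℂ (stdOrthonormalBasis ℂ K i : E)]
  exact (tendsto_inner_orthonormal hv _).smul_const _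

/-- An operator with closed range and kernel of finite dimension does not annihilate an orthonormal
sequence asymptotically. -/
theorem not_tendsto_map_orthonormal [CompleteSpace E] {B : E →L[ℂ] E}
    (hB : IsClosed (LinearMap.range B.toLinearMap : Set E)) {K : Submodule ℂ E}
    [FiniteDimensional ℂ K] (hK : ∀ x, B x = 0 → x ∈ K) {v : ℕ → E} (hv : Orthonormal ℂ v) :
    ¬ Tendsto (fun n => B (v n)) atTop (𝓝 0) := by
  intro h
  have : CompleteSpace (LinearMap.range B.toLinearMap) := hB.completeSpace_coe
  obtain ⟨C, hC, hCb⟩ := ContinuousLinearMap.exists_preimage_norm_le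
    (B.codRestrict (LinearMap.range B.toLinearMap) fun x => ⟨x, rfl⟩)
    (by rintro ⟨_, x, rfl⟩; exact ⟨x, rfl⟩)
  -- The open mapping theorem onto the closed range gives a preimage of `B (v n)` of controlled
  -- norm. It differs from `v n` by an element of `K`, so the distance to `K` is controlled, while
  -- the projections onto `K` vanish by Bessel.
  have h1 : ∀ n, ‖v n - K.starProjection (v n)‖ ≤ C * ‖B (v n)‖ := by
    intro n
    obtain ⟨x, hx1, hx2⟩ := hCb ⟨B (v n), v n, rfl⟩
    have hx3 : B x = B (v n) := congrArg Subtype.val hx1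
    have hk : v n - x ∈ K := hK _ (by rw [map_sub, hx3, sub_self])
    have h2 : v n - K.starProjection (v n) = x - K.starProjection x := by
      have h3 := Submodule.starProjection_eq_self_iff.2 hk
      rw [map_sub] at h3
      rw [sub_eq_sub_iff_sub_eq_sub, h3]
    rw [h2]
    refine le_trans ?_ hx2
    rw [Submodule.starProjection_minimal]
    refine (ciInf_le ⟨0, ?_⟩ (0 : K)).trans (by simp)
    rintro _ ⟨k, rfl⟩
    exact norm_nonneg _
  have h2 : Tendsto (fun n => v n - K.starProjection (v n)) atTop (𝓝 0) := by
    refine squeeze_zero_norm h1 ?_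
    simpa using (h.norm.const_mul C)
  have h3 := h2.add (tendsto_starProjection_orthonormal hv K)
  simp only [sub_add_cancel, add_zero] at h3
  have h4 := h3.norm
  simp only [hv.1, norm_zero] at h4
  exact one_ne_zero (tendsto_nhds_unique tendsto_const_nhds h4)

theorem not_tendsto_map_orthogonal [CompleteSpace E] {B : E →L[ℂ] E}
    (hB : IsClosed (LinearMap.range B.toLinearMap : Set E)) {K : Submodule ℂ E}
    [FiniteDimensional ℂ K] (hK : ∀ x, B x = 0 → x ∈ K) {v : ℕ → E}
    (hv : Pairwise fun i j => inner ℂ (v i) (v j) = 0) {c : ℝ} (hc : 0 < c)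
    (hvc : ∀ n, ‖v n‖ = c) :
    ¬ Tendsto (fun n => B (v n)) atTop (𝓝 0) := by
  intro h
  refine not_tendsto_map_orthonormal hB hK (v := fun n => (c⁻¹ : ℂ) • v n) ⟨fun n => ?_, ?_⟩ ?_
  · rw [norm_smul, hvc, norm_inv, Complex.norm_real, Real.norm_of_nonneg hc.le,
      inv_mul_cancel₀ hc.ne']
  · intro i j hij
    change inner ℂ ((c⁻¹ : ℂ) • v i) ((c⁻¹ : ℂ) • v j) = 0
    rw [inner_smul_left, inner_smul_right, hv hij, mul_zero, mul_zero]
  · simpa only [map_smul, smul_zero] using h.const_smul (c⁻¹ : ℂ)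

end Singular

/-- The finite rank approximation sees only finitely many nodes, where the sequence is eventually
zero; what remains is small in operator norm. -/
theorem FormCompact.tendsto_zero {T : H1 →L[ℂ] H1} (hT : FormCompact T) {p : ℕ → H1} {C : ℝ}
    (hC : ∀ n, ‖p n‖ ≤ C) (hp : ∀ x, ∀ᶠ n in atTop, rep (p n) x = 0) :
    Tendsto (fun n => T (p n)) atTop (𝓝 0) := by
  have hC0 : 0 ≤ C := (norm_nonneg _).trans (hC 0)
  rw [Metric.tendsto_atTop']
  intro ε hε
  obtain ⟨t, x, b, hb⟩ := hT.approx (ε / (2 * (C + 1))) (by positivity)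
  have h1 : ∀ᶠ n in atTop, ∀ k ∈ t, rep (p n) (x k) = 0 :=
    (eventually_all_finset t).2 fun k _ => hp (x k)
  obtain ⟨N, hN⟩ := eventually_atTop.1 h1
  refine ⟨N, fun n hn => ?_⟩
  have h2 : interpolation t x b (p n) = 0 := by
    rw [interpolation_apply]
    exact Finset.sum_eq_zero fun k hk => by rw [hN n hn.le k hk, zero_smul]
  have h3 := (T - interpolation t x b).le_of_opNorm_le hb (p n)
  rw [_root_.sub_apply, h2, sub_zero] at h3
  rw [dist_zero_right]
  refine h3.trans_lt ?_
  have h4 : ε / (2 * (C + 1)) * ‖p n‖ ≤ ε / (2 * (C + 1)) * (C + 1) := by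
    gcongr
    linarith [hC n]
  refine h4.trans_lt ?_
  rw [div_mul_eq_mul_div, div_lt_iff₀ (by positivity)]
  nlinarith

/-- A singular sequence for the block operator at `z`, built from elements of the form domain,
shows that `z` lies in the essential spectrum. -/
theorem not_isFredholmAt_of_singular {A : WithLp 2 (L2 × L2) →ₗ.[ℂ] WithLp 2 (L2 × L2)}
    {T : H1 →L[ℂ] H1} (hT : FormCompact T) {m ν : ℝ} (hν : ν ^ 2 ≤ 1)
    (hA : A.graph = blockRel T m ν) {z : ℂ} {w : ℕ → H1} {g : ℕ → L2}
    (h1 : Tendsto (fun n => adjoint grad (grad (w n) + (ν : ℂ) • g n) +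
      (m ^ 2 - z) • adjoint incl (incl (w n)) + T (w n)) atTop (𝓝 0))
    (h2 : Tendsto (fun n => (ν : ℂ) • grad (w n) + (1 - z) • g n) atTop (𝓝 0))
    {q : ℕ → L2} (hq : Orthonormal ℂ q) {a b : ℂ} (hab : ¬ (a = 0 ∧ b = 0))
    (h3 : Tendsto (fun n => incl (w n) - a • q n) atTop (𝓝 0))
    (h4 : Tendsto (fun n => g n - b • q n) atTop (𝓝 0)) : ¬ IsFredholmAt A z := by
  rintro ⟨hk, hr, -⟩
  obtain ⟨K, hKf, hK⟩ := finiteDimensional_ker_shift_iff.1 hk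
  obtain ⟨L, hL1, ⟨Q, hQ⟩, -⟩ := hT.exists_isUnit_schurOp m hν
  have hL : -(L : ℂ) ≠ 1 := by
    intro h
    have := congrArg Complex.re h
    simp at this
    linarith
  have hL0 : (1 + L : ℂ) ≠ 0 := fun h => hL (by linear_combination -h)
  set R := blockInv ν (-L) ↑Q⁻¹ with hRdef
  have hR : ∀ X Y, (X, Y) ∈ A.graph ↔ X = R (Y + (L : ℂ) • X) := by
    intro X Y
    rw [hA, ← mem_blockRel_iff_eq_blockInv hL hQ]
    simp
  -- Since `R = (A + L)⁻¹`, this is `(A - z) R`: a bounded operator with the range of `A - z`, whose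
  -- kernel lies in `K`.
  set B : WithLp 2 (L2 × L2) →L[ℂ] WithLp 2 (L2 × L2) :=
    ContinuousLinearMap.id ℂ _ - (L + z) • R with hB
  have hBapp : ∀ x, B x = x - (L + z) • R x := fun _ => rfl
  have hBr : LinearMap.range B.toLinearMap = LinearMap.range (shift A z) := by
    ext Z
    rw [mem_range_shift_iff]
    constructor
    · rintro ⟨x, rfl⟩
      refine ⟨R x, (hR _ _).2 ?_⟩
      congr 1
      change x = B x + z • R x + (L : ℂ) • R x
      rw [hBapp, add_smul]
      abel
    · rintro ⟨X, hX⟩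
      refine ⟨Z + z • X + (L : ℂ) • X, ?_⟩
      change B _ = Z
      rw [hBapp, ← (hR _ _).1 hX, add_smul]
      abel
  have hBK : ∀ x, B x = 0 → x ∈ K := by
    intro x hx
    rw [hBapp, sub_eq_zero] at hx
    rw [hx]
    refine K.smul_mem _ (hK _ ((hR _ _).2 ?_))
    congr 1
    rw [← add_smul, add_comm z, ← hx]
  -- The residual is small only in `W^{-1,2}`, and `(w n, g n)` need not lie in the domain of `A`.
  -- Eliminating the second row and applying the inverse Schur complement at `-L` turns the residual
  -- into a correction `d n` that is small in `W^{1,2}`.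
  set d : ℕ → H1 := fun n => (↑Q⁻¹ : H1 →L[ℂ] H1) (adjoint grad (grad (w n) + (ν : ℂ) • g n) +
      (m ^ 2 - z) • adjoint incl (incl (w n)) + T (w n) -
      (ν / (1 + L) : ℂ) • adjoint grad ((ν : ℂ) • grad (w n) + (1 - z) • g n)) with hd
  have hd0 : Tendsto d atTop (𝓝 0) := by
    have h5 := h1.sub ((((adjoint grad).continuous.tendsto _).comp h2).const_smul
      (ν / (1 + L) : ℂ))
    have h6 := ((↑Q⁻¹ : H1 →L[ℂ] H1).continuous.tendsto _).comp h5
    simp only [map_zero, smul_zero, sub_zero] at h6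
    exact h6
  set y : ℕ → WithLp 2 (L2 × L2) := fun n => WithLp.toLp 2 (incl (w n), g n) with hy
  have hwd : ∀ n, w n = d n + (L + z) • (↑Q⁻¹ : H1 →L[ℂ] H1) (schurMap ν (-L) (y n)) := by
    intro n
    have h5 : (↑Q⁻¹ : H1 →L[ℂ] H1) (schurOp T m ν (-L) (w n)) = w n := by
      rw [← hQ]
      exact congr($(Q.inv_mul) (w n))
    have h6 : schurMap ν (-L) (y n) =
        adjoint incl (incl (w n)) - (ν / (1 - -L) : ℂ) • adjoint grad (g n) := rfl
    rw [← map_smul, hd, ← map_add]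
    refine h5.symm.trans (congrArg _ ?_)
    rw [h6, schurOp, formOp_apply]
    simp only [map_add, map_smul]
    rw [sub_neg_eq_add, sub_neg_eq_add]
    match_scalars <;> field_simp <;> ring
  have hByd : ∀ n, B (y n) = WithLp.toLp 2 (incl (d n),
      (1 + L : ℂ)⁻¹ • ((ν : ℂ) • grad (w n) + (1 - z) • g n - (ν : ℂ) • grad (d n))) := by
    intro n
    refine (WithLp.equiv 2 (L2 × L2)).injective (Prod.ext ?_ ?_)
    · change incl (w n) - (L + z) • (R (y n)).fst = incl (d n)
      rw [hRdef, blockInv_fst]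
      conv_lhs => rw [hwd n]
      rw [map_add, map_smul, add_sub_cancel_right]
    · change g n - (L + z) • (R (y n)).snd = (1 + L : ℂ)⁻¹ • _
      rw [hRdef, blockInv_snd]
      conv_rhs => rw [hwd n]
      rw [map_add, map_smul, sub_neg_eq_add]
      change g n - (L + z) • (1 + L : ℂ)⁻¹ • (g n - _) = _
      match_scalars <;> field_simp <;> ring
  have hBy : Tendsto (fun n => B (y n)) atTop (𝓝 0) := by
    simp_rw [hByd]
    have h5 := ((incl.continuous.tendsto _).comp hd0).prodMk_nhds
      ((h2.sub (((grad.continuous.tendsto _).comp hd0).const_smul (ν : ℂ))).const_smul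
        (1 + L : ℂ)⁻¹)
    have h6 := ((WithLp.prodContinuousLinearEquiv 2 ℂ L2 L2).symm.continuous.tendsto _).comp h5
    simp only [map_zero, smul_zero, sub_zero] at h6
    exact h6
  set v : ℕ → WithLp 2 (L2 × L2) := fun n => WithLp.toLp 2 (a • q n, b • q n) with hv
  have hyv : Tendsto (fun n => y n - v n) atTop (𝓝 0) := by
    have h6 := ((WithLp.prodContinuousLinearEquiv 2 ℂ L2 L2).symm.continuous.tendsto _).comp
      (h3.prodMk_nhds h4)
    exact h6
  have hBv : Tendsto (fun n => B (v n)) atTop (𝓝 0) := by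
    have h5 := hBy.sub ((B.continuous.tendsto _).comp hyv)
    simpa only [Function.comp_def, map_sub, sub_sub_cancel, map_zero, sub_zero] using h5
  have hvin : ∀ i j, inner ℂ (v i) (v j) =
      ((‖a‖ ^ 2 + ‖b‖ ^ 2 : ℝ) : ℂ) * inner ℂ (q i) (q j) := by
    intro i j
    rw [WithLp.prod_inner_apply]
    simp only [hv, inner_smul_left, inner_smul_right]
    rw [← mul_assoc, ← mul_assoc, Complex.mul_conj', Complex.mul_conj']
    push_cast
    ring
  have hc : 0 < ‖a‖ ^ 2 + ‖b‖ ^ 2 := by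
    by_cases ha : a = 0
    · have : 0 < ‖b‖ := norm_pos_iff.2 fun hb => hab ⟨ha, hb⟩
      positivity
    · have : 0 < ‖a‖ := norm_pos_iff.2 ha
      positivity
  refine not_tendsto_map_orthogonal (hBr ▸ hr) hBK (v := v) (fun i j hij => ?_)
    (Real.sqrt_pos.2 hc) (fun n => ?_) hBv
  · change inner ℂ (v i) (v j) = 0
    rw [hvin, hq.2 hij, mul_zero]
  · have h5 := hvin n n
    have h6 : inner ℂ (v n) (v n) = (‖v n‖ : ℂ) ^ 2 := inner_self_eq_norm_sq_to_K _
    have h7 : inner ℂ (q n) (q n) = (‖q n‖ : ℂ) ^ 2 := inner_self_eq_norm_sq_to_K _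
    rw [h6, h7, hq.1, Complex.ofReal_one, one_pow, mul_one] at h5
    rw [← Real.sqrt_sq (norm_nonneg (v n))]
    congr 1
    exact_mod_cast h5

/-! ### Wave packets -/

/-- The wave packet of profile `χ`, amplitude `s`, centre `c`, width `h` and frequency `ξ`. -/
noncomputable def wavePacket (χ : ℝ → ℝ) (s c h ξ : ℝ) (x : ℝ) : ℂ :=
  ((s * χ ((x - c) / h) : ℝ) : ℂ) * Complex.exp ((ξ * x : ℝ) * Complex.I)

theorem norm_wavePacket (χ : ℝ → ℝ) (s c h ξ x : ℝ) :
    ‖wavePacket χ s c h ξ x‖ = |s * χ ((x - c) / h)| := by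
  rw [wavePacket, norm_mul, Complex.norm_exp_ofReal_mul_I, mul_one, Complex.norm_real,
    Real.norm_eq_abs]

theorem contDiff_wavePacket {χ : ℝ → ℝ} (hχ : ContDiff ℝ ∞ χ) (s c h ξ : ℝ) :
    ContDiff ℝ ∞ (wavePacket χ s c h ξ) := by
  have h1 : ContDiff ℝ ∞ fun x : ℝ => s * χ ((x - c) / h) :=
    contDiff_const.mul (hχ.comp ((contDiff_id.sub contDiff_const).div_const h))
  have h2 : ContDiff ℝ ∞ fun x : ℝ => ξ * x := contDiff_const.mul contDiff_id
  exact (Complex.ofRealCLM.contDiff.comp h1).mul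
    (((Complex.ofRealCLM.contDiff.comp h2).mul contDiff_const).cexp)

theorem hasCompactSupport_wavePacket {χ : ℝ → ℝ} (hc : HasCompactSupport χ) (s c ξ : ℝ) {h : ℝ}
    (hh : 0 < h) : HasCompactSupport (wavePacket χ s c h ξ) := by
  have h1 : HasCompactSupport fun x : ℝ => χ ((x - c) / h) := by
    simp_rw [div_eq_mul_inv]
    exact hc.comp_homeomorph
      ((Homeomorph.subRight c).trans (Homeomorph.mulRight₀ h⁻¹ (inv_ne_zero hh.ne')))
  have h2 : HasCompactSupport fun x : ℝ => ((s * χ ((x - c) / h) : ℝ) : ℂ) :=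
    hasCompactSupport_ofReal h1.mul_left
  exact h2.mul_right

theorem deriv_wavePacket {χ : ℝ → ℝ} (hχ : ContDiff ℝ ∞ χ) (s c h ξ : ℝ) :
    deriv (wavePacket χ s c h ξ) = fun x => wavePacket (deriv χ) (s / h) c h ξ x +
      (Complex.I * ξ) * wavePacket χ s c h ξ x := by
  funext x
  have h1 : HasDerivAt (fun x : ℝ => s * χ ((x - c) / h)) (s * (deriv χ ((x - c) / h) * (1 / h))) x :=
    ((hχ.differentiable (by simp) _).hasDerivAt.comp x
      (((hasDerivAt_id x).sub_const c).div_const h)).const_mul s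
  have h2 : HasDerivAt (fun x : ℝ => ξ * x) (ξ * 1) x := (hasDerivAt_id x).const_mul ξ
  have h3 := h1.ofReal_comp.mul (h2.ofReal_comp.mul_const Complex.I).cexp
  refine h3.deriv.trans ?_
  simp only [wavePacket]
  push_cast
  ring

theorem integral_sq_norm_wavePacket (χ : ℝ → ℝ) (s c ξ : ℝ) {h : ℝ} (hh : 0 < h) :
    ∫ x, ‖wavePacket χ s c h ξ x‖ ^ 2 = s ^ 2 * h * ∫ x, χ x ^ 2 := by
  simp_rw [norm_wavePacket, sq_abs, mul_pow]
  rw [integral_const_mul, integral_sub_right_eq_self (fun x => χ (x / h) ^ 2) c,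
    Measure.integral_comp_div (fun x => χ x ^ 2) h, abs_of_pos hh, smul_eq_mul, mul_assoc]

theorem exists_profile : ∃ χ : ℝ → ℝ, ContDiff ℝ ∞ χ ∧ HasCompactSupport χ ∧
    (∀ x, χ x ≠ 0 → |x| < 1) ∧ 0 < ∫ x, χ x ^ 2 := by
  let f : ContDiffBump (0 : ℝ) := ⟨1 / 2, 1, by norm_num, by norm_num⟩
  refine ⟨f, f.contDiff, f.hasCompactSupport, fun x hx => ?_, ?_⟩
  · have : x ∈ Function.support f := hx
    rw [f.support_eq] at this
    simpa using this
  · refine Continuous.integral_pos_of_hasCompactSupport_nonneg_nonzero (x := 0)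
      (f.continuous.pow 2) ?_ (fun x => sq_nonneg _) ?_
    · exact f.hasCompactSupport.comp_left (g := fun y : ℝ => y ^ 2) (by simp)
    · have : f 0 = 1 := f.one_of_mem_closedBall (by simpa using f.rIn_pos.le)
      simp [this]

/-- Orthonormal quasi-modes of the derivative with prescribed frequencies, escaping to infinity. -/
theorem exists_quasiModes (ξ : ℕ → ℝ) : ∃ q : ℕ → H1, Orthonormal ℂ (fun n => incl (q n)) ∧
    Tendsto (fun n => grad (q n) - (Complex.I * ξ n) • incl (q n)) atTop (𝓝 0) ∧
    ∀ x, ∀ᶠ n in atTop, rep (q n) x = 0 := by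
  obtain ⟨χ, hχ, hc, hsupp, hpos⟩ := exists_profile
  set J := ∫ x, χ x ^ 2 with hJ
  -- The widths grow, so the derivative of the envelope has `L²` norm of order `1 / h`. The centres
  -- `2 (n + 1)²` are spaced more than the sum of neighbouring widths, which makes the supports
  -- disjoint and lets them leave every point.
  set h : ℕ → ℝ := fun n => n + 1 with hh
  have hh0 : ∀ n, 0 < h n := fun n => by positivity
  set s : ℕ → ℝ := fun n => 1 / √(h n * J) with hs
  set c : ℕ → ℝ := fun n => 2 * (n + 1) ^ 2 with hcdef
  set f : ℕ → ℝ → ℂ := fun n => wavePacket χ (s n) (c n) (h n) (ξ n) with hf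
  have hs2 : ∀ n, s n ^ 2 = 1 / (h n * J) := by
    intro n
    rw [hs, div_pow, one_pow, Real.sq_sqrt (mul_pos (hh0 n) hpos).le]
  choose q hq1 hq2 hq3 using fun n => exists_smooth
    (contDiff_wavePacket hχ (s n) (c n) (h n) (ξ n))
    (hasCompactSupport_wavePacket hc (s n) (c n) (ξ n) (hh0 n))
  have hsup : ∀ n x, f n x ≠ 0 → |x - c n| < h n := by
    intro n x hx
    have h1 : χ ((x - c n) / h n) ≠ 0 := by
      intro h0
      apply hx
      simp [hf, wavePacket, h0]
    have h2 := hsupp _ h1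
    rwa [abs_div, abs_of_pos (hh0 n), div_lt_one (hh0 n)] at h2
  have hdisj : ∀ i j : ℕ, i < j → ∀ x, f i x = 0 ∨ f j x = 0 := by
    intro i j hij x
    by_contra! hne
    have h1 := (abs_lt.1 (hsup i x hne.1)).2
    have h2 := (abs_lt.1 (hsup j x hne.2)).1
    have h3 : (i : ℝ) + 1 ≤ j := by exact_mod_cast hij
    have h4 : (0 : ℝ) ≤ i := i.cast_nonneg
    simp only [hcdef, hh] at h1 h2
    nlinarith
  refine ⟨q, ⟨fun n => ?_, ?_⟩, ?_, fun x => ?_⟩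
  · have h1 : ‖incl (q n)‖ ^ 2 = 1 := by
      rw [norm_sq_L2, hq1]
      have h2 : ∫ x, ‖toL2 _ _ _ x‖ ^ 2 = ∫ x, ‖f n x‖ ^ 2 := integral_congr_ae (by
        filter_upwards [coeFn_toL2 (contDiff_wavePacket hχ (s n) (c n) (h n) (ξ n)).continuous
          (hasCompactSupport_wavePacket hc (s n) (c n) (ξ n) (hh0 n))] with x hx
        rw [hx])
      rw [h2, hf, integral_sq_norm_wavePacket _ _ _ _ (hh0 n), hs2, ← hJ, mul_assoc]
      exact one_div_mul_cancel (mul_pos (hh0 n) hpos).ne'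
    exact (pow_eq_one_iff_of_nonneg (norm_nonneg _) two_ne_zero).1 h1
  · have key : ∀ i j : ℕ, i < j → inner ℂ (incl (q i)) (incl (q j)) = 0 := by
      intro i j hij
      rw [hq1 i, inner_toL2]
      refine integral_eq_zero_of_ae ?_
      filter_upwards [rep_ae (q j)] with x hx
      rw [hx, hq3]
      rcases hdisj i j hij x with h0 | h0
      · simp only [hf] at h0
        simp [h0]
      · simp only [hf] at h0
        simp [h0]
    intro i j hij
    change inner ℂ (incl (q i)) (incl (q j)) = 0
    rcases lt_or_gt_of_ne hij with h1 | h1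
    · exact key i j h1
    · rw [← inner_conj_symm, key j i h1, map_zero]
  · have h1 : ∀ n, ‖grad (q n) - (Complex.I * ξ n) • incl (q n)‖ ^ 2 =
        ((∫ x, deriv χ x ^ 2) / J) * (1 / (n + 1 : ℝ)) ^ 2 := by
      intro n
      rw [norm_sq_L2]
      have h2 : ∫ x, ‖(grad (q n) - (Complex.I * ξ n) • incl (q n) : L2) x‖ ^ 2 =
          ∫ x, ‖wavePacket (deriv χ) (s n / h n) (c n) (h n) (ξ n) x‖ ^ 2 := by
        refine integral_congr_ae ?_
        have e1 := coeFn_toL2 ((contDiff_wavePacket hχ (s n) (c n) (h n) (ξ n)).continuous_deriv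
          (by simp)) (hasCompactSupport_wavePacket hc (s n) (c n) (ξ n) (hh0 n)).deriv
        rw [← hq2 n] at e1
        filter_upwards [e1, rep_ae (q n), Lp.coeFn_sub (grad (q n)) ((Complex.I * ξ n) • incl (q n)),
          Lp.coeFn_smul (Complex.I * ξ n : ℂ) (incl (q n))] with x k1 k2 k3 k4
        rw [k3, Pi.sub_apply, k4, Pi.smul_apply, k1, k2, hq3, deriv_wavePacket hχ, smul_eq_mul,
          add_sub_cancel_right]
      rw [h2, integral_sq_norm_wavePacket _ _ _ _ (hh0 n), div_pow, hs2]
      have h3 := hh0 n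
      simp only [hh] at h3 ⊢
      field_simp
    have h2 : Tendsto (fun n => ‖grad (q n) - (Complex.I * ξ n) • incl (q n)‖ ^ 2) atTop (𝓝 0) := by
      simp_rw [h1]
      have := ((tendsto_one_div_add_atTop_nhds_zero_nat (𝕜 := ℝ)).pow 2).const_mul
        ((∫ x, deriv χ x ^ 2) / J)
      simpa using this
    have h3 := (Real.continuous_sqrt.tendsto 0).comp h2
    rw [Real.sqrt_zero] at h3
    refine tendsto_zero_iff_norm_tendsto_zero.2 (h3.congr fun n => ?_)
    simp [Real.sqrt_sq]
  · obtain ⟨N, hN⟩ := exists_nat_gt x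
    filter_upwards [eventually_ge_atTop N] with n hn
    rw [hq3]
    by_contra hne
    have h1 := (abs_lt.1 (hsup n x hne)).1
    have h3 : (N : ℝ) ≤ n := by exact_mod_cast hn
    have h4 : (0 : ℝ) ≤ n := n.cast_nonneg
    simp only [hcdef, hh] at h1
    nlinarith

/-! ### Points of the essential spectrum -/

section Points

variable {A : WithLp 2 (L2 × L2) →ₗ.[ℂ] WithLp 2 (L2 × L2)} {T : H1 →L[ℂ] H1}
  (hT : FormCompact T) {m ν : ℝ} (hν : ν ^ 2 ≤ 1) (hA : A.graph = blockRel T m ν)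

theorem norm_le_of_quasiMode (q : H1) (hq : ‖incl q‖ = 1) (ξ : ℝ) {C : ℝ}
    (hC : ‖grad q - (Complex.I * ξ) • incl q‖ ≤ C) : ‖grad q‖ ≤ C + |ξ| := by
  have h1 := norm_add_le (grad q - (Complex.I * ξ) • incl q) ((Complex.I * ξ) • incl q)
  rw [sub_add_cancel, norm_smul, hq, norm_mul, Complex.norm_I, Complex.norm_real, one_mul,
    mul_one, Real.norm_eq_abs] at h1
  linarith

theorem norm_le_incl_add_grad (w : H1) : ‖w‖ ≤ ‖incl w‖ + ‖grad w‖ := by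
  refine (abs_le_of_sq_le_sq' ?_ (by positivity)).2
  rw [sobolev_norm_sq]
  nlinarith [norm_nonneg (incl w), norm_nonneg (grad w)]

include hT hν hA in
/-- The spectrum of the symbol of the block operator without potential lies in its essential
spectrum. -/
theorem not_isFredholmAt_of_symbol {z a b : ℂ} {ξ : ℝ} (hab : ¬ (a = 0 ∧ b = 0))
    (h1 : (ξ ^ 2 + m ^ 2 - z) * a - Complex.I * ξ * ν * b = 0)
    (h2 : Complex.I * ξ * ν * a + (1 - z) * b = 0) : ¬ IsFredholmAt A z := by
  obtain ⟨q, hq, he, hr⟩ := exists_quasiModes fun _ => ξ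
  set e : ℕ → L2 := fun n => grad (q n) - (Complex.I * ξ) • incl (q n) with hedef
  have hg : ∀ n, grad (q n) = e n + (Complex.I * ξ) • incl (q n) := fun n =>
    (sub_add_cancel _ _).symm
  obtain ⟨C, hC⟩ := he.norm.bddAbove_range
  have hTq : Tendsto (fun n => T (q n)) atTop (𝓝 0) := by
    refine hT.tendsto_zero (C := 1 + (C + |ξ|)) (fun n => ?_) hr
    have k1 := norm_le_of_quasiMode (q n) (hq.1 n) ξ (hC ⟨n, rfl⟩)
    have k2 := norm_le_incl_add_grad (q n)
    have k3 : ‖incl (q n)‖ = 1 := hq.1 n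
    linarith
  refine not_isFredholmAt_of_singular hT hν hA (w := fun n => a • q n)
    (g := fun n => b • incl (q n)) ?_ ?_ hq hab ?_ ?_
  · have k : ∀ n, adjoint grad (grad (a • q n) + (ν : ℂ) • b • incl (q n)) +
        (m ^ 2 - z) • adjoint incl (incl (a • q n)) + T (a • q n) =
        a • adjoint grad (e n) - (Complex.I * ξ * a + ν * b) • adjoint incl (e n) +
          a • T (q n) := by
      intro n
      have k0 : adjoint grad (incl (q n)) =
          - (adjoint incl (e n) + (Complex.I * ξ) • adjoint incl (incl (q n))) := by
        rw [adjoint_grad_incl, hg, map_add, map_smul]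
      rw [map_smul, hg, map_smul, map_smul]
      simp only [map_add, map_smul, k0]
      rw [← sub_eq_zero]
      -- The terms without the quasi-mode error `e n` or the potential carry precisely the first row
      -- of the symbol applied to `(a, b)`.
      have k1 : ((ξ ^ 2 + m ^ 2 - z) * a - Complex.I * ξ * ν * b) •
          adjoint incl (incl (q n)) = 0 := by rw [h1, zero_smul]
      rw [← k1]
      match_scalars <;> ring_nf
      simp
    simp_rw [k]
    have k1 := ((adjoint grad).continuous.tendsto _).comp he
    have k2 := ((adjoint incl).continuous.tendsto _).comp he
    have k3 := ((k1.const_smul a).sub (k2.const_smul (Complex.I * ξ * a + ν * b))).add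
      (hTq.const_smul a)
    simp only [map_zero, smul_zero, sub_zero, add_zero] at k3
    exact k3
  · have k : ∀ n, (ν : ℂ) • grad (a • q n) + (1 - z) • b • incl (q n) = (ν * a) • e n := by
      intro n
      rw [map_smul, hg, ← sub_eq_zero]
      have k1 : (Complex.I * ξ * ν * a + (1 - z) * b) • incl (q n) = 0 := by rw [h2, zero_smul]
      rw [← k1]
      match_scalars <;> ring
    simp_rw [k]
    simpa using he.const_smul (ν * a : ℂ)
  · simp
  · simp

include hT hν hA in
-- The frequency tends to infinity. After division by it, `φ n` vanishes in `L²` while `φ n'` stays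
-- near `i q n`, so the mass sits in the second component.
theorem not_isFredholmAt_one_sub_sq : ¬ IsFredholmAt A (1 - ν ^ 2 : ℂ) := by
  obtain ⟨q, hq, he, hr⟩ := exists_quasiModes fun n => n + 1
  set ξ : ℕ → ℂ := fun n => n + 1 with hξ
  have hξ0 : ∀ n, ξ n ≠ 0 := fun n => Nat.cast_add_one_ne_zero n
  have hξn : ∀ n, ‖(ξ n)⁻¹‖ = 1 / (n + 1 : ℝ) := by
    intro n
    rw [norm_inv, one_div]
    congr 1
    have := Complex.norm_natCast (n + 1)
    push_cast at this
    exact this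
  have hξt : Tendsto (fun n => (ξ n)⁻¹) atTop (𝓝 0) := by
    rw [tendsto_zero_iff_norm_tendsto_zero]
    simp_rw [hξn]
    exact tendsto_one_div_add_atTop_nhds_zero_nat
  set e : ℕ → L2 := fun n => grad (q n) - (Complex.I * ξ n) • incl (q n) with hedef
  have he' : Tendsto e atTop (𝓝 0) := by
    refine he.congr fun n => ?_
    simp [hedef, hξ]
  set φ : ℕ → H1 := fun n => (ξ n)⁻¹ • q n with hφ
  have hgφ : ∀ n, grad (φ n) - Complex.I • incl (q n) = (ξ n)⁻¹ • e n := by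
    intro n
    simp only [hφ, hedef, map_smul, smul_sub, smul_smul]
    congr 2
    field_simp [hξ0 n]
  have hφ1 : Tendsto (fun n => incl (φ n)) atTop (𝓝 0) := by
    rw [tendsto_zero_iff_norm_tendsto_zero] at hξt ⊢
    refine hξt.congr fun n => ?_
    have k3 : ‖incl (q n)‖ = 1 := hq.1 n
    rw [hφ, map_smul, norm_smul, k3, mul_one]
  have hφ2 : Tendsto (fun n => grad (φ n) - Complex.I • incl (q n)) atTop (𝓝 0) := by
    simp_rw [hgφ]
    simpa using hξt.smul he'
  obtain ⟨C, hC⟩ := hφ2.norm.bddAbove_range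
  obtain ⟨C', hC'⟩ := hφ1.norm.bddAbove_range
  have hTφ : Tendsto (fun n => T (φ n)) atTop (𝓝 0) := by
    refine hT.tendsto_zero (C := C' + (C + 1)) (fun n => ?_) fun x => ?_
    · have k1 := norm_add_le (grad (φ n) - Complex.I • incl (q n)) (Complex.I • incl (q n))
      have k3 : ‖incl (q n)‖ = 1 := hq.1 n
      rw [sub_add_cancel, norm_smul, k3, Complex.norm_I, mul_one] at k1
      have k2 := norm_le_incl_add_grad (φ n)
      have k4 : ‖grad (φ n) - Complex.I • incl (q n)‖ ≤ C := hC ⟨n, rfl⟩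
      have k5 : ‖incl (φ n)‖ ≤ C' := hC' ⟨n, rfl⟩
      linarith
    · filter_upwards [hr x] with n hn
      rw [hφ, rep_smul, Pi.smul_apply, hn, smul_zero]
  -- With `w = -ν φ` and `g = φ'`, both `w' + ν g` and the second row at `z = 1 - ν²` vanish
  -- identically. Only lower order terms in `φ` and the potential remain.
  refine not_isFredholmAt_of_singular hT hν hA (w := fun n => -(ν : ℂ) • φ n)
    (g := fun n => grad (φ n)) (a := 0) (b := Complex.I) ?_ ?_ hq (by simp) ?_ ?_
  · have k : ∀ n, adjoint grad (grad (-(ν : ℂ) • φ n) + (ν : ℂ) • grad (φ n)) +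
        (m ^ 2 - (1 - ν ^ 2) : ℂ) • adjoint incl (incl (-(ν : ℂ) • φ n)) + T (-(ν : ℂ) • φ n) =
        (-(m ^ 2 - (1 - ν ^ 2)) * ν : ℂ) • adjoint incl (incl (φ n)) + (-(ν : ℂ)) • T (φ n) := by
      intro n
      simp only [map_smul, map_add]
      match_scalars <;> ring
    simp_rw [k]
    have k3 := ((((adjoint incl).continuous.tendsto _).comp hφ1).const_smul
      (-(m ^ 2 - (1 - ν ^ 2)) * ν : ℂ)).add (hTφ.const_smul (-(ν : ℂ)))
    simp only [map_zero, smul_zero, add_zero] at k3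
    exact k3
  · have k : ∀ n, (ν : ℂ) • grad (-(ν : ℂ) • φ n) + (1 - (1 - ν ^ 2) : ℂ) • grad (φ n) = 0 := by
      intro n
      rw [map_smul]
      match_scalars
      ring
    simp_rw [k]
    exact tendsto_const_nhds
  · have := hφ1.const_smul (-(ν : ℂ))
    simp only [map_smul, zero_smul, sub_zero]
    rwa [smul_zero] at this
  · exact hφ2

end Points

/-! ### The essential spectrum -/

/-- The relation is the characteristic equation of the Hermitian symbol with `t = ξ²`. For `t > 0`
it is a quadratic in `z` with discriminant `(t (m² - 1) + 1)² + 4 t ν² ≥ 0`; a nonreal root would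
make that negative. -/
theorem im_eq_zero_of_symbol {m ν t : ℝ} (ht : 0 ≤ t) {z : ℂ}
    (h : (1 - ν ^ 2 - z) + t * ((m ^ 2 - z) * (1 - z)) = 0) : z.im = 0 := by
  have hre := congrArg Complex.re h
  have him := congrArg Complex.im h
  simp [pow_two] at hre him
  by_contra hy
  have h1 : t * (2 * z.re - m ^ 2 - 1) = 1 := by
    refine mul_right_cancel₀ hy ?_
    linear_combination him
  have h2 : t ^ 2 * z.im ^ 2 = -((t * (m ^ 2 - 1) + 1) ^ 2 + 4 * t * ν ^ 2) / 4 := by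
    linear_combination (-t) * hre + (t * z.re / 2 - t * (m ^ 2 + 1) / 4 - 1 / 4) * h1
  have h3 : t ≠ 0 := fun h0 => by simp [h0] at h1
  have h4 : 0 < t ^ 2 * z.im ^ 2 := by positivity
  have h5 : 0 ≤ 4 * t * ν ^ 2 := by positivity
  nlinarith [sq_nonneg (t * (m ^ 2 - 1) + 1)]

theorem essentialSpectrum_eq {A : WithLp 2 (L2 × L2) →ₗ.[ℂ] WithLp 2 (L2 × L2)}
    {T : H1 →L[ℂ] H1} (hT : FormCompact T) {m ν : ℝ} (hν : ν ^ 2 ≤ 1)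
    (hA : A.graph = blockRel T m ν) :
    essentialSpectrum A =
      Complex.ofReal '' {x | 0 ≤ (x - m ^ 2) * (x - 1) * (x - (1 - ν ^ 2))} := by
  ext z
  constructor
  · intro hz
    by_contra hzE
    have hne : ∀ x : ℝ, 0 ≤ (x - m ^ 2) * (x - 1) * (x - (1 - ν ^ 2)) → z ≠ x :=
      fun x hx h => hzE ⟨x, hx, h.symm⟩
    have h1 : z ≠ 1 := by simpa using hne 1 (by simp)
    have h2 : z ≠ 1 - ν ^ 2 := by exact_mod_cast hne (1 - ν ^ (2 : ℕ)) (by simp)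
    have h3 : z ≠ m ^ 2 := by exact_mod_cast hne (m ^ (2 : ℕ)) (by simp)
    have h1' : 1 - z ≠ 0 := sub_ne_zero.2 h1.symm
    refine hz (isFredholmAt_of_isFredholm_schurOp hA h1 (hT.isFredholm_formOp ?_
      (sub_ne_zero.2 h3.symm) ?_))
    · intro h
      apply h2
      field_simp at h
      linear_combination -h
    -- If the coefficients are opposite, `z` solves the symbol equation with `ξ² = t`; hence it is
    -- real, and the cubic equals `t` times a square.
    · intro t ht h
      have h4 : (1 - ν ^ 2 - z) + t * ((m ^ 2 - z) * (1 - z)) = 0 := by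
        field_simp at h
        linear_combination h
      have h5 : z = (z.re : ℂ) :=
        Complex.ext rfl (by rw [im_eq_zero_of_symbol ht h4, Complex.ofReal_im])
      refine hne z.re ?_ h5
      rw [h5] at h4
      have h6 : (1 - ν ^ 2 - z.re) + t * ((m ^ 2 - z.re) * (1 - z.re)) = 0 := by
        exact_mod_cast h4
      have h7 : z.re - (1 - ν ^ 2) = t * ((z.re - m ^ 2) * (z.re - 1)) := by
        linear_combination -h6
      rw [h7]
      have : 0 ≤ t * ((z.re - m ^ 2) * (z.re - 1)) ^ 2 := by positivity
      linarith
  · rintro ⟨x, hx, rfl⟩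
    have hx' : 0 ≤ (x - m ^ 2) * (x - 1) * (x - (1 - ν ^ 2)) := hx
    change ¬ IsFredholmAt A x
    by_cases h1 : x = 1 - ν ^ 2
    · rw [h1]
      simpa using not_isFredholmAt_one_sub_sq hT hν hA
    by_cases h2 : x = 1
    -- At zero frequency the symbol is diagonal and `(0, 1)` has eigenvalue `1`.
    · refine not_isFredholmAt_of_symbol hT hν hA (a := 0) (b := 1) (ξ := 0) (by simp) (by simp) ?_
      simp [h2]
    · have h3 : x - (1 - ν ^ 2) ≠ 0 := sub_ne_zero.2 h1
      set r := (x - m ^ 2) * (x - 1) / (x - (1 - ν ^ 2)) with hr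
      have hr0 : 0 ≤ r := by
        have : r = (x - m ^ 2) * (x - 1) * (x - (1 - ν ^ 2)) / (x - (1 - ν ^ 2)) ^ 2 := by
          rw [hr]; field_simp
        rw [this]
        positivity
      have h4 : (√r) ^ 2 * (x - (1 - ν ^ 2)) = (x - m ^ 2) * (x - 1) := by
        rw [Real.sq_sqrt hr0, hr, div_mul_cancel₀ _ h3]
      have h5 : ((√r : ℝ) : ℂ) ^ 2 * (x - (1 - ν ^ 2)) = (x - m ^ 2) * (x - 1) := by
        exact_mod_cast h4
      -- Here `r` is the squared frequency at which the determinant vanishes, and `(1 - x, -iν√r)`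
      -- solves the second row of the symbol; its first entry is nonzero since `x ≠ 1`.
      refine not_isFredholmAt_of_symbol hT hν hA (a := 1 - x) (b := -Complex.I * ν * √r)
        (ξ := √r) (fun h => h2 ?_) ?_ (by ring)
      · exact_mod_cast (sub_eq_zero.1 h.1).symm
      · linear_combination -h5 + (√r : ℂ) ^ 2 * ν ^ 2 * Complex.I_sq

theorem setOf_nonneg_cubic {a b c : ℝ} (hab : a ≤ b) (hbc : b ≤ c) :
    {x : ℝ | 0 ≤ (x - a) * (x - b) * (x - c)} = Icc a b ∪ Ici c := by
  ext x
  rw [mem_ofPred_eq, mem_union, mem_Icc, mem_Ici]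
  constructor
  · intro h
    by_contra! hne
    obtain ⟨h1, h2⟩ := hne
    rcases lt_or_ge x a with hx | hx
    · have := mul_neg_of_pos_of_neg (mul_pos_of_neg_of_neg (sub_neg.2 hx)
        (sub_neg.2 (hx.trans_le hab))) (sub_neg.2 h2)
      linarith
    · have hbx := h1 hx
      have := mul_neg_of_pos_of_neg (mul_pos (sub_pos.2 (hab.trans_lt hbx)) (sub_pos.2 hbx))
        (sub_neg.2 h2)
      linarith
  · rintro (⟨h1, h2⟩ | h)
    · exact mul_nonneg_of_nonpos_of_nonpos
        (mul_nonpos_of_nonneg_of_nonpos (sub_nonneg.2 h1) (sub_nonpos.2 h2))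
        (sub_nonpos.2 (h2.trans hbc))
    · exact mul_nonneg (mul_nonneg (sub_nonneg.2 (hab.trans (hbc.trans h)))
        (sub_nonneg.2 (hbc.trans h))) (sub_nonneg.2 h)

end GinzburgLandau

theorem corollary4p3 (m ν : ℝ) (V : ℝ → ℝ) (hm : 0 < m) (hν : -1 < ν ∧ ν < 1)
    (hV : LocallyIntegrable V volume)
    (hV0 : Tendsto (fun x : ℝ => ∫ t in x..(x + 1), |V t|) (cocompact ℝ) (𝓝 0))
    (h0 : (0 : ℂ) ∈ GinzburgLandau.resolventSet (GinzburgLandau.schrodinger m V)) :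
    -- the domain and the closure of the block operator make sense
    (GinzburgLandau.schrodinger m V).domain ≤ GinzburgLandau.derivOp.domain ∧
    (GinzburgLandau.preOperator m ν V).IsClosable ∧
    -- the essential spectrum
    (1 ≤ m →
      GinzburgLandau.essentialSpectrum (GinzburgLandau.blockOperator m ν V) =
        Complex.ofReal '' (Icc (1 - ν ^ 2) 1 ∪ Ici (m ^ 2))) ∧
    (1 - ν ^ 2 ≤ m ^ 2 → m ^ 2 < 1 →
      GinzburgLandau.essentialSpectrum (GinzburgLandau.blockOperator m ν V) =
        Complex.ofReal '' (Icc (1 - ν ^ 2) (m ^ 2) ∪ Ici 1)) ∧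
    (m ^ 2 < 1 - ν ^ 2 →
      GinzburgLandau.essentialSpectrum (GinzburgLandau.blockOperator m ν V) =
        Complex.ofReal '' (Icc (m ^ 2) (1 - ν ^ 2) ∪ Ici 1)) := by
  have hν' : ν ^ 2 ≤ 1 := by nlinarith [hν.1, hν.2]
  have hν0 : 1 - ν ^ 2 ≤ 1 := by linarith [sq_nonneg ν]
  have hess := GinzburgLandau.essentialSpectrum_eq (GinzburgLandau.formCompact_potentialOp hV hV0)
    hν' (GinzburgLandau.graph_blockOperator hV hV0 h0 hν')
  refine ⟨GinzburgLandau.domain_schrodinger_le hV hV0 h0,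
    GinzburgLandau.isClosable_preOperator hV hV0 h0 hν', fun h1 => ?_, fun h1 h2 => ?_, fun h1 => ?_⟩
  · rw [hess, ← GinzburgLandau.setOf_nonneg_cubic hν0 (by nlinarith : (1 : ℝ) ≤ m ^ 2)]
    congr! 4
    ring
  · rw [hess, ← GinzburgLandau.setOf_nonneg_cubic h1 h2.le]
    congr! 4
    ring
  · rw [hess, ← GinzburgLandau.setOf_nonneg_cubic h1.le hν0]
    congr! 4
    ring
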